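/- **Setting.** For a function $g:\mathbb R^2\to\mathbb R$ write $g^{(i,j)}=\partial_1^i\partial_2^j g$, $d^2g=(g^{(2,0)},g^{(1,1)},g^{(0,2)})$, and $$V_g=G(d^2g),\qquad \lambda_{2,g}=J(d^2g),$$ $$G(u,v,w)=\begin{pmatrix}2u-2w+2v-2\sqrt{(w-u)^2+4v^2}\\ w-u+4v-\sqrt{(w-u)^2+4v^2}\end{pmatrix},\qquad J(u,v,w)=\tfrac12\Big(u+w-\sqrt{(u-w)^2+4v^2}\Big),$$ so that $\lambda_{2,g}$ is the smaller eigenvalue of the Hessian $\nabla^2 g$ and $\nabla^2g\,V_g=\lambda_{2,g}V_g$. Let $t\mapsto X_{g,x_0}(t)$, $t\in\mathbb R$, be the integral curve $\frac{d}{dt}X_{g,x_0}(t)=V_g(X_{g,x_0}(t))$, $X_{g,x_0}(0)=x_0$, and let $\Theta_{g,x_0}=\{t\in\mathbb R:\langle\nabla g,V_g\rangle=0 \text{ and } \lambda_{2,g}<0 \text{ at the point } X_{g,x_0}(t)\}$. Let $f:\mathbb R^2\to[0,\infty)$ be a density, $\mathcal H,\mathcal L\subset\mathbb R^2$, $a^*>0$.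 Write $V=V_f$, $\lambda_2=\lambda_{2,f}$, $X_{x_0}=X_{f,x_0}$, $\Theta_{x_0}=\Theta_{f,x_0}$, $\theta_{x_0}=\operatorname{argmin}\{|t|:t\in\Theta_{x_0}\}$ and $\mathcal G=\{X_{x_0}(t):x_0\in\mathcal L,\ -a^*\le t\le a^*\}$. Let $X_1,X_2,\dots$ be i.i.d. with density $f$, let $\hat f(x)=\frac1{nh^2}\sum_{i=1}^nK\big(\frac{x-X_i}{h}\big)$ with $h=h_n>0$, let $\hat X_{x_0}=X_{\hat f,x_0}$, $\hat\Theta_{x_0}=\Theta_{\hat f,x_0}$, and let $\hat\theta_{x_0}$ be a minimizer of $|t|$ over $t\in\hat\Theta_{x_0}$ if there is one (any of them if there are several), and $\hat\theta_{x_0}=0$ if $\hat\Theta_{x_0}=\emptyset$ (if $\hat\Theta_{x_0}\neq\emptyset$ has no minimizer, $\hat\theta_{x_0}$ is arbitrary). **Assumptions.** - (F1) $f$ is a four times continuously differentiable density; its partial derivatives of orders one to four are bounded. - (F2) $\mathcal H$ is compact, $f>0$ on an open $\epsilon_0$-neighbourhood of $\mathcal H$ for some $\epsilon_0>0$, and $\nabla^2f(x)$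 has two distinct eigenvalues for every $x\in\mathcal H$. - (F3) $\mathcal L\subset\mathcal H$ is compact, $\mathcal G\subset\mathcal H$, for every $x_0\in\mathcal G$ the minimizer $\theta_{x_0}$ exists and is unique, and $\mathcal L=\{X_{x_0}(\theta_{x_0}):x_0\in\mathcal G\}$. - (F4) There is $\gamma>0$ with $\big\|\frac1{u-s}\int_s^uV(X_{x_0}(r))\,dr\big\|\ge\gamma$ for all $x_0\in\mathcal L$ and $-a^*\le s<u\le a^*$. - (F5) $\big\langle\nabla\langle\nabla f,V\rangle(x),V(x)\big\rangle\ne0$ for all $x\in\mathcal L$. - (F6) No point $x\in\mathcal H$, and no point $x=X_{x_0}(t)$ with $x_0\in\mathcal G$ and $|t|\le|\theta_{x_0}|$, satisfies both $\lambda_2(x)=0$ and $\langle\nabla f(x),V(x)\rangle=0$. - (K1) $K$ is a four times differentiable probability density on $\mathbb R^2$ with $K(-x)=K(x)$, its (closed) support is the closed unit ball, its partial derivatives of orders one to four are bounded, and $\int K(x)xx^T\,dx=\mu_2(K)I_{2\times2}$ for some $\mu_2(K)<\infty$. - (K2) The matrix $\int d^2K(x)\,d^2K(x)^T\,dx$ is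 finite. - (H1) As $n\to\infty$: $h_n\to0$, $nh_n^8/(\log n)^3\to\infty$, and $nh_n^9\to\beta$ for some $\beta\ge0$. **Theorem.** Under (F1)–(F6), (K1)–(K2) and (H1), $$\sup_{x_0\in\mathcal G}\Big\|\big[\hat X_{x_0}(\hat\theta_{x_0})-X_{x_0}(\theta_{x_0})\big]-V(X_{x_0}(\theta_{x_0}))\,\big[\hat\theta_{x_0}-\theta_{x_0}\big]\Big\|=O_p\Big(\sqrt{\tfrac{\log n}{nh^5}}\Big),$$ where $Y_n=O_p(r_n)$ means: for every $\varepsilon>0$ there is $M>0$ such that the (outer) probability of $\{Y_n>Mr_n\}$ is at most $\varepsilon$ for all sufficiently large $n$. -/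

import Mathlib

open MeasureTheory ProbabilityTheory Filter Topology
open scoped ENNReal

noncomputable section

namespace Filament

/-- The Euclidean plane. -/
abbrev E2 : Type := EuclideanSpace ℝ (Fin 2)

/-! ### Derivatives, second eigenvector and second eigenvalue -/

/-- The partial derivative of `g` in the `i`-th coordinate direction. -/
def dirDeriv (i : Fin 2) (g : E2 → ℝ) : E2 → ℝ :=
  fun x => fderiv ℝ g x (EuclideanSpace.single i 1)

/-- The partial derivative `g^(i,j)`: `i` times in the first, `j` times in the second coordinate. -/
def partialDeriv (i j : ℕ) (g : E2 → ℝ) : E2 → ℝ :=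
  (dirDeriv 0)^[i] ((dirDeriv 1)^[j] g)

/-- The Hessian matrix of `g`. -/
def hessian (g : E2 → ℝ) (x : E2) : Matrix (Fin 2) (Fin 2) ℝ :=
  !![partialDeriv 2 0 g x, partialDeriv 1 1 g x; partialDeriv 1 1 g x, partialDeriv 0 2 g x]

/-- The vector `d²g = (g^(2,0), g^(1,1), g^(0,2))`. -/
def d2 (g : E2 → ℝ) (x : E2) : Fin 3 → ℝ :=
  ![partialDeriv 2 0 g x, partialDeriv 1 1 g x, partialDeriv 0 2 g x]

/-- The map `G` sending `(u, v, w)` to an element of the eigenspace of the symmetric matrix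
`(u v; v w)` that belongs to its smaller eigenvalue. -/
def eigG (p : Fin 3 → ℝ) : E2 :=
  !₂[2 * p 0 - 2 * p 2 + 2 * p 1 - 2 * √((p 2 - p 0) ^ 2 + 4 * p 1 ^ 2),
     p 2 - p 0 + 4 * p 1 - √((p 2 - p 0) ^ 2 + 4 * p 1 ^ 2)]

/-- The smaller eigenvalue of the symmetric matrix `(u v; v w)`. -/
def eigJ (p : Fin 3 → ℝ) : ℝ :=
  (p 0 + p 2 - √((p 0 - p 2) ^ 2 + 4 * p 1 ^ 2)) / 2

/-- The vector field `V = G(d²g)` of second eigenvectors of the Hessian of `g`. -/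
def eigField (g : E2 → ℝ) (x : E2) : E2 := eigG (d2 g x)

/-- The second eigenvalue `λ₂ = J(d²g)` of the Hessian of `g`. -/
def lam2 (g : E2 → ℝ) (x : E2) : ℝ := eigJ (d2 g x)

/-- The function `⟨∇g, V⟩`. -/
def slope (g : E2 → ℝ) (x : E2) : ℝ := inner ℝ (gradient g x) (eigField g x)

/-! ### Integral curves and filament times -/

/-- `γ` solves `γ' = W(γ)` on the whole real line, with `γ(0) = x₀`. -/
def IsSolution (W : E2 → E2) (x₀ : E2) (γ : ℝ → E2) : Prop :=
  γ 0 = x₀ ∧ ∀ t : ℝ, HasDerivAt γ (W (γ t)) t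

open Classical in
/-- The integral curve of `W` starting at `x₀`. (For a Lipschitz field `W` it exists and is
unique, so that the choice and the default value play no role.) -/
def integralCurve (W : E2 → E2) (x₀ : E2) : ℝ → E2 :=
  if hex : ∃ γ : ℝ → E2, IsSolution W x₀ γ then hex.choose else fun _ => x₀

/-- The integral curve `X_{x₀}` driven by the second eigenvectors of the Hessian of `g`. -/
def curve (g : E2 → ℝ) (x₀ : E2) : ℝ → E2 := integralCurve (eigField g) x₀

/-- The set `Θ_{x₀}` of times at which `X_{x₀}` is at a filament point of `g`. -/
def filTimes (g : E2 → ℝ) (x₀ : E2) : Set ℝ :=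
  {t | slope g (curve g x₀ t) = 0 ∧ lam2 g (curve g x₀ t) < 0}

/-- `t` minimizes `|t|` over `S`. -/
def IsNearest (S : Set ℝ) (t : ℝ) : Prop := t ∈ S ∧ ∀ s ∈ S, |t| ≤ |s|

open Classical in
/-- The time `θ_{x₀} = argmin {|t| : t ∈ Θ_{x₀}}`; it is used only where the minimizer exists
and is unique. -/
def theta (g : E2 → ℝ) (x₀ : E2) : ℝ :=
  if hex : ∃ t, IsNearest (filTimes g x₀) t then hex.choose else 0

/-- `t` is an admissible value of `argmin {|t| : t ∈ S}`: some minimizer if there is one, and `0`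
if `S` is empty. (Nothing is demanded of `t` if `S` is nonempty without a minimizer.) -/
def IsArgminOrZero (S : Set ℝ) (t : ℝ) : Prop :=
  ((∃ s, IsNearest S s) → IsNearest S t) ∧ (S = ∅ → t = 0)

/-- The set `𝒢(ℒ, a) = {X_{x₀}(t) : x₀ ∈ ℒ, -a ≤ t ≤ a}` of starting points. -/
def startSet (f : E2 → ℝ) (L : Set E2) (a : ℝ) : Set E2 :=
  {x | ∃ y ∈ L, ∃ t : ℝ, -a ≤ t ∧ t ≤ a ∧ x = curve f y t}

/-! ### The kernel density estimator -/

/-- The kernel density estimator with bandwidth `h` from the first `n` terms of the sample. -/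
def kde (K : E2 → ℝ) (n : ℕ) (h : ℝ) (X : ℕ → E2) (x : E2) : ℝ :=
  1 / ((n : ℝ) * h ^ 2) * ∑ i ∈ Finset.range n, K (h⁻¹ • (x - X i))

/-! ### Assumptions -/

/-- All partial derivatives of `g` of orders one to four are bounded. -/
def BoundedPartials (g : E2 → ℝ) : Prop :=
  ∀ i j : ℕ, 1 ≤ i + j → i + j ≤ 4 → ∃ C : ℝ, ∀ x, |partialDeriv i j g x| ≤ C

/-- `g` is a probability density function on the plane. -/
def IsDensity (g : E2 → ℝ) : Prop := (∀ x, 0 ≤ g x) ∧ Integrable g ∧ ∫ x, g x = 1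

/-- `f` is a four times continuously differentiable density with bounded derivatives. -/
def SmoothDensity (f : E2 → ℝ) : Prop :=
  IsDensity f ∧ ContDiff ℝ 4 f ∧ BoundedPartials f

/-- `H` is compact, `f` is positive on a neighbourhood of `H`, and the Hessian of `f` has two
distinct eigenvalues at every point of `H`. -/
def RegularRegion (f : E2 → ℝ) (H : Set E2) : Prop :=
  IsCompact H ∧ (∃ ε₀ > 0, ∀ x ∈ Metric.thickening ε₀ H, 0 < f x) ∧
    ∀ x ∈ H, ∃ l₁ l₂ : ℝ, l₁ ≠ l₂ ∧
      Module.End.HasEigenvalue (Matrix.toLin' (hessian f x)) l₁ ∧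
      Module.End.HasEigenvalue (Matrix.toLin' (hessian f x)) l₂

/-- `L` is a compact filament in `H`, the set `𝒢` of starting points lies in `H`, `θ_{x₀}` exists
and is unique for each `x₀ ∈ 𝒢`, and `L` consists of the points `X_{x₀}(θ_{x₀})`. -/
def CompactFilament (f : E2 → ℝ) (H L : Set E2) (a : ℝ) : Prop :=
  0 < a ∧ IsCompact L ∧ L ⊆ H ∧ startSet f L a ⊆ H ∧
    (∀ x₀ ∈ startSet f L a, ∃! t, IsNearest (filTimes f x₀) t) ∧
    L = {x | ∃ x₀ ∈ startSet f L a, x = curve f x₀ (theta f x₀)}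

/-- The mean velocities along the integral curves through `L` are bounded away from zero. -/
def MeanVelocityBound (f : E2 → ℝ) (L : Set E2) (a : ℝ) : Prop :=
  ∃ γ > 0, ∀ x₀ ∈ L, ∀ s u : ℝ, -a ≤ s → s < u → u ≤ a →
    γ ≤ ‖(1 / (u - s)) • ∫ r in s..u, eigField f (curve f x₀ r)‖

/-- `⟨∇⟨∇f, V⟩, V⟩ ≠ 0` on `L`. -/
def TransversalOn (f : E2 → ℝ) (L : Set E2) : Prop :=
  ∀ x ∈ L, inner ℝ (gradient (slope f) x) (eigField f x) ≠ 0

/-- The arcs `X_{x₀}(t)`, `|t| ≤ |θ_{x₀}|`, that are searched, from starting points in `𝒢`, until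
the filament is found. -/
def searchedArcs (f : E2 → ℝ) (L : Set E2) (a : ℝ) : Set E2 :=
  {x | ∃ x₀ ∈ startSet f L a, ∃ t : ℝ, |t| ≤ |theta f x₀| ∧ x = curve f x₀ t}

/-- No point of `S` is degenerate, in the sense that `λ₂ = 0` and `⟨∇f, V⟩ = 0`. -/
def NoDegeneratePoint (f : E2 → ℝ) (S : Set E2) : Prop :=
  {x ∈ S | lam2 f x = 0 ∧ slope f x = 0} = ∅

/-- `K` is a symmetric density with support the unit ball, four times differentiable with bounded
partial derivatives, and its matrix of second moments is a multiple of the identity. -/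
def KernelRegular (K : E2 → ℝ) : Prop :=
  IsDensity K ∧ (∀ x, K (-x) = K x) ∧ tsupport K = Metric.closedBall 0 1 ∧
    (ContDiff ℝ 3 K ∧ Differentiable ℝ (iteratedFDeriv ℝ 3 K)) ∧ BoundedPartials K ∧
    ∃ μ₂ : ℝ, ∀ i j : Fin 2, ∫ x : E2, K x * (x i * x j) = if i = j then μ₂ else 0

/-- The matrix `∫ d²K (d²K)ᵀ` is finite. -/
def KernelSquareIntegrable (K : E2 → ℝ) : Prop :=
  ∀ i j : Fin 3, Integrable (fun x : E2 => d2 K x i * d2 K x j)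

/-- `h n > 0`, `h n → 0`, `n h⁸ / (log n)³ → ∞` and `n h⁹ → β` for some `β ≥ 0`. -/
def BandwidthRates (h : ℕ → ℝ) : Prop :=
  (∀ n, 0 < h n) ∧ Tendsto h atTop (𝓝 0) ∧
    Tendsto (fun n : ℕ => (n : ℝ) * h n ^ 8 / Real.log n ^ 3) atTop atTop ∧
    ∃ β : ℝ, 0 ≤ β ∧ Tendsto (fun n : ℕ => (n : ℝ) * h n ^ 9) atTop (𝓝 β)

/-- `X 0, X 1, …` are independent with common density `f`. -/
def IsSample {Ω : Type*} [MeasurableSpace Ω] (μ : Measure Ω) (X : ℕ → Ω → E2)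
    (f : E2 → ℝ) : Prop :=
  (∀ i, Measurable (X i)) ∧ iIndepFun X μ ∧
    ∀ i, μ.map (X i) = (volume : Measure E2).withDensity (fun x => ENNReal.ofReal (f x))

/-- `Y n = O_p(r n)`. (On sets that are not measurable `μ` is the outer measure, so that nothing
is assumed on the measurability of `Y n`.) -/
def IsBigOInProb {Ω : Type*} [MeasurableSpace Ω] (μ : Measure Ω) (Y : ℕ → Ω → ℝ≥0∞)
    (r : ℕ → ℝ) : Prop :=
  ∀ ε : ℝ, 0 < ε → ∃ M : ℝ, 0 < M ∧ ∀ᶠ n in atTop,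
    μ {ω | ENNReal.ofReal (M * r n) < Y n ω} ≤ ENNReal.ofReal ε

end Filament

end

noncomputable section

namespace Filament

/-! ### Iterated partial derivatives -/

section

/-! Write g for the estimator, t for the estimated time, θ for the true one, and δ for the error of
the derivatives of g of orders one and two, uniform on a large ball. The quantity to bound is
[X_g(t) - X_f(t)] + [X_f(t) - X_f(θ) - (t - θ) V(X_f(θ))].

The second bracket is a Taylor remainder, O(|t - θ|²). Transversality, nondegeneracy and compactness
of the set of starting points make the nearest filament time stable, so that |t - θ| = O(δ)
uniformly (`argmin_stability`, `argmin_uniform`). Here δ is of order √(log n / (n h⁶)) + h², which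
alone is too slow; but only δ² enters, and δ² is within the claimed rate.

The first bracket cannot be bounded through δ. A Gronwall argument
(`norm_sub_le_of_integral_field_sub`) bounds it by the integrals of V_g - V_f along the true curves,
provided that V_g has a bounded Lipschitz constant, which holds because the third derivatives of g
stay bounded when n h⁸ / log n → ∞. The eigenvalue gap is bounded below on the arcs, so G linearizes
with error O(δ²) (`norm_integral_eigG_sub_le`), and weighted integrals of d²g - d²f along arcs
remain.

These integrals gain one power of h. Up to bias each is a centred sample mean of `arcKern`. By the
mean velocity bound an arc spends time O(h) in a ball of radius h, so this function is O(h⁻³) in sup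
norm and O(h⁻²) in L¹(f), and its second moment is O(h⁻⁵), against h⁻⁶ for a second derivative at a
point. A Bernstein-type inequality with a union bound over a polynomially large net
(`uniform_sampleDev_le`) yields √(log n / (n h⁵)) uniformly. The bias is O(h²) by symmetry of K, and
it is absorbed because n h⁹ is bounded.

`filament_deviation_le` is the deterministic combination; `whp_filament_deviation_le` inserts the
stochastic rates. -/

/-- The iterated partial derivative of `g` along a list of coordinate directions. -/
def mixedDeriv : List (Fin 2) → (E2 → ℝ) → E2 → ℝ
  | [], g => g
  | i :: l, g => dirDeriv i (mixedDeriv l g)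

/-- All mixed derivatives of order at most three are differentiable. -/
def DiffFour (g : E2 → ℝ) : Prop :=
  ∀ l : List (Fin 2), l.length ≤ 3 → Differentiable ℝ (mixedDeriv l g)

theorem fderiv_apply_eq_dirDeriv (g : E2 → ℝ) (x v : E2) :
    fderiv ℝ g x v = v 0 * dirDeriv 0 g x + v 1 * dirDeriv 1 g x := by
  have hv : v = v 0 • EuclideanSpace.single 0 (1 : ℝ) + v 1 • EuclideanSpace.single 1 (1 : ℝ) := by
    ext i; fin_cases i <;> simp
  conv_lhs => rw [hv]
  simp [dirDeriv]

theorem norm_fderiv_le_dirDeriv {g : E2 → ℝ} {x : E2} {B : ℝ}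
    (hB : ∀ i, |dirDeriv i g x| ≤ B) : ‖fderiv ℝ g x‖ ≤ 2 * B := by
  have hB0 : 0 ≤ B := (abs_nonneg _).trans (hB 0)
  refine ContinuousLinearMap.opNorm_le_bound _ (by positivity) fun v => ?_
  rw [fderiv_apply_eq_dirDeriv, Real.norm_eq_abs]
  have h0 : |v 0| ≤ ‖v‖ := by simpa using PiLp.norm_apply_le v 0
  have h1 : |v 1| ≤ ‖v‖ := by simpa using PiLp.norm_apply_le v 1
  calc |v 0 * dirDeriv 0 g x + v 1 * dirDeriv 1 g x|
      ≤ |v 0| * |dirDeriv 0 g x| + |v 1| * |dirDeriv 1 g x| := by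
        rw [← abs_mul, ← abs_mul]; exact abs_add_le _ _
    _ ≤ ‖v‖ * B + ‖v‖ * B := by gcongr <;> apply hB
    _ = 2 * B * ‖v‖ := by ring

theorem abs_sub_le_of_dirDeriv {g : E2 → ℝ} {s : Set E2} (hs : Convex ℝ s) {B : ℝ}
    (hg : Differentiable ℝ g) (hB : ∀ x ∈ s, ∀ i, |dirDeriv i g x| ≤ B) {x y : E2}
    (hx : x ∈ s) (hy : y ∈ s) : |g x - g y| ≤ 2 * B * ‖x - y‖ := by
  have := hs.norm_image_sub_le_of_norm_fderiv_le (fun z _ => hg z)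
    (fun z hz => norm_fderiv_le_dirDeriv (hB z hz)) hy hx
  simpa using this

theorem ContDiff.dirDeriv {g : E2 → ℝ} {m n : WithTop ℕ∞} (hg : ContDiff ℝ n g) (hmn : m + 1 ≤ n)
    (i : Fin 2) : ContDiff ℝ m (dirDeriv i g) :=
  (hg.fderiv_right hmn).clm_apply contDiff_const

theorem ContDiff.mixedDeriv {g : E2 → ℝ} {n : ℕ} (hg : ContDiff ℝ n g) (l : List (Fin 2)) (m : ℕ)
    (h : l.length + m ≤ n) : ContDiff ℝ m (mixedDeriv l g) := by
  induction l generalizing m with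
  | nil => exact hg.of_le (by simpa using h)
  | cons i l ih =>
    refine ContDiff.dirDeriv (ih (m + 1) ?_) (by norm_cast) i
    simp at h; omega

/-- Differentiability of both first partials makes `fderiv ℝ g` differentiable, and this suffices
for symmetry of the second derivative; continuity is not needed. The kernel is four times
differentiable, but its fourth derivatives need not be continuous. -/
theorem dirDeriv_comm {g : E2 → ℝ} (hg : Differentiable ℝ g)
    (hg' : ∀ i, Differentiable ℝ (dirDeriv i g)) :
    dirDeriv 1 (dirDeriv 0 g) = dirDeriv 0 (dirDeriv 1 g) := by
  have hd : Differentiable ℝ (fderiv ℝ g) := by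
    have : fderiv ℝ g = fun x => dirDeriv 0 g x • (EuclideanSpace.proj 0 : E2 →L[ℝ] ℝ)
        + dirDeriv 1 g x • (EuclideanSpace.proj 1 : E2 →L[ℝ] ℝ) := by
      ext x v
      rw [fderiv_apply_eq_dirDeriv]
      simp [mul_comm]
    rw [this]
    exact ((hg' 0).smul_const _).add ((hg' 1).smul_const _)
  ext x
  have h2 := second_derivative_symmetric (𝕜 := ℝ) (fun y => (hg y).hasFDerivAt)
    ((hd x).hasFDerivAt) (EuclideanSpace.single 1 (1 : ℝ)) (EuclideanSpace.single 0 (1 : ℝ))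
  have key : ∀ i j : Fin 2, dirDeriv i (dirDeriv j g) x =
      fderiv ℝ (fderiv ℝ g) x (EuclideanSpace.single i (1 : ℝ))
        (EuclideanSpace.single j (1 : ℝ)) := by
    intro i j
    have : HasFDerivAt (dirDeriv j g) _ x :=
      (hd x).hasFDerivAt.clm_apply (hasFDerivAt_const (EuclideanSpace.single j (1 : ℝ)) x)
    rw [dirDeriv, this.fderiv]
    simp
  rw [key, key, h2]

theorem partialDeriv_succ_left (i j : ℕ) (g : E2 → ℝ) :
    partialDeriv (i + 1) j g = dirDeriv 0 (partialDeriv i j g) := by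
  simp [partialDeriv, Function.iterate_succ_apply']

theorem partialDeriv_zero_succ (j : ℕ) (g : E2 → ℝ) :
    partialDeriv 0 (j + 1) g = dirDeriv 1 (partialDeriv 0 j g) := by
  simp [partialDeriv, Function.iterate_succ_apply']

theorem partialDeriv_eq_mixedDeriv_replicate (i j : ℕ) (g : E2 → ℝ) :
    partialDeriv i j g = mixedDeriv (List.replicate i 0 ++ List.replicate j 1) g := by
  induction i with
  | zero =>
    induction j with
    | zero => rfl
    | succ j ih =>
      rw [partialDeriv_zero_succ, ih]; rfl
  | succ i ih => rw [partialDeriv_succ_left, ih]; rfl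

theorem dirDeriv_one_partialDeriv {g : E2 → ℝ} (hg : DiffFour g) (i j : ℕ) (h : i + j ≤ 3) :
    dirDeriv 1 (partialDeriv i j g) = partialDeriv i (j + 1) g := by
  induction i with
  | zero => rw [partialDeriv_zero_succ]
  | succ i ih =>
    rw [partialDeriv_succ_left, partialDeriv_succ_left, dirDeriv_comm, ih (by omega)]
    · rw [partialDeriv_eq_mixedDeriv_replicate]
      exact hg _ (by simp; omega)
    · intro k
      rw [partialDeriv_eq_mixedDeriv_replicate]
      exact hg (k :: _) (by simp; omega)

/-- Partials commute, so only the number of occurrences of each direction matters. This transfers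
the bounds on `partialDeriv` to derivatives in any order. -/
theorem mixedDeriv_eq_partialDeriv {g : E2 → ℝ} (hg : DiffFour g) (l : List (Fin 2))
    (hl : l.length ≤ 4) : mixedDeriv l g = partialDeriv (l.count 0) (l.count 1) g := by
  induction l with
  | nil => rfl
  | cons c l ih =>
    have hlen : l.count 0 + l.count 1 ≤ 3 := by
      have : l.count 0 + l.count 1 = l.length := by
        clear ih hl
        induction l with
        | nil => rfl
        | cons d l ih2 => fin_cases d <;> simp <;> omega
      simp at hl; omega
    simp only [mixedDeriv]
    rw [ih (by simp at hl; omega)]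
    fin_cases c
    · simp [partialDeriv_succ_left]
    · simp [dirDeriv_one_partialDeriv hg _ _ hlen]

/-- Repeated integration by parts produces the directions in reversed order; this undoes it. -/
theorem mixedDeriv_reverse {g : E2 → ℝ} (hg : DiffFour g) (l : List (Fin 2))
    (hl : l.length ≤ 4) : mixedDeriv l.reverse g = mixedDeriv l g := by
  rw [mixedDeriv_eq_partialDeriv hg _ hl, mixedDeriv_eq_partialDeriv hg _ (by simpa using hl)]
  simp

theorem exists_bound_mixedDeriv {g : E2 → ℝ} (hg : DiffFour g) (hb : BoundedPartials g) :
    ∃ B : ℝ, 0 < B ∧ ∀ l : List (Fin 2), 1 ≤ l.length → l.length ≤ 4 →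
      ∀ x, |mixedDeriv l g x| ≤ B := by
  have : ∀ p : Fin 5 × Fin 5, ∃ C : ℝ, 1 ≤ p.1.1 + p.2.1 → p.1.1 + p.2.1 ≤ 4 →
      ∀ x, |partialDeriv p.1 p.2 g x| ≤ C := by
    intro p
    by_cases h1 : 1 ≤ p.1.1 + p.2.1
    · by_cases h2 : p.1.1 + p.2.1 ≤ 4
      · obtain ⟨C, hC⟩ := hb p.1 p.2 h1 h2
        exact ⟨C, fun _ _ => hC⟩
      · exact ⟨0, fun _ h => absurd h h2⟩
    · exact ⟨0, fun h => absurd h h1⟩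
  choose C hC using this
  refine ⟨∑ p, |C p| + 1, by positivity, fun l h1 h4 x => ?_⟩
  rw [mixedDeriv_eq_partialDeriv hg l h4]
  have hlen : l.count 0 + l.count 1 = l.length := by
    clear h1 h4
    induction l with
    | nil => rfl
    | cons d l ih2 => fin_cases d <;> simp <;> omega
  have := hC (⟨l.count 0, by omega⟩, ⟨l.count 1, by omega⟩) (by simp; omega) (by simp; omega) x
  refine this.trans ((le_abs_self _).trans ?_)
  have := Finset.single_le_sum (f := fun p => |C p|) (fun p _ => abs_nonneg _)
    (Finset.mem_univ ((⟨l.count 0, by omega⟩, ⟨l.count 1, by omega⟩) : Fin 5 × Fin 5))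
  linarith

/-! ### Smoothness of the density, the kernel and the estimator. -/

theorem diffFour_of_contDiff {g : E2 → ℝ} (hg : ContDiff ℝ 4 g) : DiffFour g := fun l hl =>
  (ContDiff.mixedDeriv (n := 4) (by exact_mod_cast hg) l 1 (by omega)).differentiable (by simp)

/-- The fourth derivative of the kernel is assumed to exist through `iteratedFDeriv ℝ 3 K`; this
identity makes third-order partials differentiable. -/
theorem mixedDeriv_three_eq_iteratedFDeriv {g : E2 → ℝ} (hg : ContDiff ℝ 3 g) (i j k : Fin 2)
    (x : E2) : mixedDeriv [i, j, k] g x = iteratedFDeriv ℝ 3 g x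
      ![EuclideanSpace.single i 1, EuclideanSpace.single j 1, EuclideanSpace.single k 1] := by
  have hg2 : ContDiff ℝ 2 (fderiv ℝ g) := hg.fderiv_right (by norm_num)
  have hg1 : ContDiff ℝ 1 (fderiv ℝ (fderiv ℝ g)) := hg2.fderiv_right (by norm_num)
  have h1 : dirDeriv k g = fun y => fderiv ℝ g y (EuclideanSpace.single k 1) := rfl
  have h2 : dirDeriv j (dirDeriv k g) = fun y => fderiv ℝ (fderiv ℝ g) y
      (EuclideanSpace.single j 1) (EuclideanSpace.single k 1) := by
    ext y
    have : HasFDerivAt (dirDeriv k g) _ y :=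
      (hg2.differentiable (by norm_num) y).hasFDerivAt.clm_apply
        (hasFDerivAt_const (EuclideanSpace.single k (1 : ℝ)) y)
    rw [dirDeriv, this.fderiv]; simp
  have h3 : dirDeriv i (dirDeriv j (dirDeriv k g)) x = fderiv ℝ (fderiv ℝ (fderiv ℝ g)) x
      (EuclideanSpace.single i 1) (EuclideanSpace.single j 1) (EuclideanSpace.single k 1) := by
    have hj : HasFDerivAt (fun y => fderiv ℝ (fderiv ℝ g) y (EuclideanSpace.single j 1)) _ x :=
      (hg1.differentiable (by norm_num) x).hasFDerivAt.clm_apply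
        (hasFDerivAt_const (EuclideanSpace.single j (1 : ℝ)) x)
    have hk : HasFDerivAt (fun y => fderiv ℝ (fderiv ℝ g) y (EuclideanSpace.single j 1)
        (EuclideanSpace.single k 1)) _ x :=
      hj.clm_apply (hasFDerivAt_const (EuclideanSpace.single k (1 : ℝ)) x)
    rw [h2, dirDeriv, hk.fderiv]; simp
  simp only [mixedDeriv]
  rw [h3]
  simp [iteratedFDeriv_succ_apply_right, Fin.init]

theorem KernelRegular.diffFour {K : E2 → ℝ} (hK : KernelRegular K) : DiffFour K := by
  obtain ⟨-, -, -, ⟨h3, hd⟩, -⟩ := hK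
  intro l hl
  rcases Nat.lt_or_ge l.length 3 with h | h
  · exact (ContDiff.mixedDeriv (n := 3) (by exact_mod_cast h3) l 1 (by omega)).differentiable
      (by simp)
  · obtain ⟨i, j, k, rfl⟩ := List.length_eq_three.mp (le_antisymm hl h)
    have : mixedDeriv [i, j, k] K = fun x => iteratedFDeriv ℝ 3 K x
      ![EuclideanSpace.single i 1, EuclideanSpace.single j 1, EuclideanSpace.single k 1] :=
      funext fun x => mixedDeriv_three_eq_iteratedFDeriv h3 i j k x
    rw [this]
    intro x
    exact ((ContinuousMultilinearMap.apply ℝ (fun _ : Fin 3 => E2) ℝ _).differentiableAt).comp x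
      (hd x)

theorem mixedDeriv_scaled_sum {K : E2 → ℝ} (hK : DiffFour K) (n : ℕ) (h c : ℝ) (X : ℕ → E2)
    (l : List (Fin 2)) (hl : l.length ≤ 4) :
    mixedDeriv l (fun x => c * ∑ i ∈ Finset.range n, K (h⁻¹ • (x - X i))) =
      fun x => c * h⁻¹ ^ l.length *
        ∑ i ∈ Finset.range n, mixedDeriv l K (h⁻¹ • (x - X i)) := by
  induction l with
  | nil => ext x; simp [mixedDeriv]
  | cons j l ih =>
    simp only [mixedDeriv]
    rw [ih (by simp at hl; omega)]
    ext x
    have hd : ∀ i, HasFDerivAt (fun x => mixedDeriv l K (h⁻¹ • (x - X i)))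
        ((fderiv ℝ (mixedDeriv l K) (h⁻¹ • (x - X i))).comp
          (h⁻¹ • ContinuousLinearMap.id ℝ E2)) x := fun i =>
      ((hK l (by simp at hl; omega)) _).hasFDerivAt.comp x
        (((hasFDerivAt_id x).sub_const (X i)).const_smul h⁻¹)
    have hs : HasFDerivAt (fun x => c * h⁻¹ ^ l.length *
        ∑ i ∈ Finset.range n, mixedDeriv l K (h⁻¹ • (x - X i))) _ x :=
      (HasFDerivAt.fun_sum fun i _ => hd i).const_mul _
    rw [dirDeriv, hs.fderiv]
    simp only [smul_apply, sum_apply,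
      ContinuousLinearMap.comp_apply, ContinuousLinearMap.id_apply, map_smul, smul_eq_mul,
      ← Finset.mul_sum, dirDeriv, List.length_cons]
    ring

theorem mixedDeriv_kde {K : E2 → ℝ} (hK : DiffFour K) (n : ℕ) (h : ℝ) (X : ℕ → E2)
    (l : List (Fin 2)) (hl : l.length ≤ 4) (x : E2) :
    mixedDeriv l (kde K n h X) x = (1 / (n : ℝ)) * ∑ i ∈ Finset.range n,
      h⁻¹ ^ (2 + l.length) * mixedDeriv l K (h⁻¹ • (x - X i)) := by
  have := congrFun (mixedDeriv_scaled_sum hK n h (1 / ((n : ℝ) * h ^ 2)) X l hl) x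
  refine this.trans ?_
  rw [← Finset.mul_sum]
  simp only [inv_pow, pow_add, one_div, mul_inv]
  ring

theorem DiffFour.kde {K : E2 → ℝ} (hK : DiffFour K) (n : ℕ) (h : ℝ) (X : ℕ → E2) :
    DiffFour (kde K n h X) := by
  intro l hl
  have := (mixedDeriv_scaled_sum hK n h (1 / ((n : ℝ) * h ^ 2)) X l (by omega))
  have e : mixedDeriv l (Filament.kde K n h X) = _ := this
  rw [e]
  refine (Differentiable.fun_sum fun i _ => ?_).const_mul _
  exact (hK l hl).comp (by fun_prop : Differentiable ℝ fun y : E2 => h⁻¹ • (y - X i))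

theorem d2_eq_mixedDeriv (g : E2 → ℝ) (x : E2) :
    d2 g x = ![mixedDeriv [0, 0] g x, mixedDeriv [0, 1] g x, mixedDeriv [1, 1] g x] := rfl

theorem hasCompactSupport_mixedDeriv {K : E2 → ℝ} (l : List (Fin 2)) :
    tsupport (mixedDeriv l K) ⊆ tsupport K := by
  induction l with
  | nil => exact subset_rfl
  | cons i l ih =>
    refine (closure_mono ?_).trans (((isClosed_tsupport _).closure_subset_iff).2 ih)
    refine subset_trans ?_ (support_fderiv_subset ℝ (f := mixedDeriv l K))
    intro x hx h0
    apply hx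
    simp only [mixedDeriv, dirDeriv]
    rw [h0]; rfl

theorem gradient_apply (g : E2 → ℝ) (x : E2) (i : Fin 2) : gradient g x i = dirDeriv i g x := by
  have : inner ℝ (gradient g x) (EuclideanSpace.single i (1 : ℝ)) =
      fderiv ℝ g x (EuclideanSpace.single i (1 : ℝ)) := by
    rw [gradient, InnerProductSpace.toDual_symm_apply]
  rw [dirDeriv, ← this, EuclideanSpace.inner_single_right]
  simp

end

/-! ### Linearization of the eigenvector map -/

section

/-- The difference of the two eigenvalues of the symmetric matrix `(u v; v w)`. -/
def eigGap (p : Fin 3 → ℝ) : ℝ := √((p 2 - p 0) ^ 2 + 4 * p 1 ^ 2)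

/-- The partial derivative of `eigGap` in the variable `w`. -/
def gapCos (p : Fin 3 → ℝ) : ℝ := (p 2 - p 0) / eigGap p

/-- A quarter of the partial derivative of `eigGap` in the variable `v`. -/
def gapSin (p : Fin 3 → ℝ) : ℝ := p 1 / eigGap p

theorem eigG_zero_eq (p : Fin 3 → ℝ) : eigG p 0 = 2 * p 0 - 2 * p 2 + 2 * p 1 - 2 * eigGap p := rfl

theorem eigG_one_eq (p : Fin 3 → ℝ) : eigG p 1 = p 2 - p 0 + 4 * p 1 - eigGap p := rfl

theorem eigJ_eq (p : Fin 3 → ℝ) : eigJ p = (p 0 + p 2 - eigGap p) / 2 := by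
  rw [eigJ, eigGap, show (p 0 - p 2) ^ 2 = (p 2 - p 0) ^ 2 by ring]

theorem eigGap_nonneg (p : Fin 3 → ℝ) : 0 ≤ eigGap p := Real.sqrt_nonneg _

theorem eigGap_sq (p : Fin 3 → ℝ) : eigGap p ^ 2 = (p 2 - p 0) ^ 2 + 4 * p 1 ^ 2 :=
  Real.sq_sqrt (by positivity)

theorem norm_le_abs_add_abs (v : E2) : ‖v‖ ≤ |v 0| + |v 1| := by
  rw [EuclideanSpace.norm_eq]
  refine Real.sqrt_le_iff.mpr ⟨by positivity, ?_⟩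
  simp only [Fin.sum_univ_two, Real.norm_eq_abs]
  nlinarith [abs_nonneg (v 0), abs_nonneg (v 1)]

/-- As the norm of a linear image of `p`, the gap is Lipschitz everywhere, including where it
vanishes. Hence `eigG` and `eigJ` are globally Lipschitz too. -/
theorem eigGap_eq_norm (p : Fin 3 → ℝ) : eigGap p = ‖(!₂[p 2 - p 0, 2 * p 1] : E2)‖ := by
  rw [EuclideanSpace.norm_eq, eigGap]
  congr 1
  simp [Fin.sum_univ_two]
  ring

theorem abs_eigGap_sub_le {p q : Fin 3 → ℝ} {δ : ℝ} (h : ∀ i, |p i - q i| ≤ δ) :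
    |eigGap p - eigGap q| ≤ 4 * δ := by
  rw [eigGap_eq_norm, eigGap_eq_norm]
  refine (abs_norm_sub_norm_le _ _).trans ((norm_le_abs_add_abs _).trans ?_)
  have h0 := abs_le.mp (h 0)
  have h1 := abs_le.mp (h 1)
  have h2 := abs_le.mp (h 2)
  have e0 : (!₂[p 2 - p 0, 2 * p 1] - !₂[q 2 - q 0, 2 * q 1] : E2) 0
    = (p 2 - q 2) - (p 0 - q 0) := by simp; ring
  have e1 : (!₂[p 2 - p 0, 2 * p 1] - !₂[q 2 - q 0, 2 * q 1] : E2) 1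
    = 2 * (p 1 - q 1) := by simp; ring
  rw [e0, e1]
  have a0 : |(p 2 - q 2) - (p 0 - q 0)| ≤ 2 * δ := abs_le.mpr ⟨by linarith, by linarith⟩
  have a1 : |2 * (p 1 - q 1)| ≤ 2 * δ := abs_le.mpr ⟨by linarith, by linarith⟩
  linarith

theorem norm_eigG_sub_le {p q : Fin 3 → ℝ} {δ : ℝ} (h : ∀ i, |p i - q i| ≤ δ) :
    ‖eigG p - eigG q‖ ≤ 24 * δ := by
  refine (norm_le_abs_add_abs _).trans ?_
  have hg := abs_le.mp (abs_eigGap_sub_le h)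
  have h0 := abs_le.mp (h 0)
  have h1 := abs_le.mp (h 1)
  have h2 := abs_le.mp (h 2)
  have a0 : |(eigG p - eigG q) 0| ≤ 14 * δ := by
    rw [PiLp.sub_apply, eigG_zero_eq, eigG_zero_eq]
    exact abs_le.mpr ⟨by linarith, by linarith⟩
  have a1 : |(eigG p - eigG q) 1| ≤ 10 * δ := by
    rw [PiLp.sub_apply, eigG_one_eq, eigG_one_eq]
    exact abs_le.mpr ⟨by linarith, by linarith⟩
  linarith

theorem norm_eigG_le {p : Fin 3 → ℝ} {B : ℝ} (h : ∀ i, |p i| ≤ B) : ‖eigG p‖ ≤ 24 * B := by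
  have h0 : eigG 0 = 0 := by ext i; fin_cases i <;> simp [eigG]
  have := norm_eigG_sub_le (p := p) (q := 0) (δ := B) (by simpa using h)
  simpa [h0] using this

theorem abs_eigJ_sub_le {p q : Fin 3 → ℝ} {δ : ℝ} (h : ∀ i, |p i - q i| ≤ δ) :
    |eigJ p - eigJ q| ≤ 3 * δ := by
  have hg := abs_le.mp (abs_eigGap_sub_le h)
  have h0 := abs_le.mp (h 0)
  have h2 := abs_le.mp (h 2)
  rw [eigJ_eq, eigJ_eq]
  exact abs_le.mpr ⟨by linarith, by linarith⟩

theorem abs_gapCos_le (p : Fin 3 → ℝ) : |gapCos p| ≤ 1 := by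
  rw [gapCos, abs_div, abs_of_nonneg (eigGap_nonneg p)]
  refine div_le_one_of_le₀ (Real.abs_le_sqrt (by nlinarith [sq_nonneg (p 1)])) (eigGap_nonneg p)

theorem abs_gapSin_le (p : Fin 3 → ℝ) : |gapSin p| ≤ 1 := by
  rw [gapSin, abs_div, abs_of_nonneg (eigGap_nonneg p)]
  refine div_le_one_of_le₀ (Real.abs_le_sqrt ?_) (eigGap_nonneg p)
  nlinarith [sq_nonneg (p 1), sq_nonneg (p 2 - p 0)]

/-- The difference equals (a - b - (b/t)(s - t))/s, and |b/t| ≤ 1; so no upper bound on numerators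
or denominators is needed. -/
theorem abs_div_sub_div_le {a b s t c σ : ℝ} (hσ : 0 < σ) (hs : σ ≤ s) (ht : 0 < t)
    (hbt : |b / t| ≤ 1) (hab : |a - b| ≤ c) (hst : |s - t| ≤ c) :
    |a / s - b / t| ≤ 2 * c / σ := by
  have hs0 : 0 < s := hσ.trans_le hs
  have hc : 0 ≤ c := (abs_nonneg _).trans hab
  have e : a / s - b / t = (a - b - b / t * (s - t)) / s := by field_simp; ring
  rw [e, abs_div, abs_of_pos hs0]
  have : |a - b - b / t * (s - t)| ≤ 2 * c := by
    refine (abs_sub _ _).trans ?_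
    rw [abs_mul]
    nlinarith [abs_nonneg (b / t), abs_nonneg (s - t)]
  gcongr

theorem abs_gapCos_sub_le {p q : Fin 3 → ℝ} {δ σ : ℝ} (hσ : 0 < σ) (hp : σ ≤ eigGap p)
    (hq : σ ≤ eigGap q) (h : ∀ i, |p i - q i| ≤ δ) : |gapCos p - gapCos q| ≤ 8 * δ / σ := by
  have h0 := abs_le.mp (h 0)
  have h2 := abs_le.mp (h 2)
  have := abs_div_sub_div_le (a := p 2 - p 0) (b := q 2 - q 0) (c := 4 * δ) hσ hp
    (hσ.trans_le hq) (abs_gapCos_le q) (abs_le.mpr ⟨by linarith, by linarith⟩)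
    (abs_eigGap_sub_le h)
  simpa [gapCos, ← mul_assoc, show (2 : ℝ) * 4 = 8 by norm_num] using this

theorem abs_gapSin_sub_le {p q : Fin 3 → ℝ} {δ σ : ℝ} (hσ : 0 < σ) (hp : σ ≤ eigGap p)
    (hq : σ ≤ eigGap q) (h : ∀ i, |p i - q i| ≤ δ) : |gapSin p - gapSin q| ≤ 8 * δ / σ := by
  have h1 := h 1
  have := abs_div_sub_div_le (a := p 1) (b := q 1) (c := 4 * δ) hσ hp
    (hσ.trans_le hq) (abs_gapSin_le q) (by linarith [abs_nonneg (p 1 - q 1)])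
    (abs_eigGap_sub_le h)
  simpa [gapSin, ← mul_assoc, show (2 : ℝ) * 4 = 8 by norm_num] using this

/-- The square of the gap is a quadratic form, whose second-order expansion is exact. Writing S(q)²
- S(p)² as 2 S(p)(S(q) - S(p)) + (S(q) - S(p))² expresses the remainder as a combination of squares
over 2 S(p). No derivative of the square root is taken, and only the gap at `p` has to be bounded
below. -/
theorem abs_eigGap_linearization_le {p q : Fin 3 → ℝ} {δ σ : ℝ} (hσ : 0 < σ)
    (hp : σ ≤ eigGap p) (h : ∀ i, |q i - p i| ≤ δ) :
    |eigGap q - eigGap p - (gapCos p * (q 2 - p 2) - gapCos p * (q 0 - p 0)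
      + 4 * (gapSin p * (q 1 - p 1)))| ≤ 8 * δ ^ 2 / σ := by
  have hS : 0 < eigGap p := hσ.trans_le hp
  have hδ : 0 ≤ δ := (abs_nonneg _).trans (h 0)
  have e : eigGap q - eigGap p - (gapCos p * (q 2 - p 2) - gapCos p * (q 0 - p 0)
      + 4 * (gapSin p * (q 1 - p 1))) =
      (((q 2 - p 2) - (q 0 - p 0)) ^ 2 + 4 * (q 1 - p 1) ^ 2 - (eigGap q - eigGap p) ^ 2)
        / (2 * eigGap p) := by
    rw [gapCos, gapSin]
    field_simp
    linear_combination eigGap_sq q - eigGap_sq p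
  rw [e, abs_div, abs_of_pos (by positivity : 0 < 2 * eigGap p),
    div_le_div_iff₀ (by positivity) hσ]
  have h0 := abs_le.mp (h 0)
  have h1 := abs_le.mp (h 1)
  have h2 := abs_le.mp (h 2)
  have b1 : ((q 2 - p 2) - (q 0 - p 0)) ^ 2 ≤ (2 * δ) ^ 2 :=
    sq_le_sq' (by linarith) (by linarith)
  have b2 : (q 1 - p 1) ^ 2 ≤ δ ^ 2 := sq_le_sq' (by linarith) (by linarith)
  have b3 : (eigGap q - eigGap p) ^ 2 ≤ (4 * δ) ^ 2 := by
    have := abs_le.mp (abs_eigGap_sub_le h)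
    exact sq_le_sq' (by linarith) (by linarith)
  -- The quantity lies between -16 δ² and 4 δ² + 4 δ².
  have : |((q 2 - p 2) - (q 0 - p 0)) ^ 2 + 4 * (q 1 - p 1) ^ 2 - (eigGap q - eigGap p) ^ 2|
      ≤ 16 * δ ^ 2 := by
    rw [abs_le]; constructor <;> nlinarith [sq_nonneg ((q 2 - p 2) - (q 0 - p 0)),
      sq_nonneg (q 1 - p 1), sq_nonneg (eigGap q - eigGap p)]
  calc _ ≤ 16 * δ ^ 2 * σ := by gcongr
    _ ≤ 16 * δ ^ 2 * eigGap p := by gcongr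
    _ = _ := by ring

theorem continuous_eigGap : Continuous eigGap := by unfold eigGap; fun_prop

theorem continuous_eigG : Continuous eigG := by
  unfold eigG
  refine (PiLp.continuous_toLp 2 _).comp ?_
  refine continuous_pi fun i => ?_
  fin_cases i <;> simp <;> fun_prop

theorem measurable_gapCos : Measurable gapCos := by
  unfold gapCos
  have := continuous_eigGap.measurable
  fun_prop

theorem measurable_gapSin : Measurable gapSin := by
  unfold gapSin
  have := continuous_eigGap.measurable
  fun_prop

/-- The weights by which second derivatives enter the linearization of `eigG`. -/
def eigWeight : Fin 3 → (Fin 3 → ℝ) → ℝ := ![fun _ => 1, gapCos, gapSin]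

theorem abs_eigWeight_le (k : Fin 3) (p : Fin 3 → ℝ) : |eigWeight k p| ≤ 1 := by
  fin_cases k
  · simp [eigWeight]
  · exact abs_gapCos_le p
  · exact abs_gapSin_le p

theorem measurable_eigWeight (k : Fin 3) : Measurable (eigWeight k) := by
  fin_cases k
  · exact measurable_const
  · exact measurable_gapCos
  · exact measurable_gapSin

theorem abs_eigWeight_sub_le {p q : Fin 3 → ℝ} {δ σ : ℝ} (k : Fin 3) (hσ : 0 < σ)
    (hp : σ ≤ eigGap p) (hq : σ ≤ eigGap q) (h : ∀ i, |p i - q i| ≤ δ) :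
    |eigWeight k p - eigWeight k q| ≤ 8 * δ / σ := by
  fin_cases k
  · have hδ : 0 ≤ δ := (abs_nonneg _).trans (h 0)
    simp only [eigWeight]
    simp
    positivity
  · exact abs_gapCos_sub_le hσ hp hq h
  · exact abs_gapSin_sub_le hσ hp hq h

theorem intervalIntegrable_of_bounded {φ : ℝ → ℝ} (hm : Measurable φ) {s t C : ℝ}
    (hb : ∀ r, |φ r| ≤ C) : IntervalIntegrable φ volume s t := by
  rw [intervalIntegrable_iff]
  exact Measure.integrableOn_of_bounded (M := C) (by simp) hm.aestronglyMeasurable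
    (ae_of_all _ fun r => by simpa using hb r)

/-- The gap is the only nonlinear ingredient of `eigG`, so its linearization suffices. In `hρ` the
absolute value stands outside the integral: cancellation along the arc makes ρ smaller than the
pointwise error δ, which enters only squared. The gap remainder occurs twice in the first coordinate
and once in the second, hence 24 = 3 · 8; the linear terms need only 18 + 12 of the 36. -/
theorem norm_integral_eigG_sub_le {p q : ℝ → Fin 3 → ℝ} (hp : Continuous p) (hq : Continuous q)
    {τ δ σ ρ : ℝ} (hσ : 0 < σ) (hgap : ∀ r ∈ Set.uIoc 0 τ, σ ≤ eigGap (p r))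
    (hδ : ∀ r ∈ Set.uIoc 0 τ, ∀ i, |q r i - p r i| ≤ δ)
    (hρ : ∀ k i, |∫ r in (0 : ℝ)..τ, eigWeight k (p r) * (q r i - p r i)| ≤ ρ) :
    ‖∫ r in (0 : ℝ)..τ, (eigG (q r) - eigG (p r))‖ ≤ 36 * ρ + 24 * δ ^ 2 / σ * |τ| := by
  have hcG : Continuous fun r => eigG (q r) - eigG (p r) :=
    (continuous_eigG.comp hq).sub (continuous_eigG.comp hp)
  have hcomp : ∀ i, (∫ r in (0 : ℝ)..τ, (eigG (q r) - eigG (p r))) i =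
      ∫ r in (0 : ℝ)..τ, (eigG (q r) i - eigG (p r) i) := by
    intro i
    have := ContinuousLinearMap.intervalIntegral_comp_comm (EuclideanSpace.proj i : E2 →L[ℝ] ℝ)
      (hcG.intervalIntegrable (μ := volume) 0 τ)
    simpa using this.symm
  have hci : ∀ k i, IntervalIntegrable (fun r => eigWeight k (p r) * (q r i - p r i))
      volume 0 τ := by
    intro k i
    refine IntervalIntegrable.mul_continuousOn
      (intervalIntegrable_of_bounded ((measurable_eigWeight k).comp hp.measurable)
        (C := 1) fun r => abs_eigWeight_le k _) (by fun_prop)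
  set I : Fin 3 → Fin 3 → ℝ := fun k i =>
    ∫ r in (0 : ℝ)..τ, eigWeight k (p r) * (q r i - p r i) with hI
  set R : ℝ := ∫ r in (0 : ℝ)..τ, (eigGap (q r) - eigGap (p r) -
    (eigWeight 1 (p r) * (q r 2 - p r 2) - eigWeight 1 (p r) * (q r 0 - p r 0)
      + 4 * (eigWeight 2 (p r) * (q r 1 - p r 1)))) with hR
  have hRle : |R| ≤ 8 * δ ^ 2 / σ * |τ| := by
    have := intervalIntegral.norm_integral_le_of_norm_le_const (a := 0) (b := τ)
      (f := fun r => (eigGap (q r) - eigGap (p r) -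
    (eigWeight 1 (p r) * (q r 2 - p r 2) - eigWeight 1 (p r) * (q r 0 - p r 0)
      + 4 * (eigWeight 2 (p r) * (q r 1 - p r 1))))) (C := 8 * δ ^ 2 / σ)
      (fun r hr => abs_eigGap_linearization_le hσ (hgap r hr) (hδ r hr))
    simpa using this
  have hgi : IntervalIntegrable (fun r => eigGap (q r) - eigGap (p r)) volume 0 τ :=
    ((continuous_eigGap.comp hq).sub (continuous_eigGap.comp hp)).intervalIntegrable 0 τ
  have hgap_eq : ∫ r in (0 : ℝ)..τ, (eigGap (q r) - eigGap (p r)) =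
      R + (I 1 2 - I 1 0 + 4 * I 2 1) := by
    rw [hR, intervalIntegral.integral_sub hgi
      (((hci 1 2).sub (hci 1 0)).add ((hci 2 1).const_mul 4)),
      intervalIntegral.integral_add ((hci 1 2).sub (hci 1 0)) ((hci 2 1).const_mul 4),
      intervalIntegral.integral_sub (hci 1 2) (hci 1 0), intervalIntegral.integral_const_mul]
    ring
  have h0 : ∀ i, IntervalIntegrable (fun r => q r i - p r i) volume 0 τ := fun i =>
    (by fun_prop : Continuous fun r => q r i - p r i).intervalIntegrable 0 τ
  have hI0 : ∀ i, I 0 i = ∫ r in (0 : ℝ)..τ, (q r i - p r i) := by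
    intro i; simp [hI, eigWeight]
  have c0 : (∫ r in (0 : ℝ)..τ, (eigG (q r) - eigG (p r))) 0 =
      2 * I 0 0 - 2 * I 0 2 + 2 * I 0 1 - 2 * (R + (I 1 2 - I 1 0 + 4 * I 2 1)) := by
    rw [hcomp, ← hgap_eq, hI0, hI0, hI0, ← intervalIntegral.integral_const_mul,
      ← intervalIntegral.integral_const_mul, ← intervalIntegral.integral_const_mul,
      ← intervalIntegral.integral_const_mul,
      ← intervalIntegral.integral_sub ((h0 0).const_mul 2) ((h0 2).const_mul 2),
      ← intervalIntegral.integral_add (((h0 0).const_mul 2).sub ((h0 2).const_mul 2))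
        ((h0 1).const_mul 2),
      ← intervalIntegral.integral_sub ((((h0 0).const_mul 2).sub ((h0 2).const_mul 2)).add
        ((h0 1).const_mul 2)) (hgi.const_mul 2)]
    congr 1; ext r
    rw [eigG_zero_eq, eigG_zero_eq]; ring
  have c1 : (∫ r in (0 : ℝ)..τ, (eigG (q r) - eigG (p r))) 1 =
      I 0 2 - I 0 0 + 4 * I 0 1 - (R + (I 1 2 - I 1 0 + 4 * I 2 1)) := by
    rw [hcomp, ← hgap_eq, hI0, hI0, hI0, ← intervalIntegral.integral_const_mul,
      ← intervalIntegral.integral_sub (h0 2) (h0 0),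
      ← intervalIntegral.integral_add ((h0 2).sub (h0 0)) ((h0 1).const_mul 4),
      ← intervalIntegral.integral_sub (((h0 2).sub (h0 0)).add
        ((h0 1).const_mul 4)) hgi]
    congr 1; ext r
    rw [eigG_one_eq, eigG_one_eq]; ring
  have b := fun k i => abs_le.mp (hρ k i : |I k i| ≤ ρ)
  have bR := abs_le.mp hRle
  have hsplit : 24 * δ ^ 2 / σ * |τ| = 3 * (8 * δ ^ 2 / σ * |τ|) := by ring
  have a0 : |(∫ r in (0 : ℝ)..τ, (eigG (q r) - eigG (p r))) 0| ≤
      18 * ρ + 2 * (8 * δ ^ 2 / σ * |τ|) := by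
    rw [c0]
    exact abs_le.mpr ⟨by linarith [b 0 0, b 0 1, b 0 2, b 1 0, b 1 2, b 2 1],
      by linarith [b 0 0, b 0 1, b 0 2, b 1 0, b 1 2, b 2 1]⟩
  have a1 : |(∫ r in (0 : ℝ)..τ, (eigG (q r) - eigG (p r))) 1| ≤
      12 * ρ + (8 * δ ^ 2 / σ * |τ|) := by
    rw [c1]
    exact abs_le.mpr ⟨by linarith [b 0 0, b 0 1, b 0 2, b 1 0, b 1 2, b 2 1],
      by linarith [b 0 0, b 0 1, b 0 2, b 1 0, b 1 2, b 2 1]⟩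
  have hρ0 : 0 ≤ ρ := (abs_nonneg _).trans (hρ 0 0)
  refine (norm_le_abs_add_abs _).trans ?_
  linarith

end

/-! ### The vector field of second eigenvectors -/

section

theorem forall_d2_of_mixedDeriv {g : E2 → ℝ} {P : ℝ → Prop} {x : E2}
    (h : ∀ l : List (Fin 2), l.length = 2 → P (mixedDeriv l g x)) : ∀ i, P (d2 g x i) := by
  intro i
  rw [d2_eq_mixedDeriv]
  fin_cases i
  · exact h [0, 0] rfl
  · exact h [0, 1] rfl
  · exact h [1, 1] rfl

theorem exists_d2_eq_mixedDeriv (i : Fin 3) :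
    ∃ l : List (Fin 2), l.length = 2 ∧ ∀ g x, d2 g x i = mixedDeriv l g x := by
  fin_cases i
  · exact ⟨[0, 0], rfl, fun _ _ => rfl⟩
  · exact ⟨[0, 1], rfl, fun _ _ => rfl⟩
  · exact ⟨[1, 1], rfl, fun _ _ => rfl⟩

theorem DiffFour.continuous_d2 {g : E2 → ℝ} (hg : DiffFour g) : Continuous (d2 g) := by
  refine continuous_pi fun i => ?_
  obtain ⟨l, hl, h⟩ := exists_d2_eq_mixedDeriv i
  simp_rw [h]
  exact (hg l (by omega)).continuous

theorem DiffFour.continuous_eigField {g : E2 → ℝ} (hg : DiffFour g) : Continuous (eigField g) :=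
  continuous_eigG.comp hg.continuous_d2

theorem DiffFour.continuous_lam2 {g : E2 → ℝ} (hg : DiffFour g) : Continuous (lam2 g) := by
  have : lam2 g = fun x => (d2 g x 0 + d2 g x 2 - eigGap (d2 g x)) / 2 := by
    ext x; exact eigJ_eq _
  rw [this]
  have := hg.continuous_d2
  have := continuous_eigGap.comp this
  fun_prop

theorem DiffFour.continuous_gradient {g : E2 → ℝ} (hg : DiffFour g) : Continuous (gradient g) := by
  have : gradient g = fun x => WithLp.toLp 2 (fun i => dirDeriv i g x) := by
    ext x i; simp [gradient_apply]
  rw [this]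
  refine (PiLp.continuous_toLp 2 _).comp (continuous_pi fun i => ?_)
  exact (hg [i] (by simp)).continuous

theorem DiffFour.continuous_slope {g : E2 → ℝ} (hg : DiffFour g) : Continuous (slope g) :=
  hg.continuous_gradient.inner hg.continuous_eigField

theorem abs_d2_sub_le {g : E2 → ℝ} (hg : DiffFour g) {s : Set E2} (hs : Convex ℝ s) {B : ℝ}
    (hB : ∀ l : List (Fin 2), l.length = 3 → ∀ x ∈ s, |mixedDeriv l g x| ≤ B) {x y : E2}
    (hx : x ∈ s) (hy : y ∈ s) (i : Fin 3) : |d2 g x i - d2 g y i| ≤ 2 * B * ‖x - y‖ := by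
  obtain ⟨l, hl, h⟩ := exists_d2_eq_mixedDeriv i
  rw [h, h]
  exact abs_sub_le_of_dirDeriv hs (hg l (by omega))
    (fun z hz j => hB (j :: l) (by simp [hl]) z hz) hx hy

theorem norm_eigField_sub_le {g : E2 → ℝ} (hg : DiffFour g) {s : Set E2} (hs : Convex ℝ s) {B : ℝ}
    (hB : ∀ l : List (Fin 2), l.length = 3 → ∀ x ∈ s, |mixedDeriv l g x| ≤ B) {x y : E2}
    (hx : x ∈ s) (hy : y ∈ s) : ‖eigField g x - eigField g y‖ ≤ 48 * B * ‖x - y‖ := by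
  refine (norm_eigG_sub_le (abs_d2_sub_le hg hs hB hx hy)).trans (le_of_eq ?_)
  ring

theorem norm_eigField_le {g : E2 → ℝ} {B : ℝ} {x : E2}
    (hB : ∀ l : List (Fin 2), l.length = 2 → |mixedDeriv l g x| ≤ B) :
    ‖eigField g x‖ ≤ 24 * B :=
  norm_eigG_le (forall_d2_of_mixedDeriv (P := fun y => |y| ≤ B) hB)

theorem abs_d2_diff_le {f g : E2 → ℝ} {δ : ℝ} {x : E2}
    (h : ∀ l : List (Fin 2), l.length = 2 → |mixedDeriv l g x - mixedDeriv l f x| ≤ δ)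
    (i : Fin 3) : |d2 g x i - d2 f x i| ≤ δ := by
  obtain ⟨l, hl, e⟩ := exists_d2_eq_mixedDeriv i
  rw [e, e]; exact h l hl

theorem norm_gradient_sub_le {g f : E2 → ℝ} {x y : E2} {δ : ℝ}
    (h : ∀ i, |dirDeriv i g x - dirDeriv i f y| ≤ δ) : ‖gradient g x - gradient f y‖ ≤ 2 * δ := by
  refine (norm_le_abs_add_abs _).trans ?_
  simp only [PiLp.sub_apply, gradient_apply]
  linarith [h 0, h 1]

theorem norm_gradient_le {g : E2 → ℝ} {x : E2} {B : ℝ}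
    (h : ∀ i, |dirDeriv i g x| ≤ B) : ‖gradient g x‖ ≤ 2 * B := by
  refine (norm_le_abs_add_abs _).trans ?_
  simp only [gradient_apply]
  linarith [h 0, h 1]

/-- Bilinearity of the inner product, allowing the function and the point to change together. -/
theorem abs_slope_sub_le {g f : E2 → ℝ} {x y : E2} {C D δ ε : ℝ}
    (h1 : ‖gradient f y‖ ≤ C) (h2 : ‖eigField g x‖ ≤ D)
    (h3 : ‖gradient g x - gradient f y‖ ≤ δ) (h4 : ‖eigField g x - eigField f y‖ ≤ ε) :
    |slope g x - slope f y| ≤ δ * D + C * ε := by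
  have hδ : 0 ≤ δ := (norm_nonneg _).trans h3
  have hC : 0 ≤ C := (norm_nonneg _).trans h1
  have e : slope g x - slope f y = inner ℝ (gradient g x - gradient f y) (eigField g x)
      + inner ℝ (gradient f y) (eigField g x - eigField f y) := by
    rw [slope, slope, inner_sub_left, inner_sub_right]; ring
  rw [e]
  refine (abs_add_le _ _).trans (add_le_add ?_ ?_)
  · exact (abs_real_inner_le_norm _ _).trans (by gcongr)
  · exact (abs_real_inner_le_norm _ _).trans (by gcongr)

/-- A symmetric 2 × 2 matrix with zero gap is a multiple of the identity and has only one
eigenvalue. -/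
theorem RegularRegion.eigGap_pos {f : E2 → ℝ} {H : Set E2} (hH : RegularRegion f H) {x : E2}
    (hx : x ∈ H) : 0 < eigGap (d2 f x) := by
  refine (eigGap_nonneg _).lt_of_ne fun h0 => ?_
  obtain ⟨l₁, l₂, hne, h₁, h₂⟩ := hH.2.2 x hx
  have hsq := eigGap_sq (d2 f x)
  rw [← h0] at hsq
  have hv : d2 f x 1 = 0 := by nlinarith [sq_nonneg (d2 f x 1), sq_nonneg (d2 f x 2 - d2 f x 0)]
  have hd : d2 f x 2 = d2 f x 0 := by
    nlinarith [sq_nonneg (d2 f x 1), sq_nonneg (d2 f x 2 - d2 f x 0)]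
  have hM : hessian f x = d2 f x 0 • (1 : Matrix (Fin 2) (Fin 2) ℝ) := by
    have e0 : d2 f x 0 = partialDeriv 2 0 f x := rfl
    have e1 : d2 f x 1 = partialDeriv 1 1 f x := rfl
    have e2 : d2 f x 2 = partialDeriv 0 2 f x := rfl
    rw [hessian, ← e0, ← e1, ← e2, hv, hd]
    ext i j; fin_cases i <;> fin_cases j <;> simp
  have key : ∀ l : ℝ, Module.End.HasEigenvalue (Matrix.toLin' (hessian f x)) l → l = d2 f x 0 := by
    intro l hl
    obtain ⟨v, hv⟩ := hl.exists_hasEigenvector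
    have h1 := hv.apply_eq_smul
    rw [hM] at h1
    simp at h1
    have : (d2 f x 0 - l) • v = 0 := by rw [sub_smul, h1, sub_self]
    rcases smul_eq_zero.mp this with h | h
    · linarith
    · exact absurd h hv.2
  exact hne ((key _ h₁).trans (key _ h₂).symm)

/-- The square root in `eigG` is smooth only away from zero, which is why the gap must be positive
at the point. -/
theorem contDiffAt_slope {f : E2 → ℝ} (hf : ContDiff ℝ 4 f) {x : E2}
    (hx : 0 < eigGap (d2 f x)) : ContDiffAt ℝ 1 (slope f) x := by
  have hw : ∀ l : List (Fin 2), l.length ≤ 3 → ContDiff ℝ 1 (mixedDeriv l f) := fun l hl => by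
    exact_mod_cast ContDiff.mixedDeriv (n := 4) (by exact_mod_cast hf) l 1 (by omega)
  have hd : ∀ i, ContDiff ℝ 1 fun y => d2 f y i := by
    intro i
    obtain ⟨l, hl, h⟩ := exists_d2_eq_mixedDeriv i
    simp_rw [h]; exact hw l (by omega)
  have hgap : ContDiffAt ℝ 1 (fun y => eigGap (d2 f y)) x := by
    refine ContDiffAt.sqrt ?_ (Real.sqrt_pos.mp hx).ne'
    exact ContDiff.contDiffAt (by have := hd 0; have := hd 1; have := hd 2; fun_prop)
  have e : slope f = fun y =>
      dirDeriv 0 f y * eigG (d2 f y) 0 + dirDeriv 1 f y * eigG (d2 f y) 1 := by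
    ext y
    simp only [slope, eigField, PiLp.inner_apply, Fin.sum_univ_two, gradient_apply]
    simp [mul_comm]
  rw [e]
  simp_rw [eigG_zero_eq, eigG_one_eq]
  have h0 := (hw [0] (by simp)).contDiffAt (x := x)
  have h1 := (hw [1] (by simp)).contDiffAt (x := x)
  simp only [mixedDeriv] at h0 h1
  have d0 := (hd 0).contDiffAt (x := x)
  have d1 := (hd 1).contDiffAt (x := x)
  have d2' := (hd 2).contDiffAt (x := x)
  fun_prop

end

/-! ### Integral curves -/

section

/-- Since the field is bounded, a solution cannot leave the ball of radius C(n + 1) before time n +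
1; Picard–Lindelöf therefore applies on the whole interval, and uniqueness glues the pieces. -/
theorem exists_isSolution {W : E2 → E2} {K : NNReal} {C : ℝ} (hK : LipschitzWith K W)
    (hC : ∀ x, ‖W x‖ ≤ C) (x₀ : E2) : ∃ γ, IsSolution W x₀ γ := by
  have hC0 : 0 ≤ C := (norm_nonneg _).trans (hC 0)
  have hloc : ∀ n : ℕ, ∃ α : ℝ → E2, α 0 = x₀ ∧
      ∀ t ∈ Set.Ioo (-((n : ℝ) + 1)) (n + 1), HasDerivAt α (W (α t)) t := by
    intro n
    have h0 : (0 : ℝ) ∈ Set.Icc (-((n : ℝ) + 1)) (n + 1) := ⟨by linarith, by positivity⟩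
    have hP : IsPicardLindelof (fun _ => W) (⟨0, h0⟩ : Set.Icc (-((n : ℝ) + 1)) (n + 1)) x₀
        (Real.toNNReal (C * (n + 1))) 0 (Real.toNNReal C) K := by
      refine ⟨fun t _ => hK.lipschitzOnWith, fun x _ => continuousOn_const, fun t _ x _ => ?_, ?_⟩
      · rw [Real.coe_toNNReal _ hC0]; exact hC x
      · rw [Real.coe_toNNReal _ hC0, Real.coe_toNNReal _ (by positivity)]
        simp
    obtain ⟨α, h1, h2⟩ := hP.exists_eq_forall_mem_Icc_hasDerivWithinAt₀
    exact ⟨α, h1, fun t ht => (h2 t (Set.Ioo_subset_Icc_self ht)).hasDerivAt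
      (Icc_mem_nhds ht.1 ht.2)⟩
  choose α hα0 hα using hloc
  have huniq : ∀ m n : ℕ, m ≤ n → Set.EqOn (α m) (α n) (Set.Ioo (-((m : ℝ) + 1)) (m + 1)) := by
    intro m n hmn
    have hmn' : (m : ℝ) ≤ n := by exact_mod_cast hmn
    refine ODE_solution_unique_of_mem_Ioo (v := fun _ => W) (s := fun _ => Set.univ) (t₀ := 0)
      (K := K) (fun t _ => hK.lipschitzOnWith) ⟨by linarith [m.cast_nonneg (α := ℝ)], by positivity⟩
      (fun t ht => ⟨hα m t ht, trivial⟩)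
      (fun t ht => ⟨hα n t ⟨by linarith [ht.1], by linarith [ht.2]⟩, trivial⟩) ?_
    rw [hα0, hα0]
  have hmem : ∀ t : ℝ, t ∈ Set.Ioo (-((⌈|t|⌉₊ : ℝ) + 1)) (⌈|t|⌉₊ + 1) := fun t => by
    have h1 := Nat.le_ceil |t|
    have h2 := neg_abs_le t
    have h3 := le_abs_self t
    exact ⟨by linarith, by linarith⟩
  refine ⟨fun t => α ⌈|t|⌉₊ t, by simpa using hα0 _, fun t => ?_⟩
  -- The ceiling may jump at `t`, but near `t` it is at most ⌈|t|⌉₊ + 1, and all pieces agree with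
  -- that larger one there.
  have hev : (fun s => α ⌈|s|⌉₊ s) =ᶠ[𝓝 t] α (⌈|t|⌉₊ + 1) := by
    have : ∀ᶠ s in 𝓝 t, |s| < |t| + 1 :=
      (continuous_abs.tendsto t).eventually_lt_const (by linarith)
    filter_upwards [this] with s hs
    refine huniq _ _ ?_ (hmem s)
    refine Nat.ceil_le.mpr ?_
    push_cast
    linarith [Nat.le_ceil |t|]
  refine HasDerivAt.congr_of_eventuallyEq ?_ hev
  rw [hev.self_of_nhds]
  refine hα _ t ?_
  have := hmem t
  push_cast
  exact ⟨by linarith [this.1], by linarith [this.2]⟩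

theorem IsSolution.unique {W : E2 → E2} {K : NNReal} (hK : LipschitzWith K W) {x₀ : E2}
    {γ γ' : ℝ → E2} (h : IsSolution W x₀ γ) (h' : IsSolution W x₀ γ') : γ = γ' :=
  ODE_solution_unique_univ (v := fun _ => W) (s := fun _ => Set.univ) (t₀ := 0)
    (fun _ => hK.lipschitzOnWith) (fun t => ⟨h.2 t, trivial⟩) (fun t => ⟨h'.2 t, trivial⟩)
    (h.1.trans h'.1.symm)

theorem IsSolution.continuous {W : E2 → E2} {x₀ : E2} {γ : ℝ → E2} (h : IsSolution W x₀ γ) :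
    Continuous γ :=
  continuous_iff_continuousAt.mpr fun t => (h.2 t).continuousAt

/-- Time reversal reduces estimates at negative times to Gronwall's inequality, which runs forward.
-/
theorem IsSolution.reverse {W : E2 → E2} {x₀ : E2} {γ : ℝ → E2} (h : IsSolution W x₀ γ) :
    IsSolution (fun x => -W x) x₀ (fun t => γ (-t)) := by
  refine ⟨by simpa using h.1, fun t => ?_⟩
  have : HasDerivAt (fun t => γ (-t)) ((-1 : ℝ) • W (γ (-t))) t :=
    (h.2 (-t)).scomp t (hasDerivAt_neg t)
  rw [neg_one_smul] at this
  exact this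

theorem IsSolution.shift {W : E2 → E2} {x₀ : E2} {γ : ℝ → E2} (h : IsSolution W x₀ γ) (s : ℝ) :
    IsSolution W (γ s) (fun t => γ (s + t)) := by
  refine ⟨by simp, fun t => ?_⟩
  exact (h.2 (s + t)).comp_const_add s t

theorem integralCurve_isSolution {W : E2 → E2} {x₀ : E2} (h : ∃ γ, IsSolution W x₀ γ) :
    IsSolution W x₀ (integralCurve W x₀) := by
  rw [integralCurve, dif_pos h]
  exact h.choose_spec

theorem norm_sub_le_of_isSolution {W : E2 → E2} {K : NNReal} (hK : LipschitzWith K W) {x y : E2}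
    {γ γ' : ℝ → E2} (h : IsSolution W x γ) (h' : IsSolution W y γ') (t : ℝ) :
    ‖γ t - γ' t‖ ≤ ‖x - y‖ * Real.exp (K * |t|) := by
  have fwd : ∀ (W : E2 → E2), LipschitzWith K W → ∀ {γ γ' : ℝ → E2}, IsSolution W x γ →
      IsSolution W y γ' → ∀ t, 0 ≤ t → ‖γ t - γ' t‖ ≤ ‖x - y‖ * Real.exp (K * t) := by
    intro W hK γ γ' h h' t ht
    have := dist_le_of_trajectories_ODE (v := fun _ => W) (a := 0) (b := t) (fun _ => hK)
      h.continuous.continuousOn (fun s _ => (h.2 s).hasDerivWithinAt)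
      h'.continuous.continuousOn (fun s _ => (h'.2 s).hasDerivWithinAt)
      (δ := ‖x - y‖) (by rw [h.1, h'.1, dist_eq_norm]) t ⟨ht, le_rfl⟩
    simpa [dist_eq_norm] using this
  rcases le_total 0 t with ht | ht
  · rw [abs_of_nonneg ht]; exact fwd W hK h h' t ht
  · rw [abs_of_nonpos ht]
    simpa using fwd _ hK.neg h.reverse h'.reverse (-t) (by linarith)

theorem norm_sub_le_mul_abs_of_isSolution {W : E2 → E2} {C : ℝ} (hC : ∀ x, ‖W x‖ ≤ C) {x : E2}
    {γ : ℝ → E2} (h : IsSolution W x γ) (s t : ℝ) : ‖γ t - γ s‖ ≤ C * |t - s| := by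
  have := convex_univ.norm_image_sub_le_of_norm_hasDerivWithin_le (f := γ)
    (f' := fun t => W (γ t)) (C := C) (fun r _ => (h.2 r).hasDerivWithinAt) (fun r _ => hC _)
    (Set.mem_univ s) (Set.mem_univ t)
  simpa using this

/-- The fields are close only on a ball, so γ' must be shown not to leave it. Up to its first exit
Gronwall applies, and `hsmall` then keeps γ' within distance less than 1 of γ, hence inside the
ball. -/
theorem norm_sub_le_of_field_close {W W' : E2 → E2} {K : NNReal} (hK0 : 0 < K)
    (hK : LipschitzWith K W) {x₀ : E2} {γ γ' : ℝ → E2} (h : IsSolution W x₀ γ)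
    (h' : IsSolution W' x₀ γ') {R T ε : ℝ} (hγ : ∀ t, |t| ≤ T → ‖γ t‖ ≤ R - 1)
    (hε : ∀ x, ‖x‖ ≤ R → ‖W' x - W x‖ ≤ ε) (hsmall : ε / K * Real.exp (K * T) < 1) {t : ℝ}
    (ht : |t| ≤ T) : ‖γ' t - γ t‖ ≤ ε / K * Real.exp (K * T) := by
  have hKr : (0 : ℝ) < K := hK0
  have fwd : ∀ (W W' : E2 → E2), LipschitzWith K W → ∀ {γ γ' : ℝ → E2}, IsSolution W x₀ γ →
      IsSolution W' x₀ γ' → (∀ t, |t| ≤ T → ‖γ t‖ ≤ R - 1) →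
      (∀ x, ‖x‖ ≤ R → ‖W' x - W x‖ ≤ ε) → ∀ t, 0 ≤ t → t ≤ T →
      ‖γ' t - γ t‖ ≤ ε / K * Real.exp (K * T) := by
    intro W W' hK γ γ' h h' hγ hε t ht0 htT
    have hR : ‖x₀‖ ≤ R - 1 := by
      have := hγ 0 (by simpa using ht0.trans htT)
      rwa [h.1] at this
    have hε0 : 0 ≤ ε := (norm_nonneg _).trans (hε x₀ (by linarith))
    have gron : ∀ u, 0 ≤ u → u ≤ T → (∀ s ∈ Set.Ico 0 u, ‖γ' s‖ ≤ R) →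
        ‖γ' u - γ u‖ ≤ ε / K * Real.exp (K * T) := by
      intro u hu0 huT hb
      have := dist_le_of_approx_trajectories_ODE (v := fun _ => W) (a := 0) (b := u)
        (f := γ') (f' := fun s => W' (γ' s)) (g := γ) (g' := fun s => W (γ s)) (εf := ε) (εg := 0)
        (δ := 0) (fun _ => hK)
        h'.continuous.continuousOn (fun s _ => (h'.2 s).hasDerivWithinAt)
        (fun s hs => by rw [dist_eq_norm]; exact hε _ (hb s hs))
        h.continuous.continuousOn (fun s _ => (h.2 s).hasDerivWithinAt) (by simp)
        (by rw [h.1, h'.1, dist_self]) u ⟨hu0, le_rfl⟩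
      rw [dist_eq_norm, gronwallBound_of_K_ne_0 hKr.ne'] at this
      refine this.trans ?_
      simp only [sub_zero, add_zero, zero_mul, zero_add]
      have h1 : Real.exp (K * u) ≤ Real.exp (K * T) := Real.exp_le_exp.mpr (by gcongr)
      have : 0 ≤ ε / K := by positivity
      nlinarith
    by_contra hcon
    have hne : ¬ ∀ s ∈ Set.Ico 0 t, ‖γ' s‖ ≤ R := fun hb => hcon (gron t ht0 htT hb)
    push Not at hne
    obtain ⟨s, hs, hsR⟩ := hne
    -- The minimum of this set is the first exit time.
    have hcomp : IsCompact (Set.Icc 0 s ∩ {r | R ≤ ‖γ' r‖}) :=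
      isCompact_Icc.inter_right (isClosed_le continuous_const h'.continuous.norm)
    obtain ⟨r, hr, hmin⟩ := hcomp.exists_isMinOn ⟨s, ⟨hs.1, le_rfl⟩, hsR.le⟩ continuousOn_id
    have hrT : r ≤ T := by linarith [hr.1.2, hs.2]
    have hb : ∀ q ∈ Set.Ico 0 r, ‖γ' q‖ ≤ R := by
      intro q hq
      by_contra hq'
      have := hmin (⟨⟨hq.1, hq.2.le.trans hr.1.2⟩, (not_le.mp hq').le⟩ :
        q ∈ Set.Icc 0 s ∩ {r | R ≤ ‖γ' r‖})
      simp only [id] at this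
      exact absurd (show r ≤ q from this) (not_le.mpr hq.2)
    have h1 := gron r hr.1.1 hrT hb
    have h2 := hγ r (by rw [abs_of_nonneg hr.1.1]; exact hrT)
    have h3 : R ≤ ‖γ' r‖ := hr.2
    have h4 : ‖γ' r‖ ≤ ‖γ' r - γ r‖ + ‖γ r‖ := by simpa using norm_add_le (γ' r - γ r) (γ r)
    linarith
  rcases le_total 0 t with ht0 | ht0
  · exact fwd W W' hK h h' hγ hε t ht0 ((le_abs_self t).trans ht)
  · have := fwd (fun x => -W x) (fun x => -W' x) hK.neg h.reverse h'.reverse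
      (fun t ht => hγ (-t) (by rwa [abs_neg]))
      (fun x hx => by
        have := hε x hx
        rwa [← norm_neg, show -(-W' x - -W x) = W' x - W x by abel])
      (-t) (by linarith) ((neg_le_abs t).trans ht)
    simpa using this

/-- With Z(s) the integral of W' - W along γ, the difference γ' - γ - Z has derivative W'(γ') -
W'(γ), so W' - W is never estimated pointwise. Gronwall gives ρ(exp(L|t|) - 1), and adding ‖Z‖ ≤ ρ
cancels the -1. The Lipschitz condition is on W', the field of the estimator. -/
theorem norm_sub_le_of_integral_field_sub {W W' : E2 → E2} {x₀ : E2} {γ γ' : ℝ → E2}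
    (hW : Continuous W) (hW' : Continuous W')
    (h : IsSolution W x₀ γ) (h' : IsSolution W' x₀ γ') {B : Set E2} {L ρ t : ℝ} (hL : 0 < L)
    (hLip : ∀ x ∈ B, ∀ y ∈ B, ‖W' x - W' y‖ ≤ L * ‖x - y‖)
    (hγ : ∀ s ∈ Set.uIcc 0 t, γ s ∈ B) (hγ' : ∀ s ∈ Set.uIcc 0 t, γ' s ∈ B)
    (hρ : ∀ s ∈ Set.uIcc 0 t, ‖∫ r in (0 : ℝ)..s, (W' (γ r) - W (γ r))‖ ≤ ρ) :
    ‖γ' t - γ t‖ ≤ ρ * Real.exp (L * |t|) := by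
  have fwd : ∀ (W W' : E2 → E2), Continuous W → Continuous W' → ∀ {γ γ' : ℝ → E2},
      IsSolution W x₀ γ → IsSolution W' x₀ γ' →
      (∀ x ∈ B, ∀ y ∈ B, ‖W' x - W' y‖ ≤ L * ‖x - y‖) → ∀ t, 0 ≤ t →
      (∀ s ∈ Set.Icc 0 t, γ s ∈ B) → (∀ s ∈ Set.Icc 0 t, γ' s ∈ B) →
      (∀ s ∈ Set.Icc 0 t, ‖∫ r in (0 : ℝ)..s, (W' (γ r) - W (γ r))‖ ≤ ρ) →
      ‖γ' t - γ t‖ ≤ ρ * Real.exp (L * t) := by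
    intro W W' hW hW' γ γ' h h' hLip t ht hγ hγ' hρ
    have hγc := h.continuous
    have hc : Continuous fun r => W' (γ r) - W (γ r) := by fun_prop
    set Z : ℝ → E2 := fun s => ∫ r in (0 : ℝ)..s, (W' (γ r) - W (γ r)) with hZ
    have hZd : ∀ s, HasDerivAt Z (W' (γ s) - W (γ s)) s := fun s =>
      hc.integral_hasStrictDerivAt 0 s |>.hasDerivAt
    have hE : ∀ s, HasDerivAt (fun s => γ' s - γ s - Z s) (W' (γ' s) - W' (γ s)) s := by
      intro s
      exact (((h'.2 s).fun_sub (h.2 s)).fun_sub (hZd s)).congr_deriv (by abel)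
    have hb := norm_le_gronwallBound_of_norm_deriv_right_le (f := fun s => γ' s - γ s - Z s)
      (f' := fun s => W' (γ' s) - W' (γ s)) (δ := 0) (K := L) (ε := L * ρ) (a := 0) (b := t)
      (fun s _ => (hE s).continuousAt.continuousWithinAt) (fun s _ => (hE s).hasDerivWithinAt)
      (by simp [hZ, h.1, h'.1]) (fun s hs => by
        have hs' : s ∈ Set.Icc 0 t := ⟨hs.1, hs.2.le⟩
        refine (hLip _ (hγ' s hs') _ (hγ s hs')).trans ?_
        have e : γ' s - γ s = (γ' s - γ s - Z s) + Z s := by abel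
        have h1 : ‖γ' s - γ s‖ ≤ ‖γ' s - γ s - Z s‖ + ‖Z s‖ := by
          conv_lhs => rw [e]
          exact norm_add_le _ _
        have h2 := hρ s hs'
        calc L * ‖γ' s - γ s‖ ≤ L * (‖γ' s - γ s - Z s‖ + ρ) := by gcongr; linarith
          _ = _ := by ring) t ⟨ht, le_rfl⟩
    rw [gronwallBound_of_K_ne_0 hL.ne'] at hb
    have h2 := hρ t ⟨ht, le_rfl⟩
    have h1 : ‖γ' t - γ t‖ ≤ ‖γ' t - γ t - Z t‖ + ‖Z t‖ := by
      have e : γ' t - γ t = (γ' t - γ t - Z t) + Z t := by abel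
      conv_lhs => rw [e]
      exact norm_add_le _ _
    have h3 : (0 : ℝ) * Real.exp (L * (t - 0)) + L * ρ / L * (Real.exp (L * (t - 0)) - 1)
        = ρ * Real.exp (L * t) - ρ := by field_simp; simp
    replace hb := hb.trans_eq h3
    linarith
  rcases le_total 0 t with ht0 | ht0
  · rw [Set.uIcc_of_le ht0] at hγ hγ' hρ
    rw [abs_of_nonneg ht0]
    exact fwd W W' hW hW' h h' hLip t ht0 hγ hγ' hρ
  · rw [Set.uIcc_of_ge ht0] at hγ hγ' hρ
    rw [abs_of_nonpos ht0]
    have := fwd (fun x => -W x) (fun x => -W' x) hW.neg hW'.neg h.reverse h'.reverse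
      (fun x hx y hy => by
        have := hLip x hx y hy
        rwa [← norm_neg, show -(-W' x - -W' y) = W' x - W' y by abel])
      (-t) (by linarith) (fun s hs => hγ (-s) ⟨by linarith [hs.2], by linarith [hs.1]⟩)
      (fun s hs => hγ' (-s) ⟨by linarith [hs.2], by linarith [hs.1]⟩)
      (fun s hs => by
        have h1 := hρ (-s) ⟨by linarith [hs.2], by linarith [hs.1]⟩
        have h2 := intervalIntegral.integral_comp_neg (a := 0) (b := s)
          (fun r => -W' (γ r) - -W (γ r))
        rw [h2, intervalIntegral.integral_symm, neg_zero, ← intervalIntegral.integral_neg]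
        simpa [neg_add_eq_sub] using h1)
    simpa using this

end

/-! ### Stability of the nearest filament time -/

section

theorem exists_pos_forall_le_of_isCompact {s : Set ℝ} (hs : IsCompact s) {F : ℝ → ℝ}
    (hF : Continuous F) (hpos : ∀ t ∈ s, 0 < F t) : ∃ c > 0, ∀ t ∈ s, c ≤ F t := by
  rcases s.eq_empty_or_nonempty with rfl | hne
  · exact ⟨1, one_pos, by simp⟩
  · obtain ⟨t, ht, hmin⟩ := hs.exists_isMinOn hne hF.continuousOn
    exact ⟨F t, hpos t ht, fun u hu => hmin hu⟩

theorem exists_sign_of_hasDerivAt {φ : ℝ → ℝ} {θ d : ℝ} (hd : HasDerivAt φ d θ) (h0 : φ θ = 0)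
    (hd0 : d ≠ 0) : ∃ r > 0, ∀ t, |t - θ| < r → t ≠ θ → 0 < φ t * (d * (t - θ)) := by
  have h1 := hasDerivAt_iff_tendsto_slope.mp hd
  have h2 : ∀ᶠ t in 𝓝[≠] θ, 0 < _root_.slope φ θ t * d :=
    (h1.mul_const d).eventually_const_lt (mul_self_pos.mpr hd0)
  rw [eventually_nhdsWithin_iff, Metric.eventually_nhds_iff] at h2
  obtain ⟨r, hr, h⟩ := h2
  refine ⟨r, hr, fun t ht hne => ?_⟩
  have h3 := h (by rwa [Real.dist_eq]) hne
  rw [slope_def_field, h0, sub_zero] at h3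
  have h4 : 0 < (t - θ) ^ 2 := by have := sub_ne_zero.mpr hne; positivity
  have h5 : φ t * (d * (t - θ)) = φ t / (t - θ) * d * (t - θ) ^ 2 := by
    have := sub_ne_zero.mpr hne
    field_simp
  rw [h5]; positivity

/-- Stability of the point nearest to zero among the zeros of `φ` at which `l` is negative. -/
theorem argmin_stability {φ l : ℝ → ℝ} (hφ : Continuous φ) (hl : Continuous l) {θ d : ℝ}
    (hθ : IsNearest {t | φ t = 0 ∧ l t < 0} θ)
    (huniq : ∀ t, IsNearest {t | φ t = 0 ∧ l t < 0} t → t = θ)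
    (hnd : ∀ t, |t| ≤ |θ| → ¬(l t = 0 ∧ φ t = 0)) (hd : HasDerivAt φ d θ) (hd0 : d ≠ 0)
    {ε : ℝ} (hε : 0 < ε) :
    ∃ η > 0, ∀ φ' l' : ℝ → ℝ, Continuous φ' → Continuous l' →
      (∀ t, |t| ≤ |θ| + 1 → |φ' t - φ t| ≤ η) → (∀ t, |t| ≤ |θ| + 1 → |l' t - l t| ≤ η) →
      ∀ t, IsArgminOrZero {s | φ' s = 0 ∧ l' s < 0} t → φ' t = 0 ∧ |t - θ| ≤ ε := by
  obtain ⟨⟨hφθ, hlθ⟩, hmin⟩ := hθ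
  obtain ⟨r, hr, hsign⟩ := exists_sign_of_hasDerivAt hd hφθ hd0
  obtain ⟨r', hr', hneg⟩ : ∃ r' > 0, ∀ t, |t - θ| < r' → l t < l θ / 2 := by
    have := (hl.tendsto θ).eventually_lt_const (show l θ < l θ / 2 by linarith)
    obtain ⟨r', hr', h⟩ := Metric.eventually_nhds_iff.mp this
    exact ⟨r', hr', fun t ht => h (by rwa [Real.dist_eq])⟩
  obtain ⟨ε₁, hε₁, hε₁ε, hε₁1, hε₁r, hε₁r'⟩ :
      ∃ ε₁ > 0, ε₁ ≤ ε ∧ ε₁ ≤ 1 ∧ ε₁ < r ∧ ε₁ < r' := by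
    refine ⟨min (min ε 1) (min r r' / 2), by positivity, ?_, ?_, ?_, ?_⟩
    · exact (min_le_left _ _).trans (min_le_left _ _)
    · exact (min_le_left _ _).trans (min_le_right _ _)
    · have := min_le_right (min ε 1) (min r r' / 2); have := min_le_left r r'; linarith
    · have := min_le_right (min ε 1) (min r r' / 2); have := min_le_right r r'; linarith
  -- M is nonpositive exactly where φ = 0 and l ≤ 0. For |t| ≤ |θ| nondegeneracy makes l < 0 at such
  -- a point, so it would be a nearest time and equal to θ by uniqueness; hence M > 0 on the compact
  -- set `A` of times away from θ.
  set M : ℝ → ℝ := fun t => max |φ t| (l t) with hM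
  have hMc : Continuous M := by fun_prop
  set A : Set ℝ := {t | |t| ≤ |θ| ∧ ε₁ / 2 ≤ |t - θ|} with hA
  have habs : ∀ c : ℝ, IsCompact {t : ℝ | |t| ≤ c} := fun c => by
    have : {t : ℝ | |t| ≤ c} = Set.Icc (-c) c := by ext t; simp [abs_le]
    rw [this]; exact isCompact_Icc
  have hAc : IsCompact A := (habs |θ|).inter_right
    (isClosed_le continuous_const (by fun_prop : Continuous fun t : ℝ => |t - θ|))
  have hMA : A ⊆ {t | 0 < M t} := by
    intro t ht
    by_contra hcon
    have hle : M t ≤ 0 := not_lt.mp hcon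
    have h1 : |φ t| ≤ 0 := (le_max_left _ _).trans hle
    have h2 : l t ≤ 0 := (le_max_right _ _).trans hle
    have h3 : φ t = 0 := abs_nonpos_iff.mp h1
    have h4 : l t < 0 := lt_of_le_of_ne h2 fun h => hnd t ht.1 ⟨h, h3⟩
    have h5 : t = θ := huniq t ⟨⟨h3, h4⟩, fun s hs => ht.1.trans (hmin s hs)⟩
    have := ht.2
    rw [h5] at this
    simp at this
    linarith
  -- The perturbed minimizer may have modulus slightly above |θ|, where nothing is assumed.
  -- Positivity of M is open, so it persists near `A`, and ε₂ is chosen small enough to use this.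
  obtain ⟨δ, hδ, hthick⟩ := hAc.exists_thickening_subset_open
    (isOpen_lt continuous_const hMc) hMA
  obtain ⟨ε₂, hε₂, hε₂δ, hε₂ε⟩ : ∃ ε₂ > 0, ε₂ < δ ∧ ε₂ ≤ ε₁ / 2 :=
    ⟨min (δ / 2) (ε₁ / 2), by positivity, (min_le_left _ _).trans_lt (by linarith),
      min_le_right _ _⟩
  obtain ⟨c, hc, hcM⟩ : ∃ c > 0, ∀ t ∈ {t | |t| ≤ |θ| + ε₂ ∧ ε₁ ≤ |t - θ|}, c ≤ M t := by
    refine exists_pos_forall_le_of_isCompact ((habs _).inter_right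
      (isClosed_le continuous_const (by fun_prop : Continuous fun t : ℝ => |t - θ|))) hMc ?_
    intro t ht
    obtain ⟨t', ht', hd'⟩ : ∃ t', |t'| ≤ |θ| ∧ |t - t'| ≤ ε₂ := by
      have h1 := abs_le.mp (show |t| ≤ |θ| + ε₂ from ht.1)
      have h2 := abs_nonneg θ
      rcases le_total |t| |θ| with h | h
      · exact ⟨t, h, by simpa using hε₂.le⟩
      · rcases le_total 0 t with h0 | h0
        · rw [abs_of_nonneg h0] at h
          exact ⟨|θ|, by simp, abs_le.mpr ⟨by linarith, by linarith⟩⟩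
        · rw [abs_of_nonpos h0] at h
          exact ⟨-|θ|, by simp, abs_le.mpr ⟨by linarith, by linarith⟩⟩
    refine hthick (Metric.mem_thickening_iff.mpr ⟨t', ⟨ht', ?_⟩, ?_⟩)
    · have := abs_sub_le t t' θ
      have : ε₁ ≤ |t - θ| := ht.2
      linarith
    · rw [Real.dist_eq]; linarith
  have hpt : ∀ u : ℝ, |u| = ε₂ → φ (θ + u) ≠ 0 := by
    intro u hu h
    have := hsign (θ + u) (by rw [add_sub_cancel_left, hu]; linarith) (by
      intro h; simp at h; rw [h] at hu; simp at hu; linarith)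
    rw [h] at this; simp at this
  have hκ1 := abs_pos.mpr (hpt ε₂ (abs_of_pos hε₂))
  have hκ2 := abs_pos.mpr (hpt (-ε₂) (by rw [abs_neg, abs_of_pos hε₂]))
  -- The first two conditions preserve the opposite signs of φ at θ ± ε₂, the third keeps l'
  -- negative near θ, and the last excludes perturbed filament times far from θ.
  obtain ⟨η, hη, hη1, hη2, hη3, hη4⟩ : ∃ η > 0, η < |φ (θ + ε₂)| ∧ η < |φ (θ + -ε₂)| ∧
      η < -l θ / 2 ∧ η < c := by
    have h3 : 0 < -l θ / 2 := by linarith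
    refine ⟨min (min |φ (θ + ε₂)| |φ (θ + -ε₂)|) (min (-l θ / 2) c) / 2, by positivity, ?_⟩
    have hm : 0 < min (min |φ (θ + ε₂)| |φ (θ + -ε₂)|) (min (-l θ / 2) c) := by positivity
    have a1 := min_le_left (min |φ (θ + ε₂)| |φ (θ + -ε₂)|) (min (-l θ / 2) c)
    have a2 := min_le_right (min |φ (θ + ε₂)| |φ (θ + -ε₂)|) (min (-l θ / 2) c)
    have b1 := min_le_left |φ (θ + ε₂)| |φ (θ + -ε₂)|
    have b2 := min_le_right |φ (θ + ε₂)| |φ (θ + -ε₂)|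
    have c1 := min_le_left (-l θ / 2) c
    have c2 := min_le_right (-l θ / 2) c
    exact ⟨by linarith, by linarith, by linarith, by linarith⟩
  refine ⟨η, hη, fun φ' l' hφ' hl' hcφ hcl t ht => ?_⟩
  have hrange : ∀ t, |t - θ| ≤ ε₁ → |t| ≤ |θ| + 1 := fun t ht => by
    have := abs_sub_abs_le_abs_sub t θ
    linarith
  have hl'neg : ∀ t, |t - θ| ≤ ε₁ → l' t < 0 := fun t ht => by
    have h1 := hneg t (by linarith)
    have h2 := (abs_le.mp (hcl t (hrange t ht))).2
    linarith
  obtain ⟨t₁, ht₁, hφt₁⟩ : ∃ t₁, |t₁ - θ| ≤ ε₂ ∧ φ' t₁ = 0 := by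
    have hs1 := hsign (θ + ε₂) (by rw [add_sub_cancel_left, abs_of_pos hε₂]; linarith)
      (by simp [hε₂.ne'])
    have hs2 := hsign (θ + -ε₂) (by rw [add_sub_cancel_left, abs_neg, abs_of_pos hε₂]; linarith)
      (by simp [hε₂.ne'])
    rw [add_sub_cancel_left] at hs1 hs2
    have k1 := abs_le.mp (hcφ (θ + ε₂) (hrange _ (by
      rw [add_sub_cancel_left, abs_of_pos hε₂]; linarith)))
    have k2 := abs_le.mp (hcφ (θ + -ε₂) (hrange _ (by
      rw [add_sub_cancel_left, abs_neg, abs_of_pos hε₂]; linarith)))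
    have hsub : ∀ t ∈ Set.uIcc (θ + -ε₂) (θ + ε₂), |t - θ| ≤ ε₂ := fun t ht => by
      rw [Set.uIcc_of_le (by linarith)] at ht
      exact abs_le.mpr ⟨by linarith [ht.1], by linarith [ht.2]⟩
    have hivt := intermediate_value_uIcc (f := φ') (a := θ + -ε₂) (b := θ + ε₂)
      hφ'.continuousOn
    have hz : (0 : ℝ) ∈ Set.uIcc (φ' (θ + -ε₂)) (φ' (θ + ε₂)) := by
      rcases lt_or_gt_of_ne hd0 with hd' | hd'
      · have p1 : φ (θ + ε₂) < 0 := by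
          by_contra h
          have : φ (θ + ε₂) * (d * ε₂) ≤ 0 :=
            mul_nonpos_of_nonneg_of_nonpos (not_lt.mp h) (by nlinarith)
          linarith
        have p2 : 0 < φ (θ + -ε₂) := by
          by_contra h
          have : φ (θ + -ε₂) * (d * -ε₂) ≤ 0 :=
            mul_nonpos_of_nonpos_of_nonneg (not_lt.mp h) (by nlinarith)
          linarith
        rw [abs_of_neg p1] at hη1
        rw [abs_of_pos p2] at hη2
        exact Set.mem_uIcc.mpr (Or.inr ⟨by linarith, by linarith⟩)
      · have p1 : 0 < φ (θ + ε₂) := by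
          by_contra h
          have : φ (θ + ε₂) * (d * ε₂) ≤ 0 :=
            mul_nonpos_of_nonpos_of_nonneg (not_lt.mp h) (by positivity)
          linarith
        have p2 : φ (θ + -ε₂) < 0 := by
          by_contra h
          have : φ (θ + -ε₂) * (d * -ε₂) ≤ 0 :=
            mul_nonpos_of_nonneg_of_nonpos (not_lt.mp h) (by nlinarith)
          linarith
        rw [abs_of_pos p1] at hη1
        rw [abs_of_neg p2] at hη2
        exact Set.mem_uIcc.mpr (Or.inl ⟨by linarith, by linarith⟩)
    obtain ⟨t₁, h1, h2⟩ := hivt hz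
    exact ⟨t₁, hsub t₁ h1, h2⟩
  have ht₁abs : |t₁| ≤ |θ| + ε₂ := by
    have := abs_sub_abs_le_abs_sub t₁ θ
    linarith
  have hclose : ∀ s, φ' s = 0 → l' s < 0 → |s| ≤ |θ| + ε₂ → |s - θ| ≤ ε₁ := by
    intro s h1 h2 h3
    by_contra hcon
    have h4 := hcM s ⟨h3, (not_le.mp hcon).le⟩
    have h5 := hcφ s (by linarith)
    have h6 := (abs_le.mp (hcl s (by linarith))).1
    rw [h1, zero_sub, abs_neg] at h5
    rcases le_max_iff.mp h4 with h | h <;> linarith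
  -- The set of perturbed filament times need not be closed, since l' < 0 is an open condition.
  -- Those with |s| ≤ |t₁| lie within ε₁ of θ, where l' < 0 is automatic, so minimizing over a
  -- compact set of zeros of φ' suffices. Existence must be proved: otherwise `IsArgminOrZero` need
  -- not force `t` to be a minimizer.
  have hex : ∃ s, IsNearest {s | φ' s = 0 ∧ l' s < 0} s := by
    have hcomp : IsCompact ({s | |s| ≤ |t₁|} ∩ {s | φ' s = 0 ∧ |s - θ| ≤ ε₁}) :=
      (habs _).inter_right ((isClosed_eq hφ' continuous_const).inter
        (isClosed_le (by fun_prop : Continuous fun t : ℝ => |t - θ|) continuous_const))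
    obtain ⟨s, hs, hsmin⟩ := hcomp.exists_isMinOn ⟨t₁, le_refl |t₁|, hφt₁, by linarith⟩
      continuous_abs.continuousOn
    refine ⟨s, ⟨hs.2.1, hl'neg s hs.2.2⟩, fun u hu => ?_⟩
    rcases le_total |u| |t₁| with h | h
    · exact hsmin ⟨h, hu.1, hclose u hu.1 hu.2 (h.trans ht₁abs)⟩
    · exact hs.1.trans h
  obtain ⟨⟨h1, h2⟩, h3⟩ := ht.1 hex
  have h4 := h3 t₁ ⟨hφt₁, hl'neg t₁ (by linarith)⟩
  exact ⟨h1, (hclose t h1 h2 (h4.trans ht₁abs)).trans hε₁ε⟩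

end

/-! ### Regular flows -/

section

/-- `g` is four times differentiable and its derivatives of orders one to three are bounded
by `B`. -/
structure FlowRegular (g : E2 → ℝ) (B : ℝ) : Prop where
  diff : DiffFour g
  pos : 0 < B
  bound : ∀ l : List (Fin 2), 1 ≤ l.length → l.length ≤ 3 → ∀ x, |mixedDeriv l g x| ≤ B

namespace FlowRegular

variable {g : E2 → ℝ} {B : ℝ}

theorem norm_eigField_le (hg : FlowRegular g B) (x : E2) : ‖eigField g x‖ ≤ 24 * B :=
  Filament.norm_eigField_le fun l hl => hg.bound l (by omega) (by omega) x

theorem norm_eigField_sub_le (hg : FlowRegular g B) (x y : E2) :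
    ‖eigField g x - eigField g y‖ ≤ 48 * B * ‖x - y‖ :=
  Filament.norm_eigField_sub_le hg.diff convex_univ
    (fun l hl x _ => hg.bound l (by omega) (by omega) x) (Set.mem_univ x) (Set.mem_univ y)

theorem lipschitz (hg : FlowRegular g B) : LipschitzWith (Real.toNNReal (48 * B)) (eigField g) :=
  LipschitzWith.of_dist_le_mul fun x y => by
    have := hg.pos
    rw [Real.coe_toNNReal _ (by positivity), dist_eq_norm, dist_eq_norm]
    exact hg.norm_eigField_sub_le x y

theorem curve_isSolution (hg : FlowRegular g B) (x : E2) :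
    IsSolution (eigField g) x (curve g x) :=
  integralCurve_isSolution (exists_isSolution hg.lipschitz hg.norm_eigField_le x)

theorem curve_zero (hg : FlowRegular g B) (x : E2) : curve g x 0 = x := (hg.curve_isSolution x).1

theorem hasDerivAt_curve (hg : FlowRegular g B) (x : E2) (t : ℝ) :
    HasDerivAt (curve g x) (eigField g (curve g x t)) t := (hg.curve_isSolution x).2 t

theorem continuous_curve (hg : FlowRegular g B) (x : E2) : Continuous (curve g x) :=
  (hg.curve_isSolution x).continuous

theorem curve_curve (hg : FlowRegular g B) (x : E2) (s t : ℝ) :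
    curve g (curve g x s) t = curve g x (s + t) :=
  congrFun ((hg.curve_isSolution _).unique hg.lipschitz ((hg.curve_isSolution x).shift s)) t

theorem norm_curve_sub_le (hg : FlowRegular g B) (x y : E2) (t : ℝ) :
    ‖curve g x t - curve g y t‖ ≤ ‖x - y‖ * Real.exp (48 * B * |t|) := by
  have := norm_sub_le_of_isSolution hg.lipschitz (hg.curve_isSolution x) (hg.curve_isSolution y) t
  rwa [Real.coe_toNNReal _ (by have := hg.pos; positivity)] at this

theorem norm_curve_sub_le_time (hg : FlowRegular g B) (x : E2) (s t : ℝ) :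
    ‖curve g x t - curve g x s‖ ≤ 24 * B * |t - s| :=
  norm_sub_le_mul_abs_of_isSolution hg.norm_eigField_le (hg.curve_isSolution x) s t

theorem continuous_curve_uncurry (hg : FlowRegular g B) :
    Continuous fun p : E2 × ℝ => curve g p.1 p.2 := by
  rw [continuous_iff_continuousAt]
  rintro ⟨x, t⟩
  rw [ContinuousAt, tendsto_iff_norm_sub_tendsto_zero]
  have hb : Tendsto (fun p : E2 × ℝ => ‖p.1 - x‖ * Real.exp (48 * B * |p.2|) +
      24 * B * |p.2 - t|) (𝓝 (x, t)) (𝓝 0) := by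
    have : Continuous (fun p : E2 × ℝ => ‖p.1 - x‖ * Real.exp (48 * B * |p.2|) +
      24 * B * |p.2 - t|) := by fun_prop
    simpa using this.tendsto (x, t)
  refine squeeze_zero (fun _ => norm_nonneg _) (fun p => ?_) hb
  have e : curve g p.1 p.2 - curve g x t =
      (curve g p.1 p.2 - curve g x p.2) + (curve g x p.2 - curve g x t) := by abel
  rw [e]
  exact (norm_add_le _ _).trans (add_le_add (hg.norm_curve_sub_le _ _ _)
    (hg.norm_curve_sub_le_time _ _ _))

/-- A Lipschitz field replaces a second derivative of the curve: the constant is the Lipschitz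
constant 48 B times the speed bound 24 B. -/
theorem norm_curve_taylor_le (hg : FlowRegular g B) (x : E2) (s t : ℝ) :
    ‖curve g x t - curve g x s - (t - s) • eigField g (curve g x s)‖ ≤
      48 * B * (24 * B) * |t - s| ^ 2 := by
  have hB := hg.pos
  have := (convex_uIcc s t).norm_image_sub_le_of_norm_hasDerivWithin_le
    (f := fun r => curve g x r - (r - s) • eigField g (curve g x s))
    (f' := fun r => eigField g (curve g x r) - eigField g (curve g x s))
    (C := 48 * B * (24 * B * |t - s|))
    (fun r _ => by
      have h1 : HasDerivAt (fun r : ℝ => (r - s) • eigField g (curve g x s))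
          ((1 : ℝ) • eigField g (curve g x s)) r :=
        ((hasDerivAt_id r).sub_const s).smul_const _
      rw [one_smul] at h1
      exact ((hg.hasDerivAt_curve x r).fun_sub h1).hasDerivWithinAt)
    (fun r hr => by
      refine (hg.norm_eigField_sub_le _ _).trans ?_
      have h1 := hg.norm_curve_sub_le_time x s r
      have h2 : |r - s| ≤ |t - s| := Set.abs_sub_left_of_mem_uIcc hr
      have h3 : ‖curve g x r - curve g x s‖ ≤ 24 * B * |t - s| := h1.trans (by gcongr)
      gcongr)
    Set.left_mem_uIcc Set.right_mem_uIcc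
  simp only [sub_self, zero_smul, sub_zero, Real.norm_eq_abs] at this
  have e : curve g x t - curve g x s - (t - s) • eigField g (curve g x s) =
      curve g x t - (t - s) • eigField g (curve g x s) - curve g x s := by abel
  rw [e]
  refine this.trans (le_of_eq ?_)
  ring

theorem abs_slope_sub_le (hg : FlowRegular g B) (x y : E2) :
    |slope g x - slope g y| ≤ 200 * B ^ 2 * ‖x - y‖ := by
  have hB := hg.pos
  have h3 : ‖gradient g x - gradient g y‖ ≤ 2 * (2 * B * ‖x - y‖) :=
    norm_gradient_sub_le fun i => abs_sub_le_of_dirDeriv convex_univ (hg.diff [i] (by simp))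
      (fun z _ j => hg.bound [j, i] (by simp) (by simp) z) (Set.mem_univ x) (Set.mem_univ y)
  refine (Filament.abs_slope_sub_le (norm_gradient_le fun i => hg.bound [i] (by simp) (by simp) y)
    (hg.norm_eigField_le x) h3 (hg.norm_eigField_sub_le x y)).trans ?_
  -- The two contributions are 4B · 24B and 2B · 48B, in total 192 B².
  have : 0 ≤ B ^ 2 * ‖x - y‖ := by positivity
  nlinarith

theorem abs_lam2_sub_le (hg : FlowRegular g B) (x y : E2) :
    |lam2 g x - lam2 g y| ≤ 6 * B * ‖x - y‖ := by
  refine (abs_eigJ_sub_le (abs_d2_sub_le hg.diff convex_univ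
    (fun l hl x _ => hg.bound l (by omega) (by omega) x) (Set.mem_univ x)
    (Set.mem_univ y))).trans (le_of_eq ?_)
  ring

end FlowRegular

theorem SmoothDensity.exists_flowRegular {f : E2 → ℝ} (hf : SmoothDensity f) :
    ∃ B, FlowRegular f B := by
  have hd := diffFour_of_contDiff hf.2.1
  obtain ⟨B, hB, h⟩ := exists_bound_mixedDeriv hd hf.2.2
  exact ⟨B, hd, hB, fun l h1 h2 => h l h1 (by omega)⟩

theorem hasDerivAt_slope_curve {g : E2 → ℝ} {B : ℝ} (hg : FlowRegular g B) {x : E2} {t : ℝ}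
    (hd : DifferentiableAt ℝ (slope g) (curve g x t)) :
    HasDerivAt (fun s => slope g (curve g x s))
      (fderiv ℝ (slope g) (curve g x t) (eigField g (curve g x t))) t :=
  hd.hasFDerivAt.comp_hasDerivAt t (hg.hasDerivAt_curve x t)

/-! ### The filament as reached from the starting points. -/

section Filament

variable {f : E2 → ℝ} {H L : Set E2} {a B : ℝ}

theorem isNearest_theta (hF : CompactFilament f H L a) {x : E2} (hx : x ∈ startSet f L a) :
    IsNearest (filTimes f x) (theta f x) := by
  have hex : ∃ t, IsNearest (filTimes f x) t := (hF.2.2.2.2.1 x hx).exists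
  rw [theta, dif_pos hex]
  exact hex.choose_spec

theorem eq_theta (hF : CompactFilament f H L a) {x : E2} (hx : x ∈ startSet f L a) {t : ℝ}
    (ht : IsNearest (filTimes f x) t) : t = theta f x :=
  (hF.2.2.2.2.1 x hx).unique ht (isNearest_theta hF hx)

theorem curve_theta_mem (hF : CompactFilament f H L a) {x : E2} (hx : x ∈ startSet f L a) :
    curve f x (theta f x) ∈ L := by
  rw [hF.2.2.2.2.2]
  exact ⟨x, hx, rfl⟩

theorem slope_lam2_of_mem (hF : CompactFilament f H L a) {z : E2} (hz : z ∈ L) :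
    slope f z = 0 ∧ lam2 f z < 0 := by
  rw [hF.2.2.2.2.2] at hz
  obtain ⟨x, hx, rfl⟩ := hz
  exact (isNearest_theta hF hx).1

/-- A starting point lies on the curve of a filament point at some time in [-a, a]; flowing back
reaches the filament, so this time bounds the minimum. -/
theorem abs_theta_le (hf : FlowRegular f B) (hF : CompactFilament f H L a) {x : E2}
    (hx : x ∈ startSet f L a) : |theta f x| ≤ a := by
  obtain ⟨y, hy, t, h1, h2, rfl⟩ := id hx
  have hmem : -t ∈ filTimes f (curve f y t) := by
    change slope f (curve f (curve f y t) (-t)) = 0 ∧ _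
    rw [hf.curve_curve, add_neg_cancel, hf.curve_zero]
    exact slope_lam2_of_mem hF hy
  refine ((isNearest_theta hF hx).2 _ hmem).trans ?_
  rw [abs_neg]; exact abs_le.mpr ⟨h1, h2⟩

theorem curve_eq_curve_theta (hf : FlowRegular f B) (x : E2) (s : ℝ) :
    curve f x s = curve f (curve f x (theta f x)) (s - theta f x) := by
  rw [hf.curve_curve]; congr 1; ring

theorem isCompact_startSet (hf : FlowRegular f B) (hL : IsCompact L) :
    IsCompact (startSet f L a) := by
  have : startSet f L a = (fun p : E2 × ℝ => curve f p.1 p.2) '' (L ×ˢ Set.Icc (-a) a) := by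
    ext x; constructor
    · rintro ⟨y, hy, t, h1, h2, rfl⟩; exact ⟨(y, t), ⟨hy, h1, h2⟩, rfl⟩
    · rintro ⟨⟨y, t⟩, ⟨hy, h1, h2⟩, rfl⟩; exact ⟨y, hy, t, h1, h2, rfl⟩
  rw [this]
  exact (hL.prod isCompact_Icc).image hf.continuous_curve_uncurry

/-- The derivative of `slope f` along the flow is continuous near a filament point, so
transversality there persists with a quantitative bound on a ball. -/
theorem exists_slope_deriv_ge (hF1 : SmoothDensity f) (hF2 : RegularRegion f H)
    (hF5 : TransversalOn f L) (hLH : L ⊆ H) {z : E2} (hz : z ∈ L) :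
    ∃ m > 0, ∃ r > 0, ∀ x ∈ Metric.ball z r, DifferentiableAt ℝ (slope f) x ∧
      m ≤ |fderiv ℝ (slope f) x (eigField f x)| := by
  have hC := contDiffAt_slope hF1.2.1 (hF2.eigGap_pos (hLH hz))
  have hev : ∀ᶠ x in 𝓝 z, ContDiffAt ℝ 1 (slope f) x := hC.eventually (by simp)
  have hcont : ContinuousAt (fun x => |fderiv ℝ (slope f) x (eigField f x)|) z := by
    have h1 : ContinuousAt (fderiv ℝ (slope f)) z :=
      (hC.fderiv_right (m := 0) (by norm_num)).continuousAt
    have h2 : ContinuousAt (eigField f) z :=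
      (diffFour_of_contDiff hF1.2.1).continuous_eigField.continuousAt
    exact (h1.clm_apply h2).abs
  have hne : 0 < |fderiv ℝ (slope f) z (eigField f z)| := by
    have := hF5 z hz
    rw [gradient, InnerProductSpace.toDual_symm_apply] at this
    exact abs_pos.mpr this
  have hev2 := hcont.eventually_const_le
    (show |fderiv ℝ (slope f) z (eigField f z)| / 2 < |fderiv ℝ (slope f) z (eigField f z)|
      by linarith)
  obtain ⟨r, hr, h⟩ := Metric.eventually_nhds_iff_ball.mp (hev.and hev2)
  exact ⟨_, half_pos hne, r, hr, fun x hx =>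
    ⟨(h x hx).1.differentiableAt (by norm_num), (h x hx).2⟩⟩

end Filament

end

/-! ### Deviation of the filament of a perturbed density -/

section

theorem mul_abs_sub_le_of_hasDerivAt {φ φ' : ℝ → ℝ} {m s t : ℝ}
    (hd : ∀ r ∈ Set.uIcc s t, HasDerivAt φ (φ' r) r) (hm : ∀ r ∈ Set.uIcc s t, m ≤ |φ' r|) :
    m * |t - s| ≤ |φ t - φ s| := by
  have key : ∀ {s t : ℝ}, s < t → (∀ r ∈ Set.Icc s t, HasDerivAt φ (φ' r) r) →
      (∀ r ∈ Set.Icc s t, m ≤ |φ' r|) → m * |t - s| ≤ |φ t - φ s| := by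
    intro s t hst hd hm
    obtain ⟨c, hc, he⟩ := exists_hasDerivAt_eq_slope φ φ' hst
      (fun r hr => (hd r hr).continuousAt.continuousWithinAt)
      (fun r hr => hd r (Set.Ioo_subset_Icc_self hr))
    have h1 : φ t - φ s = φ' c * (t - s) := by
      rw [he]; field_simp [sub_ne_zero.mpr hst.ne']
    rw [h1, abs_mul]
    exact mul_le_mul_of_nonneg_right (hm c (Set.Ioo_subset_Icc_self hc)) (abs_nonneg _)
  rcases lt_trichotomy s t with h | rfl | h
  · rw [Set.uIcc_of_le h.le] at hd hm; exact key h hd hm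
  · simp
  · rw [Set.uIcc_of_ge h.le] at hd hm
    rw [abs_sub_comm t s, abs_sub_comm (φ t)]
    exact key h hd hm

variable {f : E2 → ℝ} {H L : Set E2} {a B : ℝ}

/-- Stability at the fixed curve of `x₁` is applied twice, to the perturbed functions and to the
exact ones along the curve of `x₀`. Both times are then near θ₁, where the slope along the curve of
`x₀` has derivative at least m in modulus; the mean value theorem turns closeness into the linear
bound with C = 1/m. -/
theorem argmin_uniform_local (hf : FlowRegular f B) (hF1 : SmoothDensity f)
    (hF2 : RegularRegion f H) (hF3 : CompactFilament f H L a) (hF5 : TransversalOn f L)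
    (hF6 : NoDegeneratePoint f (H ∪ searchedArcs f L a)) {ε : ℝ} (hε : 0 < ε)
    {x₁ : E2} (hx₁ : x₁ ∈ startSet f L a) :
    ∃ κ > 0, ∃ δ₀ > 0, ∃ C > 0, ∀ x₀ ∈ startSet f L a, ‖x₀ - x₁‖ < κ → ∀ δ ≤ δ₀,
      ∀ φ l : ℝ → ℝ, Continuous φ → Continuous l →
      (∀ t, |t| ≤ a + 1 → |φ t - slope f (curve f x₀ t)| ≤ δ) →
      (∀ t, |t| ≤ a + 1 → |l t - lam2 f (curve f x₀ t)| ≤ δ) →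
      ∀ t, IsArgminOrZero {s | φ s = 0 ∧ l s < 0} t →
        |t - theta f x₀| ≤ C * δ ∧ |t - theta f x₀| ≤ ε := by
  have hB := hf.pos
  have ha := hF3.1
  set θ₁ := theta f x₁ with hθ₁
  have hθ₁a : |θ₁| ≤ a := abs_theta_le hf hF3 hx₁
  obtain ⟨m, hm, r, hr, hball⟩ := exists_slope_deriv_ge hF1 hF2 hF5 hF3.2.2.1
    (curve_theta_mem hF3 hx₁)
  obtain ⟨hdiff, hge⟩ := hball _ (Metric.mem_ball_self hr)
  -- Both times will be within ε' of θ₁, hence within 2 ε' of each other; at speed at most 24 B the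
  -- curve of `x₁` moves at most r/4 in time ε'.
  obtain ⟨ε', hε', hε'ε, hε'1, hε'r⟩ : ∃ ε' > 0, 2 * ε' ≤ ε ∧ ε' ≤ 1 ∧ 24 * B * ε' ≤ r / 4 := by
    refine ⟨min (min (ε / 2) 1) (r / 4 / (24 * B)), by positivity, ?_, ?_, ?_⟩
    · have := min_le_left (min (ε / 2) 1) (r / 4 / (24 * B))
      have := min_le_left (ε / 2) 1
      linarith
    · exact (min_le_left _ _).trans (min_le_right _ _)
    · have := min_le_right (min (ε / 2) 1) (r / 4 / (24 * B))
      rw [le_div_iff₀ (by positivity)] at this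
      linarith
  have hslope_c : ∀ x, Continuous fun t => slope f (curve f x t) := fun x =>
    hf.diff.continuous_slope.comp (hf.continuous_curve x)
  have hlam_c : ∀ x, Continuous fun t => lam2 f (curve f x t) := fun x =>
    hf.diff.continuous_lam2.comp (hf.continuous_curve x)
  obtain ⟨η, hη, hstab⟩ := argmin_stability (hslope_c x₁) (hlam_c x₁) (θ := θ₁)
    (isNearest_theta hF3 hx₁) (fun t ht => eq_theta hF3 hx₁ ht)
    (fun t ht hcon => by
      have : curve f x₁ t ∈ {x ∈ H ∪ searchedArcs f L a | lam2 f x = 0 ∧ slope f x = 0} :=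
        ⟨Or.inr ⟨x₁, hx₁, t, ht, rfl⟩, hcon⟩
      rw [hF6] at this
      exact this) (hasDerivAt_slope_curve hf hdiff) (abs_pos.mp (hm.trans_le hge)) hε'
  set E := Real.exp (48 * B * (a + 1)) with hE
  have hE0 : 0 < E := Real.exp_pos _
  set Cs := 200 * B ^ 2 + 6 * B with hCs
  have hCs0 : 0 < Cs := by positivity
  have hcurve : ∀ x₀ t, |t| ≤ a + 1 → ‖curve f x₀ t - curve f x₁ t‖ ≤ ‖x₀ - x₁‖ * E := by
    intro x₀ t ht
    refine (hf.norm_curve_sub_le x₀ x₁ t).trans ?_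
    rw [hE]
    gcongr
  -- Moving the starting point may use half of η, leaving the other half for δ, and displaces the
  -- curves by at most r/4, which keeps them in the ball of radius r.
  refine ⟨min (η / 2 / (Cs * E)) (r / 4 / E), by positivity, η / 2, by positivity, 1 / m,
    by positivity, fun x₀ hx₀ hx₀κ δ hδ φ l hφ hl hφc hlc t ht => ?_⟩
  have hk1 : ‖x₀ - x₁‖ * E * Cs ≤ η / 2 := by
    have := (hx₀κ.trans_le (min_le_left _ _)).le
    rw [le_div_iff₀ (by positivity)] at this
    linarith
  have hk2 : ‖x₀ - x₁‖ * E ≤ r / 4 := by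
    have := (hx₀κ.trans_le (min_le_right _ _)).le
    rwa [le_div_iff₀ hE0] at this
  have hs0 : ∀ t, |t| ≤ a + 1 → |slope f (curve f x₀ t) - slope f (curve f x₁ t)| ≤ η / 2 := by
    intro t ht
    refine (hf.abs_slope_sub_le _ _).trans (le_trans ?_ hk1)
    have h1 := hcurve x₀ t ht
    calc _ ≤ 200 * B ^ 2 * (‖x₀ - x₁‖ * E) := by gcongr
      _ ≤ _ := by rw [mul_comm]; gcongr; rw [hCs]; linarith
  have hl0 : ∀ t, |t| ≤ a + 1 → |lam2 f (curve f x₀ t) - lam2 f (curve f x₁ t)| ≤ η / 2 := by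
    intro t ht
    refine (hf.abs_lam2_sub_le _ _).trans (le_trans ?_ hk1)
    have h1 := hcurve x₀ t ht
    calc _ ≤ 6 * B * (‖x₀ - x₁‖ * E) := by gcongr
      _ ≤ _ := by rw [mul_comm]; gcongr; rw [hCs]; nlinarith
  obtain ⟨hφt, htθ₁⟩ := hstab φ l hφ hl
    (fun t ht => by
      have h1 := hφc t (by linarith)
      have h2 := hs0 t (by linarith)
      have h3 := abs_sub_le (φ t) (slope f (curve f x₀ t)) (slope f (curve f x₁ t))
      linarith)
    (fun t ht => by
      have h1 := hlc t (by linarith)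
      have h2 := hl0 t (by linarith)
      have h3 := abs_sub_le (l t) (lam2 f (curve f x₀ t)) (lam2 f (curve f x₁ t))
      linarith) t ht
  have hnear := isNearest_theta hF3 hx₀
  obtain ⟨hφθ, hθθ₁⟩ := hstab _ _ (hslope_c x₀) (hlam_c x₀)
    (fun t ht => (hs0 t (by linarith)).trans (by linarith))
    (fun t ht => (hl0 t (by linarith)).trans (by linarith)) (theta f x₀)
    ⟨fun _ => hnear, fun h => absurd hnear.1 (by rw [filTimes, h]; simp)⟩
  have hmvt := mul_abs_sub_le_of_hasDerivAt (φ := fun s => slope f (curve f x₀ s))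
    (φ' := fun s => fderiv ℝ (slope f) (curve f x₀ s) (eigField f (curve f x₀ s)))
    (m := m) (s := theta f x₀) (t := t)
  have hin : ∀ s ∈ Set.uIcc (theta f x₀) t, curve f x₀ s ∈ Metric.ball (curve f x₁ θ₁) r := by
    intro s hs
    have h1 : |s - θ₁| ≤ ε' := by
      have h3 := abs_le.mp htθ₁
      have h4 := abs_le.mp hθθ₁
      rcases Set.mem_uIcc.mp hs with h | h <;>
      exact abs_le.mpr ⟨by linarith [h.1], by linarith [h.2]⟩
    have h2 : |s| ≤ a + 1 := by
      have := abs_sub_abs_le_abs_sub s θ₁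
      linarith
    have h3 := hcurve x₀ s h2
    have h4 := hf.norm_curve_sub_le_time x₁ θ₁ s
    have h5 : 24 * B * |s - θ₁| ≤ 24 * B * ε' := by gcongr
    rw [mem_ball_iff_norm]
    have e : curve f x₀ s - curve f x₁ θ₁ =
      (curve f x₀ s - curve f x₁ s) + (curve f x₁ s - curve f x₁ θ₁) := by abel
    rw [e]
    refine (norm_add_le _ _).trans_lt ?_
    linarith
  have hmvt' := hmvt (fun s hs => hasDerivAt_slope_curve hf (hball _ (hin s hs)).1)
    (fun s hs => (hball _ (hin s hs)).2)
  constructor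
  · have h1 := hφc t (by
      have := abs_sub_abs_le_abs_sub t θ₁
      linarith)
    rw [hφt, zero_sub, abs_neg] at h1
    rw [hφθ, sub_zero] at hmvt'
    rw [one_div_mul_eq_div, le_div_iff₀ hm]
    linarith
  · have := abs_sub_le t θ₁ (theta f x₀)
    rw [abs_sub_comm θ₁] at this
    linarith

/-- The local constants become uniform by compactness of `startSet f L a`: finitely many
neighbourhoods cover, and one takes the least δ₀ and the largest C. -/
theorem argmin_uniform (hf : FlowRegular f B) (hF1 : SmoothDensity f)
    (hF2 : RegularRegion f H) (hF3 : CompactFilament f H L a) (hF5 : TransversalOn f L)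
    (hF6 : NoDegeneratePoint f (H ∪ searchedArcs f L a)) {ε : ℝ} (hε : 0 < ε) :
    ∃ δ₀ > 0, ∃ C > 0, ∀ x₀ ∈ startSet f L a, ∀ δ ≤ δ₀,
      ∀ φ l : ℝ → ℝ, Continuous φ → Continuous l →
      (∀ t, |t| ≤ a + 1 → |φ t - slope f (curve f x₀ t)| ≤ δ) →
      (∀ t, |t| ≤ a + 1 → |l t - lam2 f (curve f x₀ t)| ≤ δ) →
      ∀ t, IsArgminOrZero {s | φ s = 0 ∧ l s < 0} t →
        |t - theta f x₀| ≤ C * δ ∧ |t - theta f x₀| ≤ ε := by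
  have ha := hF3.1
  have h := (isCompact_startSet (a := a) hf hF3.2.1).induction_on
    (p := fun U => ∃ δ₀ > 0, ∃ C > 0, ∀ x₀ ∈ U, x₀ ∈ startSet f L a → ∀ δ ≤ δ₀,
      ∀ φ l : ℝ → ℝ, Continuous φ → Continuous l →
      (∀ t, |t| ≤ a + 1 → |φ t - slope f (curve f x₀ t)| ≤ δ) →
      (∀ t, |t| ≤ a + 1 → |l t - lam2 f (curve f x₀ t)| ≤ δ) →
      ∀ t, IsArgminOrZero {s | φ s = 0 ∧ l s < 0} t →
        |t - theta f x₀| ≤ C * δ ∧ |t - theta f x₀| ≤ ε)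
    ⟨1, one_pos, 1, one_pos, by simp⟩
    (fun s t hst ⟨δ₀, h1, C, h2, h⟩ => ⟨δ₀, h1, C, h2, fun x hx => h x (hst hx)⟩)
    (fun s t ⟨δ₁, h1, C₁, h2, h⟩ ⟨δ₂, h1', C₂, h2', h'⟩ => by
      refine ⟨min δ₁ δ₂, lt_min h1 h1', max C₁ C₂, lt_max_of_lt_left h2, ?_⟩
      intro x hx hxG δ hδ φ l hφ hl hφc hlc t ht
      have hδ0 : 0 ≤ δ := (abs_nonneg _).trans (hφc 0 (by simp; linarith))
      rcases hx with hx | hx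
      · obtain ⟨h3, h4⟩ := h x hx hxG δ (hδ.trans (min_le_left _ _)) φ l hφ hl hφc hlc t ht
        exact ⟨h3.trans (by gcongr; exact le_max_left _ _), h4⟩
      · obtain ⟨h3, h4⟩ := h' x hx hxG δ (hδ.trans (min_le_right _ _)) φ l hφ hl hφc hlc t ht
        exact ⟨h3.trans (by gcongr; exact le_max_right _ _), h4⟩)
    (fun x₁ hx₁ => by
      obtain ⟨κ, hκ, δ₀, h1, C, h2, h⟩ := argmin_uniform_local hf hF1 hF2 hF3 hF5 hF6 hε hx₁
      exact ⟨Metric.ball x₁ κ, mem_nhdsWithin_of_mem_nhds (Metric.ball_mem_nhds _ hκ), δ₀, h1, C,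
        h2, fun x hx hxG => h x hxG (by rwa [← mem_ball_iff_norm])⟩)
  obtain ⟨δ₀, h1, C, h2, h⟩ := h
  exact ⟨δ₀, h1, C, h2, fun x hx => h x hx hx⟩

/-- Integrals are controlled only for arcs issuing from `L` with |τ| ≤ a. Seen from the filament
point at time θ, the arc from 0 to s becomes the arc from -θ to s - θ, a difference of two
controlled ones; this gives the factor 2. -/
theorem integral_curve_shift (hf : FlowRegular f B) (hF3 : CompactFilament f H L a)
    {F : E2 → E2} (hF : Continuous F) {ρ : ℝ}
    (hρ : ∀ z ∈ L, ∀ τ, |τ| ≤ a → ‖∫ r in (0 : ℝ)..τ, F (curve f z r)‖ ≤ ρ)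
    {x₀ : E2} (hx₀ : x₀ ∈ startSet f L a) {s : ℝ} (hs : |s - theta f x₀| ≤ a) :
    ‖∫ r in (0 : ℝ)..s, F (curve f x₀ r)‖ ≤ 2 * ρ := by
  set z := curve f x₀ (theta f x₀) with hz
  have hzL : z ∈ L := curve_theta_mem hF3 hx₀
  have e1 : ∫ r in (0 : ℝ)..s, F (curve f x₀ r) =
      ∫ r in (0 : ℝ)..s, F (curve f z (r - theta f x₀)) := by
    congr 1; ext1 r; rw [curve_eq_curve_theta hf x₀ r]
  have hi : ∀ u v : ℝ, IntervalIntegrable (fun r => F (curve f z r)) volume u v := fun u v =>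
    (hF.comp (hf.continuous_curve z)).intervalIntegrable u v
  rw [e1, intervalIntegral.integral_comp_sub_right (fun r => F (curve f z r)),
    ← intervalIntegral.integral_interval_sub_left (hi 0 _) (hi 0 _)]
  refine (norm_sub_le _ _).trans ?_
  have h1 := hρ z hzL _ hs
  have h2 := hρ z hzL (0 - theta f x₀) (by
    rw [zero_sub, abs_neg]; exact abs_theta_le hf hF3 hx₀)
  linarith

/-- The deterministic core: Gronwall bounds the distance between the curves at the estimated time by
a multiple of ρ, and the Taylor remainder with |t - θ| = O(δ) contributes δ². The bound `Bg'` enters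
no constant; it only ensures that `curve g` solves its equation. R is fixed before `Bg` because the
third derivatives will be bounded on the ball of radius R. -/
theorem filament_deviation_le (hf : FlowRegular f B) (hF1 : SmoothDensity f)
    (hF2 : RegularRegion f H) (hF3 : CompactFilament f H L a) (hF5 : TransversalOn f L)
    (hF6 : NoDegeneratePoint f (H ∪ searchedArcs f L a)) :
    ∃ R > 0, ∀ Bg > 0, ∃ δ₀ > 0, ∃ C > 0, ∀ (g : E2 → ℝ) (Bg' : ℝ), FlowRegular g Bg' →
      ∀ δ ≤ δ₀, ∀ ρ : ℝ,
      (∀ l : List (Fin 2), 1 ≤ l.length → l.length ≤ 2 → ∀ x, ‖x‖ ≤ R →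
        |mixedDeriv l g x - mixedDeriv l f x| ≤ δ) →
      (∀ l : List (Fin 2), l.length = 3 → ∀ x, ‖x‖ ≤ R → |mixedDeriv l g x| ≤ Bg) →
      (∀ z ∈ L, ∀ τ, |τ| ≤ a →
        ‖∫ r in (0 : ℝ)..τ, (eigField g (curve f z r) - eigField f (curve f z r))‖ ≤ ρ) →
      ∀ x₀ ∈ startSet f L a, ∀ t, IsArgminOrZero (filTimes g x₀) t →
        ‖(curve g x₀ t - curve f x₀ (theta f x₀)) -
          (t - theta f x₀) • eigField f (curve f x₀ (theta f x₀))‖ ≤ C * (ρ + δ ^ 2) := by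
  have hB := hf.pos
  have ha := hF3.1
  obtain ⟨R₀, hR₀⟩ := (isCompact_startSet (a := a) hf hF3.2.1).isBounded.exists_norm_le
  set R := |R₀| + 24 * B * (a + 1) + 1 with hR
  have hRpos : 0 < R := by positivity
  have hRcurve : ∀ x₀ ∈ startSet f L a, ∀ t, |t| ≤ a + 1 → ‖curve f x₀ t‖ ≤ R - 1 := by
    intro x₀ hx₀ t ht
    have h1 := hf.norm_curve_sub_le_time x₀ 0 t
    rw [hf.curve_zero, sub_zero] at h1
    have h2 : 24 * B * |t| ≤ 24 * B * (a + 1) := by gcongr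
    have h3 := (hR₀ x₀ hx₀).trans (le_abs_self R₀)
    have h4 : ‖curve f x₀ t‖ ≤ ‖curve f x₀ t - x₀‖ + ‖x₀‖ := by
      simpa using norm_add_le (curve f x₀ t - x₀) x₀
    linarith
  -- The tolerance `min a 1` serves twice: |t - θ| ≤ a is needed to shift integrals to the filament,
  -- and |t - θ| ≤ 1 keeps |t| ≤ a + 1.
  obtain ⟨δu, hδu, Cu, hCu, hunif⟩ := argmin_uniform hf hF1 hF2 hF3 hF5 hF6
    (ε := min a 1) (by positivity)
  refine ⟨R, hRpos, fun Bg hBg => ?_⟩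
  set E := Real.exp (48 * B * (a + 1)) with hE
  set c₁ := 24 / (48 * B) * E with hc₁
  have hc₁0 : 0 < c₁ := by positivity
  -- One constant for both functions: the slope costs 96 B + 48 + 200 B² c₁ and the eigenvalue 3 + 6
  -- B c₁, where c₁ δ bounds the distance of the curves.
  set c₂ := 96 * B + 51 + (200 * B ^ 2 + 6 * B) * c₁ with hc₂
  have hc₂0 : 0 < c₂ := by positivity
  refine ⟨min (min 1 (1 / (2 * c₁))) (δu / c₂), by positivity,
    2 * Real.exp (48 * Bg * (a + 1)) + 48 * B * (24 * B) * (Cu * c₂) ^ 2, by positivity, ?_⟩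
  intro g Bg' hg δ hδ ρ hδg h3g hρ x₀ hx₀ t ht
  have hδ0 : 0 ≤ δ := (abs_nonneg _).trans (hδg [0] (by simp) (by simp) 0 (by simpa using hRpos.le))
  have hδ1 : δ ≤ 1 := hδ.trans ((min_le_left _ _).trans (min_le_left _ _))
  have hδ2 : c₁ * δ < 1 := by
    have := hδ.trans ((min_le_left _ _).trans (min_le_right _ _))
    rw [le_div_iff₀ (by positivity)] at this
    linarith
  have hδ3 : c₂ * δ ≤ δu := by
    have := hδ.trans (min_le_right _ _)
    rw [le_div_iff₀ (by positivity)] at this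
    linarith
  have hV : ∀ x, ‖x‖ ≤ R → ‖eigField g x - eigField f x‖ ≤ 24 * δ := fun x hx =>
    norm_eigG_sub_le (abs_d2_diff_le fun l hl => hδg l (by omega) (by omega) x hx)
  have hcrude : ∀ t, |t| ≤ a + 1 → ‖curve g x₀ t - curve f x₀ t‖ ≤ c₁ * δ := by
    intro t ht
    have hK : ((Real.toNNReal (48 * B) : NNReal) : ℝ) = 48 * B :=
      Real.coe_toNNReal _ (by positivity)
    have e : 24 * δ / (48 * B) * Real.exp (48 * B * (a + 1)) = c₁ * δ := by
      rw [hc₁, hE]; ring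
    have := norm_sub_le_of_field_close (K := Real.toNNReal (48 * B))
      (Real.toNNReal_pos.mpr (by positivity)) hf.lipschitz (hf.curve_isSolution x₀)
      (hg.curve_isSolution x₀) (hRcurve x₀ hx₀) hV (by rw [hK, e]; exact hδ2) ht
    rwa [hK, e] at this
  have hgR : ∀ t, |t| ≤ a + 1 → ‖curve g x₀ t‖ ≤ R := by
    intro t ht
    have h1 := hcrude t ht
    have h2 := hRcurve x₀ hx₀ t ht
    have h4 : ‖curve g x₀ t‖ ≤ ‖curve g x₀ t - curve f x₀ t‖ + ‖curve f x₀ t‖ := by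
      simpa using norm_add_le (curve g x₀ t - curve f x₀ t) (curve f x₀ t)
    linarith
  have hslope : ∀ t, |t| ≤ a + 1 →
      |slope g (curve g x₀ t) - slope f (curve f x₀ t)| ≤ c₂ * δ := by
    intro t ht
    have h1 : |slope g (curve g x₀ t) - slope f (curve g x₀ t)| ≤
        2 * δ * (24 * B + 24) + 2 * B * (24 * δ) := by
      refine abs_slope_sub_le (norm_gradient_le fun i => hf.bound [i] (by simp) (by simp) _) ?_
        (norm_gradient_sub_le fun i => hδg [i] (by simp) (by simp) _ (hgR t ht))
        (hV _ (hgR t ht))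
      have h2 := hV _ (hgR t ht)
      have h3 := hf.norm_eigField_le (curve g x₀ t)
      have h4 : ‖eigField g (curve g x₀ t)‖ ≤ ‖eigField g (curve g x₀ t) -
          eigField f (curve g x₀ t)‖ + ‖eigField f (curve g x₀ t)‖ := by
        simpa using norm_add_le (eigField g (curve g x₀ t) - eigField f (curve g x₀ t))
          (eigField f (curve g x₀ t))
      linarith
    have h2 := hf.abs_slope_sub_le (curve g x₀ t) (curve f x₀ t)
    have h3 : 200 * B ^ 2 * ‖curve g x₀ t - curve f x₀ t‖ ≤ 200 * B ^ 2 * (c₁ * δ) := by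
      gcongr; exact hcrude t ht
    have h4 := abs_sub_le (slope g (curve g x₀ t)) (slope f (curve g x₀ t))
      (slope f (curve f x₀ t))
    have h5 : 0 ≤ 6 * B * c₁ * δ := by positivity
    rw [hc₂]
    linarith
  have hlam : ∀ t, |t| ≤ a + 1 →
      |lam2 g (curve g x₀ t) - lam2 f (curve f x₀ t)| ≤ c₂ * δ := by
    intro t ht
    have h1 : |lam2 g (curve g x₀ t) - lam2 f (curve g x₀ t)| ≤ 3 * δ :=
      abs_eigJ_sub_le (abs_d2_diff_le fun l hl => hδg l (by omega) (by omega) _ (hgR t ht))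
    have h2 := hf.abs_lam2_sub_le (curve g x₀ t) (curve f x₀ t)
    have h3 : 6 * B * ‖curve g x₀ t - curve f x₀ t‖ ≤ 6 * B * (c₁ * δ) := by
      gcongr; exact hcrude t ht
    have h4 := abs_sub_le (lam2 g (curve g x₀ t)) (lam2 f (curve g x₀ t))
      (lam2 f (curve f x₀ t))
    have h5 : 0 ≤ 200 * B ^ 2 * c₁ * δ := by positivity
    have h6 : 0 ≤ B * δ := by positivity
    rw [hc₂]
    linarith
  obtain ⟨htC, htε⟩ := hunif x₀ hx₀ (c₂ * δ) hδ3 _ _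
    (hg.diff.continuous_slope.comp (hg.continuous_curve x₀))
    (hg.diff.continuous_lam2.comp (hg.continuous_curve x₀)) hslope hlam t ht
  have hθa := abs_theta_le hf hF3 hx₀
  have hta : |t - theta f x₀| ≤ a := htε.trans (min_le_left _ _)
  have ht1 : |t| ≤ a + 1 := by
    have := abs_sub_abs_le_abs_sub t (theta f x₀)
    have := htε.trans (min_le_right _ _)
    linarith
  have hmem : ∀ s ∈ Set.uIcc 0 t, |s| ≤ a + 1 ∧ |s - theta f x₀| ≤ a := by
    intro s hs
    have h1 := abs_le.mp ht1
    have h2 := abs_le.mp hta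
    have h3 := abs_le.mp hθa
    rcases Set.mem_uIcc.mp hs with h | h <;>
    exact ⟨abs_le.mpr ⟨by linarith [h.1], by linarith [h.2]⟩,
      abs_le.mpr ⟨by linarith [h.1], by linarith [h.2]⟩⟩
  have hρ0 : 0 ≤ ρ := (norm_nonneg _).trans
    (hρ _ (curve_theta_mem hF3 hx₀) 0 (by simpa using ha.le))
  have hfirst : ‖curve g x₀ t - curve f x₀ t‖ ≤ 2 * ρ * Real.exp (48 * Bg * (a + 1)) := by
    have := norm_sub_le_of_integral_field_sub hf.diff.continuous_eigField
      hg.diff.continuous_eigField (hf.curve_isSolution x₀) (hg.curve_isSolution x₀)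
      (B := Metric.closedBall 0 R) (L := 48 * Bg) (ρ := 2 * ρ) (t := t) (by positivity)
      (fun x hx y hy => norm_eigField_sub_le hg.diff (convex_closedBall 0 R)
        (fun l hl x hx => h3g l hl x (by simpa using hx)) hx hy)
      (fun s hs => by
        have := hRcurve x₀ hx₀ s (hmem s hs).1
        simp; linarith)
      (fun s hs => by simpa using hgR s (hmem s hs).1)
      (fun s hs => integral_curve_shift hf hF3 (F := fun x => eigField g x - eigField f x)
        (hg.diff.continuous_eigField.sub hf.diff.continuous_eigField) hρ hx₀ (hmem s hs).2)
    refine this.trans ?_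
    gcongr
  have hsecond := hf.norm_curve_taylor_le x₀ (theta f x₀) t
  have hsq : |t - theta f x₀| ^ 2 ≤ (Cu * c₂) ^ 2 * δ ^ 2 := by
    rw [← mul_pow]
    gcongr
    linarith
  have e : (curve g x₀ t - curve f x₀ (theta f x₀)) -
      (t - theta f x₀) • eigField f (curve f x₀ (theta f x₀)) =
      (curve g x₀ t - curve f x₀ t) + (curve f x₀ t - curve f x₀ (theta f x₀) -
      (t - theta f x₀) • eigField f (curve f x₀ (theta f x₀))) := by abel
  rw [e]
  refine (norm_add_le _ _).trans ?_
  have h1 : 48 * B * (24 * B) * |t - theta f x₀| ^ 2 ≤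
      48 * B * (24 * B) * ((Cu * c₂) ^ 2 * δ ^ 2) := by gcongr
  have h2 : 0 ≤ 48 * B * (24 * B) * (Cu * c₂) ^ 2 * ρ := by positivity
  have h3 : 0 ≤ 2 * Real.exp (48 * Bg * (a + 1)) * δ ^ 2 := by positivity
  linarith

end

/-! ### Uniform deviations of sample means -/

section

variable {Ω : Type*} [MeasurableSpace Ω] {μ : Measure Ω} {X : ℕ → Ω → E2} {f : E2 → ℝ}

/-- The events `A n` have (inner) probability tending to one. -/
def WithHighProb (μ : Measure Ω) (A : ℕ → Ω → Prop) : Prop :=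
  Tendsto (fun n => μ {ω | ¬ A n ω}) atTop (𝓝 0)

theorem WithHighProb.mono {A A' : ℕ → Ω → Prop} (h : WithHighProb μ A)
    (hA : ∀ᶠ n in atTop, ∀ ω, A n ω → A' n ω) : WithHighProb μ A' := by
  refine tendsto_of_tendsto_of_tendsto_of_le_of_le' tendsto_const_nhds h
    (Eventually.of_forall fun _ => zero_le) ?_
  filter_upwards [hA] with n hn
  exact measure_mono fun ω hω hA' => hω (hn ω hA')

theorem WithHighProb.forall_finite {ι : Type*} [Finite ι] {A : ι → ℕ → Ω → Prop}
    (h : ∀ i, WithHighProb μ (A i)) : WithHighProb μ (fun n ω => ∀ i, A i n ω) := by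
  have := Fintype.ofFinite ι
  have hsum : Tendsto (fun n => ∑ i, μ {ω | ¬ A i n ω}) atTop (𝓝 0) := by
    simpa using tendsto_finsetSum Finset.univ fun i _ => h i
  refine tendsto_of_tendsto_of_tendsto_of_le_of_le tendsto_const_nhds hsum
    (fun _ => zero_le) fun n => ?_
  refine (measure_mono ?_).trans (measure_iUnion_fintype_le μ _)
  intro ω hω
  simpa using hω

theorem WithHighProb.and {A A' : ℕ → Ω → Prop} (h : WithHighProb μ A) (h' : WithHighProb μ A') :
    WithHighProb μ (fun n ω => A n ω ∧ A' n ω) := by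
  have := WithHighProb.forall_finite (μ := μ) (ι := Bool) (A := fun b => cond b A A')
    (by rintro (_ | _); exacts [h', h])
  exact this.mono (Eventually.of_forall fun n ω hω => ⟨hω true, hω false⟩)

/-! ### Exponential inequalities for sample means. -/

theorem mgf_le_of_abs_le [IsProbabilityMeasure μ] {Y : Ω → ℝ} (hY : Measurable Y) {b v t : ℝ}
    (hb : ∀ ω, |Y ω| ≤ b) (h0 : ∫ ω, Y ω ∂μ = 0) (hv : ∫ ω, Y ω ^ 2 ∂μ ≤ v) (ht : 0 ≤ t)
    (htb : t * b ≤ 1) : mgf Y μ t ≤ Real.exp (t ^ 2 * v) := by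
  have hint : Integrable Y μ := Integrable.of_bound hY.aestronglyMeasurable b
    (ae_of_all _ fun ω => by simpa using hb ω)
  have hint2 : Integrable (fun ω => Y ω ^ 2) μ :=
    Integrable.of_bound (hY.pow_const 2).aestronglyMeasurable (b ^ 2) (ae_of_all _ fun ω => by
      rw [Real.norm_eq_abs, abs_pow]
      exact pow_le_pow_left₀ (abs_nonneg _) (hb ω) 2)
  -- The elementary bound exp u ≤ 1 + u + u² for |u| ≤ 1 makes the variance appear; the linear term
  -- integrates to zero.
  have hpt : ∀ ω, Real.exp (t * Y ω) ≤ 1 + t * Y ω + t ^ 2 * Y ω ^ 2 := by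
    intro ω
    have h1 : |t * Y ω| ≤ 1 := by
      rw [abs_mul, abs_of_nonneg ht]
      exact (mul_le_mul_of_nonneg_left (hb ω) ht).trans htb
    have h2 := (abs_le.mp (Real.abs_exp_sub_one_sub_id_le h1)).2
    nlinarith
  have hint3 : Integrable (fun ω => 1 + t * Y ω + t ^ 2 * Y ω ^ 2) μ :=
    ((integrable_const _).add (hint.const_mul _)).add (hint2.const_mul _)
  calc mgf Y μ t ≤ ∫ ω, (1 + t * Y ω + t ^ 2 * Y ω ^ 2) ∂μ :=
        integral_mono_of_nonneg (ae_of_all _ fun ω => (Real.exp_pos _).le) hint3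
          (ae_of_all _ hpt)
    _ = 1 + t ^ 2 * ∫ ω, Y ω ^ 2 ∂μ := by
        have h1 : Integrable (fun ω => 1 + t * Y ω) μ := (integrable_const _).add (hint.const_mul _)
        rw [integral_add h1 (hint2.const_mul _),
          integral_add (integrable_const _) (hint.const_mul _),
          integral_const_mul, integral_const_mul, h0]
        simp
    _ ≤ 1 + t ^ 2 * v := by gcongr
    _ ≤ Real.exp (t ^ 2 * v) := by linarith [Real.add_one_le_exp (t ^ 2 * v)]

theorem IsSample.integral_comp (hX : IsSample μ X f) (hf : Continuous f) (hf0 : ∀ x, 0 ≤ f x)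
    (i : ℕ) {ψ : E2 → ℝ} (hψ : Measurable ψ) : ∫ ω, ψ (X i ω) ∂μ = ∫ y, ψ y * f y := by
  rw [← integral_map (hX.1 i).aemeasurable (f := ψ) hψ.aestronglyMeasurable, hX.2.2 i,
    integral_withDensity_eq_integral_toReal_smul (by fun_prop) (by simp)]
  congr 1; ext y
  rw [ENNReal.toReal_ofReal (hf0 y), smul_eq_mul, mul_comm]

/-- The deviation of the sample mean of `ψ` from its expectation. -/
def sampleDev (f : E2 → ℝ) (n : ℕ) (x : ℕ → E2) (ψ : E2 → ℝ) : ℝ :=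
  1 / (n : ℝ) * ∑ i ∈ Finset.range n, ψ (x i) - ∫ y, ψ y * f y

/-- Chernoff's bound. Centring at most doubles the sup norm, whence 2b in `htb`, and does not
increase the second moment. -/
theorem measure_sum_ge_le [IsProbabilityMeasure μ] (hX : IsSample μ X f) (hf : Continuous f)
    (hf0 : ∀ x, 0 ≤ f x) {ψ : E2 → ℝ} (hψ : Measurable ψ) {b v t : ℝ} (hb : ∀ y, |ψ y| ≤ b)
    (hv : ∫ y, ψ y ^ 2 * f y ≤ v) (ht : 0 ≤ t) (htb : t * (2 * b) ≤ 1) (n : ℕ) (s : ℝ) :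
    μ.real {ω | s ≤ ∑ i ∈ Finset.range n, (ψ (X i ω) - ∫ y, ψ y * f y)} ≤
      Real.exp (-t * s + n * (t ^ 2 * v)) := by
  set m := ∫ y, ψ y * f y with hm
  have hint : ∀ i, Integrable (fun ω => ψ (X i ω)) μ := fun i =>
    Integrable.of_bound (hψ.comp (hX.1 i)).aestronglyMeasurable b
      (ae_of_all _ fun ω => by simpa using hb _)
  have hint2 : ∀ i, Integrable (fun ω => ψ (X i ω) ^ 2) μ := fun i =>
    Integrable.of_bound ((hψ.comp (hX.1 i)).pow_const 2).aestronglyMeasurable (b ^ 2)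
      (ae_of_all _ fun ω => by
        rw [Real.norm_eq_abs, abs_pow]
        exact pow_le_pow_left₀ (abs_nonneg _) (hb _) 2)
  have hmi : ∀ i, ∫ ω, ψ (X i ω) ∂μ = m := fun i => hX.integral_comp hf hf0 i hψ
  have hmb : |m| ≤ b := by
    rw [← hmi 0]
    have := norm_integral_le_of_norm_le_const (μ := μ) (f := fun ω => ψ (X 0 ω)) (C := b)
      (ae_of_all _ fun ω => by simpa using hb _)
    simpa using this
  set Y : ℕ → Ω → ℝ := fun i ω => ψ (X i ω) - m with hY
  have hYm : ∀ i, Measurable (Y i) := fun i => (hψ.comp (hX.1 i)).sub_const m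
  have hind : iIndepFun Y μ := hX.2.1.comp (fun _ x => ψ x - m) fun _ => hψ.sub_const m
  have hmgf : ∀ i, mgf (Y i) μ t ≤ Real.exp (t ^ 2 * v) := by
    intro i
    refine mgf_le_of_abs_le (hYm i) (b := 2 * b) (fun ω => ?_) ?_ ?_ ht htb
    · refine (abs_sub _ _).trans ?_
      have := hb (X i ω); linarith
    · rw [hY, integral_sub (hint i) (integrable_const _), hmi]; simp
    · have e : ∀ ω, Y i ω ^ 2 = ψ (X i ω) ^ 2 - 2 * m * ψ (X i ω) + m ^ 2 := fun ω => by
        rw [hY]; ring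
      simp_rw [e]
      have h1 : Integrable (fun ω => ψ (X i ω) ^ 2 - 2 * m * ψ (X i ω)) μ :=
        (hint2 i).sub ((hint i).const_mul _)
      rw [integral_add h1 (integrable_const _), integral_sub (hint2 i) ((hint i).const_mul _),
        integral_const_mul, hmi,
        hX.integral_comp hf hf0 i (ψ := fun y => ψ y ^ 2) (hψ.pow_const 2)]
      simp
      nlinarith [sq_nonneg m]
  have hsumb : ∀ ω, |∑ i ∈ Finset.range n, Y i ω| ≤ n * (2 * b) := by
    intro ω
    refine (Finset.abs_sum_le_sum_abs _ _).trans ?_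
    refine (Finset.sum_le_card_nsmul _ _ (2 * b) fun i _ => ?_).trans (by simp)
    refine (abs_sub _ _).trans ?_
    have := hb (X i ω); linarith
  have hch := measure_ge_le_exp_mul_mgf (μ := μ) (X := ∑ i ∈ Finset.range n, Y i) (t := t) s ht
    (Integrable.of_bound (C := Real.exp (t * (n * (2 * b))))
      (by
        simp only [Finset.sum_apply]
        exact ((Finset.measurable_sum _ fun i _ => hYm i).const_mul t).exp.aestronglyMeasurable)
      (ae_of_all _ fun ω => by
        rw [Real.norm_eq_abs, abs_of_pos (Real.exp_pos _), Real.exp_le_exp, Finset.sum_apply]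
        exact mul_le_mul_of_nonneg_left ((le_abs_self _).trans (hsumb ω)) ht))
  rw [hind.mgf_sum hYm] at hch
  simp only [Finset.sum_apply] at hch
  refine hch.trans ?_
  rw [Real.exp_add]
  gcongr
  calc ∏ i ∈ Finset.range n, mgf (Y i) μ t ≤ ∏ _i ∈ Finset.range n, Real.exp (t ^ 2 * v) :=
        Finset.prod_le_prod (fun i _ => mgf_nonneg) fun i _ => hmgf i
    _ = Real.exp (n * (t ^ 2 * v)) := by
        rw [Finset.prod_const, Finset.card_range, ← Real.exp_nat_mul]

/-- With r² = v log n / n the choice t = r/v in Chernoff's bound turns the exponent into -(M - 1)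
log n. The condition `hbn` says exactly that (2 b t)² ≤ 1, the regime where variance dominates. -/
theorem measure_sampleDev_le [IsProbabilityMeasure μ] (hX : IsSample μ X f) (hf : Continuous f)
    (hf0 : ∀ x, 0 ≤ f x) {ψ : E2 → ℝ} (hψ : Measurable ψ) {b v M : ℝ} (hb : ∀ y, |ψ y| ≤ b)
    (hv : ∫ y, ψ y ^ 2 * f y ≤ v) (hv0 : 0 < v) {n : ℕ} (hn : 1 ≤ n)
    (hbn : 4 * b ^ 2 * Real.log n ≤ n * v) :
    μ.real {ω | M * √(v * Real.log n / n) ≤ |sampleDev f n (fun i => X i ω) ψ|} ≤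
      2 * Real.exp (-(M - 1) * Real.log n) := by
  have hn0 : (0 : ℝ) < n := by exact_mod_cast hn
  have hlog : 0 ≤ Real.log n := Real.log_natCast_nonneg n
  set r := √(v * Real.log n / n) with hr
  have hr0 : 0 ≤ r := Real.sqrt_nonneg _
  have hr2 : r ^ 2 = v * Real.log n / n := Real.sq_sqrt (by positivity)
  have hb0 : 0 ≤ b := (abs_nonneg _).trans (hb 0)
  have htb : r / v * (2 * b) ≤ 1 := by
    rw [← abs_of_nonneg (show 0 ≤ r / v * (2 * b) by positivity)]
    refine abs_le_one_iff_mul_self_le_one.mpr ?_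
    have e : r / v * (2 * b) * (r / v * (2 * b)) = 4 * b ^ 2 * Real.log n / (n * v) := by
      calc _ = r ^ 2 * (4 * b ^ 2) / v ^ 2 := by ring
        _ = _ := by rw [hr2]; field_simp
    rw [e]
    exact div_le_one_of_le₀ hbn (by positivity)
  have hexp : -(r / v) * (n * (M * r)) + n * ((r / v) ^ 2 * v) = -(M - 1) * Real.log n := by
    have e : -(r / v) * (n * (M * r)) + n * ((r / v) ^ 2 * v) = -(M - 1) * (n * r ^ 2 / v) := by
      field_simp; ring
    rw [e, hr2]; field_simp
  have h1 := measure_sum_ge_le hX hf hf0 hψ hb hv (t := r / v) (by positivity) htb n (n * (M * r))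
  have h2 := measure_sum_ge_le hX hf hf0 hψ.neg (by simpa using hb) (by simpa using hv)
    (t := r / v) (by positivity) htb n (n * (M * r))
  rw [hexp] at h1 h2
  have hsub : {ω | M * r ≤ |sampleDev f n (fun i => X i ω) ψ|} ⊆
      {ω | n * (M * r) ≤ ∑ i ∈ Finset.range n, (ψ (X i ω) - ∫ y, ψ y * f y)} ∪
      {ω | n * (M * r) ≤ ∑ i ∈ Finset.range n, ((-ψ) (X i ω) - ∫ y, (-ψ) y * f y)} := by
    intro ω hω
    have hd : sampleDev f n (fun i => X i ω) ψ * n =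
        ∑ i ∈ Finset.range n, (ψ (X i ω) - ∫ y, ψ y * f y) := by
      rw [sampleDev, Finset.sum_sub_distrib]
      simp; field_simp
    have hd' : ∑ i ∈ Finset.range n, ((-ψ) (X i ω) - ∫ y, (-ψ) y * f y) =
        -(sampleDev f n (fun i => X i ω) ψ * n) := by
      rw [hd, ← Finset.sum_neg_distrib]
      congr 1; ext i
      simp [integral_neg]; ring
    rcases le_abs.mp (show M * r ≤ |sampleDev f n (fun i => X i ω) ψ| from hω) with h | h
    · left
      rw [Set.mem_ofPred_eq, ← hd, mul_comm]; gcongr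
    · right
      rw [Set.mem_ofPred_eq, hd', ← neg_mul, mul_comm]; gcongr
  refine (measureReal_mono hsub).trans ((measureReal_union_le _ _).trans ?_)
  linarith

/-- A grid of mesh ρ/2 in three real parameters has O(ρ⁻³) cells meeting `S`. One point of `S` is
picked in each occupied cell, because the functions indexed by the net are controlled only on `S`.
-/
theorem exists_finite_net {S : Set (E2 × ℝ)} (hS : Bornology.IsBounded S) :
    ∃ C > 0, ∀ ρ : ℝ, 0 < ρ → ρ ≤ 1 → ∃ T : Finset (E2 × ℝ), (∀ q ∈ T, q ∈ S) ∧
      (T.card : ℝ) ≤ C * (1 / ρ) ^ 3 ∧ ∀ p ∈ S, ∃ q ∈ T, dist p q ≤ ρ := by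
  classical
  obtain ⟨R, hR0, hR⟩ := hS.exists_pos_norm_le
  refine ⟨(4 * R + 7) ^ 3, by positivity, fun ρ hρ hρ1 => ?_⟩
  set N : ℕ := ⌈2 * R / ρ⌉₊ + 1 with hN
  have hNle : (N : ℝ) ≤ (2 * R + 2) / ρ := by
    rw [hN]; push_cast
    have h1 := (Nat.ceil_lt_add_one (show 0 ≤ 2 * R / ρ by positivity)).le
    have h2 : 1 ≤ 1 / ρ := by rw [le_div_iff₀ hρ]; linarith
    rw [add_div, show (2 : ℝ) / ρ = 1 / ρ + 1 / ρ by ring]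
    linarith
  set c : E2 × ℝ → ℤ × ℤ × ℤ := fun p =>
    (⌊2 * p.1 0 / ρ⌋, ⌊2 * p.1 1 / ρ⌋, ⌊2 * p.2 / ρ⌋) with hc
  have hfl : ∀ u : ℝ, |u| ≤ R → ⌊2 * u / ρ⌋ ∈ Finset.Icc (-(N : ℤ)) N := by
    intro u hu
    have h1 := abs_le.mp hu
    have hce := Nat.le_ceil (2 * R / ρ)
    have h2 : 2 * u / ρ ≤ 2 * R / ρ := by gcongr; exact h1.2
    have h3 : -(2 * R / ρ) ≤ 2 * u / ρ := by
      rw [← neg_div]; gcongr; linarith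
    rw [Finset.mem_Icc]
    constructor
    · rw [Int.le_floor]; push_cast [hN]; linarith
    · have : (⌊2 * u / ρ⌋ : ℝ) ≤ (N : ℤ) := by
        push_cast [hN]; linarith [Int.floor_le (2 * u / ρ)]
      exact_mod_cast this
  set cells : Finset (ℤ × ℤ × ℤ) := Finset.Icc (-(N : ℤ)) N ×ˢ Finset.Icc (-(N : ℤ)) N ×ˢ
    Finset.Icc (-(N : ℤ)) N with hcells
  have hmem : ∀ p ∈ S, c p ∈ cells := by
    intro p hp
    have h1 := hR p hp
    have h2 : ‖p.1‖ ≤ R := (norm_fst_le p).trans h1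
    have h3 : |p.2| ≤ R := (norm_snd_le p).trans h1
    have h4 : ∀ i, |p.1 i| ≤ R := fun i => by
      have := PiLp.norm_apply_le p.1 i
      rw [Real.norm_eq_abs] at this
      exact this.trans h2
    simp only [hcells, hc, Finset.mem_product]
    exact ⟨hfl _ (h4 0), hfl _ (h4 1), hfl _ h3⟩
  set occ := cells.filter (fun k => ∃ p ∈ S, c p = k) with hocc
  have hex : ∀ k : ℤ × ℤ × ℤ, ∃ p, k ∈ occ → p ∈ S ∧ c p = k := by
    intro k
    by_cases h : k ∈ occ
    · obtain ⟨p, hp⟩ := (Finset.mem_filter.mp h).2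
      exact ⟨p, fun _ => hp⟩
    · exact ⟨0, fun h' => absurd h' h⟩
  choose P hP using hex
  refine ⟨occ.image P, ?_, ?_, ?_⟩
  · intro q hq
    obtain ⟨k, hk, rfl⟩ := Finset.mem_image.mp hq
    exact (hP k hk).1
  · have h1 : (occ.image P).card ≤ (2 * N + 1) ^ 3 := by
      refine Finset.card_image_le.trans ((Finset.card_filter_le _ _).trans (le_of_eq ?_))
      have : (Finset.Icc (-(N : ℤ)) N).card = 2 * N + 1 := by
        rw [Int.card_Icc]; omega
      rw [hcells, Finset.card_product, Finset.card_product, this]; ring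
    have h2 : ((occ.image P).card : ℝ) ≤ (2 * N + 1) ^ 3 := by exact_mod_cast h1
    refine h2.trans ?_
    rw [← mul_pow]
    refine pow_le_pow_left₀ (by positivity) ?_ 3
    have h3 : 1 ≤ 1 / ρ := by rw [le_div_iff₀ hρ]; linarith
    have h4 : (2 * R + 2) / ρ = (2 * R + 2) * (1 / ρ) := by ring
    rw [h4] at hNle
    nlinarith
  · intro p hp
    have hpo : c p ∈ occ := Finset.mem_filter.mpr ⟨hmem p hp, p, hp, rfl⟩
    refine ⟨P (c p), Finset.mem_image_of_mem _ hpo, ?_⟩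
    have hq := (hP _ hpo).2
    have hclose : ∀ u w : ℝ, ⌊2 * w / ρ⌋ = ⌊2 * u / ρ⌋ → |u - w| ≤ ρ / 2 := by
      intro u w h
      have := (Int.abs_sub_lt_one_of_floor_eq_floor h.symm).le
      rw [← sub_div, ← mul_sub, abs_div, abs_of_pos hρ, div_le_one hρ, abs_mul, abs_two] at this
      linarith
    simp only [hc, Prod.mk.injEq] at hq
    rw [Prod.dist_eq, max_le_iff, dist_eq_norm, Real.dist_eq]
    constructor
    · refine (norm_le_abs_add_abs _).trans ?_
      have h0 := hclose _ _ hq.1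
      have h1 := hclose _ _ hq.2.1
      simp only [PiLp.sub_apply]
      linarith
    · linarith [hclose _ _ hq.2.2]

/-- Uniform deviation bound for a family of functions indexed by a bounded set of parameters. -/
theorem uniform_sampleDev_le [IsProbabilityMeasure μ] (hX : IsSample μ X f) (hf : Continuous f)
    (hfd : IsDensity f) {S : Set (E2 × ℝ)} (hS : Bornology.IsBounded S)
    {ψ : ℕ → E2 × ℝ → E2 → ℝ} {b v : ℕ → ℝ} (k : ℕ)
    (hψ : ∀ n, ∀ p ∈ S, Measurable (ψ n p))
    (hb : ∀ᶠ n in atTop, ∀ p ∈ S, ∀ y, |ψ n p y| ≤ b n)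
    (hv : ∀ᶠ n in atTop, ∀ p ∈ S, ∫ y, ψ n p y ^ 2 * f y ≤ v n)
    (hlip : ∀ᶠ n : ℕ in atTop, ∀ p ∈ S, ∀ q ∈ S, ∀ y,
      |ψ n p y - ψ n q y| ≤ (n : ℝ) ^ k * dist p q)
    (hbv : ∀ᶠ n : ℕ in atTop, 4 * b n ^ 2 * Real.log n ≤ n * v n)
    (hv1 : ∀ᶠ n in atTop, 1 ≤ v n) :
    ∃ M > 0, WithHighProb μ fun n ω => ∀ p ∈ S,
      |sampleDev f n (fun i => X i ω) (ψ n p)| ≤ M * √(v n * Real.log n / n) := by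
  obtain ⟨C, hC, hnet⟩ := exists_finite_net hS
  set M : ℝ := 3 * (k + 1) + 2 with hM
  refine ⟨M + 2, by positivity, ?_⟩
  have hlim : Tendsto (fun n : ℕ => ENNReal.ofReal (2 * C * (1 / (n : ℝ)))) atTop (𝓝 0) := by
    have : Tendsto (fun n : ℕ => 2 * C * (1 / (n : ℝ))) atTop (𝓝 0) := by
      simpa using tendsto_one_div_atTop_nhds_zero_nat.const_mul (2 * C)
    simpa using ENNReal.tendsto_ofReal this
  refine tendsto_of_tendsto_of_tendsto_of_le_of_le' tendsto_const_nhds hlim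
    (Eventually.of_forall fun _ => zero_le) ?_
  have hlog1 : ∀ᶠ n : ℕ in atTop, 1 ≤ Real.log n :=
    (Real.tendsto_log_atTop.comp tendsto_natCast_atTop_atTop).eventually_ge_atTop 1
  filter_upwards [hb, hv, hlip, hbv, hv1, hlog1, eventually_ge_atTop 1] with
    n hb hv hlip hbv hv1 hlog1 hn1
  have hn0 : (0 : ℝ) < n := by exact_mod_cast hn1
  have hn1' : (1 : ℝ) ≤ n := by exact_mod_cast hn1
  set r := √(v n * Real.log n / n) with hr
  have hr1 : 1 / (n : ℝ) ≤ r := by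
    refine Real.le_sqrt_of_sq_le ?_
    rw [div_pow, one_pow, div_le_div_iff₀ (by positivity) hn0]
    have : 1 ≤ v n * Real.log n := one_le_mul_of_one_le_of_one_le hv1 hlog1
    nlinarith [sq_nonneg (n : ℝ)]
  -- With Lipschitz constant n^k, passing to the net changes the sample mean and the expectation by
  -- at most 1/n ≤ r each; this is the extra 2 in M + 2.
  set ρ : ℝ := (1 / (n : ℝ)) ^ (k + 1) with hρ
  have hρ0 : 0 < ρ := by positivity
  have hρ1 : ρ ≤ 1 := pow_le_one₀ (by positivity) (by rw [div_le_one hn0]; exact hn1')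
  obtain ⟨T, hTS, hTcard, hT⟩ := hnet ρ hρ0 hρ1
  have hnk : (n : ℝ) ^ k * ρ = 1 / n := by
    rw [hρ, pow_succ, ← mul_assoc, ← mul_pow, mul_one_div_cancel hn0.ne', one_pow, one_mul]
  have hlipI : ∀ p ∈ S, ∀ q ∈ S, dist p q ≤ ρ → ∀ x : ℕ → E2,
      |sampleDev f n x (ψ n p) - sampleDev f n x (ψ n q)| ≤ 2 * (1 / n) := by
    intro p hp q hq hpq x
    have hpt : ∀ y, |ψ n p y - ψ n q y| ≤ 1 / n := fun y =>
      (hlip p hp q hq y).trans (by rw [← hnk]; gcongr)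
    have hi : ∀ p ∈ S, Integrable (fun y => ψ n p y * f y) := fun p hp =>
      hfd.2.1.bdd_mul (c := b n) (hψ n p hp).aestronglyMeasurable
        (ae_of_all _ fun y => by simpa using hb p hp y)
    have e : sampleDev f n x (ψ n p) - sampleDev f n x (ψ n q) =
        1 / (n : ℝ) * ∑ i ∈ Finset.range n, (ψ n p (x i) - ψ n q (x i)) -
        ∫ y, (ψ n p y - ψ n q y) * f y := by
      simp_rw [sub_mul]
      rw [integral_sub (hi p hp) (hi q hq), Finset.sum_sub_distrib, sampleDev, sampleDev]
      ring
    have h1 : |1 / (n : ℝ) * ∑ i ∈ Finset.range n, (ψ n p (x i) - ψ n q (x i))| ≤ 1 / n := by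
      rw [abs_mul, abs_of_pos (by positivity : 0 < 1 / (n : ℝ))]
      have : |∑ i ∈ Finset.range n, (ψ n p (x i) - ψ n q (x i))| ≤ n * (1 / n) := by
        refine (Finset.abs_sum_le_sum_abs _ _).trans ?_
        exact (Finset.sum_le_card_nsmul _ _ (1 / (n : ℝ)) fun i _ => hpt _).trans (by simp)
      calc _ ≤ 1 / (n : ℝ) * (n * (1 / n)) := by gcongr
        _ = 1 / n := by field_simp
    have h2 : |∫ y, (ψ n p y - ψ n q y) * f y| ≤ 1 / n := by
      have : ‖∫ y, (ψ n p y - ψ n q y) * f y‖ ≤ ∫ y, 1 / n * f y :=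
        norm_integral_le_of_norm_le (hfd.2.1.const_mul _) (ae_of_all _ fun y => by
          rw [norm_mul, Real.norm_eq_abs, Real.norm_eq_abs, abs_of_nonneg (hfd.1 y)]
          exact mul_le_mul_of_nonneg_right (hpt y) (hfd.1 y))
      rwa [integral_const_mul, hfd.2.2, mul_one, Real.norm_eq_abs] at this
    rw [e]
    refine (abs_sub _ _).trans ?_
    linarith
  have hsub : {ω | ¬ ∀ p ∈ S, |sampleDev f n (fun i => X i ω) (ψ n p)| ≤ (M + 2) * r} ⊆
      ⋃ q ∈ T, {ω | M * r ≤ |sampleDev f n (fun i => X i ω) (ψ n q)|} := by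
    intro ω hω
    have hω' : ∃ p ∈ S, (M + 2) * r < |sampleDev f n (fun i => X i ω) (ψ n p)| := by
      simpa using hω
    obtain ⟨p, hp, hlt⟩ := hω'
    obtain ⟨q, hq, hpq⟩ := hT p hp
    simp only [Set.mem_iUnion]
    refine ⟨q, hq, ?_⟩
    have h1 := hlipI p hp q (hTS q hq) hpq (fun i => X i ω)
    have h2 := abs_sub_abs_le_abs_sub (sampleDev f n (fun i => X i ω) (ψ n p))
      (sampleDev f n (fun i => X i ω) (ψ n q))
    change M * r ≤ _
    linarith
  have hexp : Real.exp (-(M - 1) * Real.log n) = (1 / (n : ℝ)) ^ (3 * (k + 1) + 1) := by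
    have : -(M - 1) * Real.log n = ((3 * (k + 1) + 1 : ℕ) : ℝ) * Real.log (1 / n) := by
      rw [one_div, Real.log_inv, hM]; push_cast; ring
    rw [this, Real.exp_nat_mul, Real.exp_log (by positivity)]
  calc μ {ω | ¬ ∀ p ∈ S, |sampleDev f n (fun i => X i ω) (ψ n p)| ≤ (M + 2) * r}
      ≤ ∑ q ∈ T, μ {ω | M * r ≤ |sampleDev f n (fun i => X i ω) (ψ n q)|} :=
        (measure_mono hsub).trans (measure_biUnion_finset_le _ _)
    _ ≤ ∑ _q ∈ T, ENNReal.ofReal (2 * (1 / (n : ℝ)) ^ (3 * (k + 1) + 1)) := by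
        refine Finset.sum_le_sum fun q hq => ?_
        have := measure_sampleDev_le hX hf hfd.1 (hψ n q (hTS q hq)) (M := M) (hb q (hTS q hq))
          (hv q (hTS q hq)) (by linarith) hn1 hbv
        rw [hexp] at this
        rw [← ofReal_measureReal]
        exact ENNReal.ofReal_le_ofReal this
    _ = ENNReal.ofReal (T.card * (2 * (1 / (n : ℝ)) ^ (3 * (k + 1) + 1))) := by
        rw [Finset.sum_const, nsmul_eq_mul, ENNReal.ofReal_mul (p := (T.card : ℝ)) (by positivity),
          ENNReal.ofReal_natCast]
    _ ≤ ENNReal.ofReal (2 * C * (1 / (n : ℝ))) := by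
        refine ENNReal.ofReal_le_ofReal ?_
        have e : (1 / ρ) ^ 3 * (1 / (n : ℝ)) ^ (3 * (k + 1) + 1) = 1 / n := by
          rw [hρ, pow_succ (1 / (n : ℝ)) (3 * (k + 1)), mul_comm 3, pow_mul, ← mul_assoc,
            ← mul_pow]
          field_simp
        calc _ ≤ C * (1 / ρ) ^ 3 * (2 * (1 / (n : ℝ)) ^ (3 * (k + 1) + 1)) := by gcongr
          _ = 2 * C * ((1 / ρ) ^ 3 * (1 / (n : ℝ)) ^ (3 * (k + 1) + 1)) := by ring
          _ = _ := by rw [e]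

end

/-! ### Kernels and smoothing -/

section

/-- `K` is four times differentiable, vanishes off the unit ball, and its derivatives of orders
zero to four are bounded by `B`. -/
structure KernelBound (K : E2 → ℝ) (B : ℝ) : Prop where
  diff : DiffFour K
  pos : 0 < B
  bound : ∀ l : List (Fin 2), l.length ≤ 4 → ∀ x, |mixedDeriv l K x| ≤ B
  zero : ∀ (l : List (Fin 2)) (x : E2), 1 < ‖x‖ → mixedDeriv l K x = 0

theorem KernelRegular.exists_kernelBound {K : E2 → ℝ} (hK : KernelRegular K) :
    ∃ B, KernelBound K B := by
  have hd := hK.diffFour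
  obtain ⟨B, hB, h⟩ := exists_bound_mixedDeriv hd hK.2.2.2.2.1
  have hcs : HasCompactSupport K := by
    rw [HasCompactSupport, hK.2.2.1]; exact isCompact_closedBall 0 1
  obtain ⟨C, hC⟩ := hcs.exists_bound_of_continuous (hd [] (by simp)).continuous
  refine ⟨max B C, hd, lt_max_of_lt_left hB, fun l hl x => ?_, fun l x hx => ?_⟩
  · rcases Nat.eq_zero_or_pos l.length with h0 | h0
    · rw [List.length_eq_zero_iff.mp h0]
      exact (hC x).trans (le_max_right _ _)
    · exact (h l h0 hl x).trans (le_max_left _ _)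
  · refine image_eq_zero_of_notMem_tsupport fun hmem => ?_
    have := hasCompactSupport_mixedDeriv l hmem
    rw [hK.2.2.1] at this
    simp at this
    linarith

/-- The contribution of an observation at `y` to the derivative along `l` of the kernel density
estimator at `x`. -/
def kernFn (K : E2 → ℝ) (l : List (Fin 2)) (h : ℝ) (x y : E2) : ℝ :=
  h⁻¹ ^ (2 + l.length) * mixedDeriv l K (h⁻¹ • (x - y))

namespace KernelBound

variable {K : E2 → ℝ} {B : ℝ}

theorem continuous_mixedDeriv (hK : KernelBound K B) {l : List (Fin 2)} (hl : l.length ≤ 3) :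
    Continuous (mixedDeriv l K) := (hK.diff l hl).continuous

theorem abs_sub_le (hK : KernelBound K B) {l : List (Fin 2)} (hl : l.length ≤ 3) (x y : E2) :
    |mixedDeriv l K x - mixedDeriv l K y| ≤ 2 * B * ‖x - y‖ :=
  abs_sub_le_of_dirDeriv convex_univ (hK.diff l hl)
    (fun z _ j => hK.bound (j :: l) (by simp; omega) z) (Set.mem_univ x) (Set.mem_univ y)

theorem continuous_kernFn (hK : KernelBound K B) {l : List (Fin 2)} (hl : l.length ≤ 3) (h : ℝ) :
    Continuous fun p : E2 × E2 => kernFn K l h p.1 p.2 := by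
  have := hK.continuous_mixedDeriv hl
  unfold kernFn
  fun_prop

theorem continuous_kernFn_right (hK : KernelBound K B) {l : List (Fin 2)} (hl : l.length ≤ 3)
    (h : ℝ) (x : E2) : Continuous (kernFn K l h x) :=
  (hK.continuous_kernFn hl h).comp (by fun_prop : Continuous fun y : E2 => (x, y))

theorem kernFn_eq_zero (hK : KernelBound K B) (l : List (Fin 2)) {h : ℝ} (hh : 0 < h) {x y : E2}
    (hxy : h < ‖x - y‖) : kernFn K l h x y = 0 := by
  rw [kernFn, hK.zero l, mul_zero]
  rw [norm_smul, norm_inv, Real.norm_eq_abs, abs_of_pos hh, inv_mul_eq_div, one_lt_div hh]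
  exact hxy

theorem abs_kernFn_le (hK : KernelBound K B) {l : List (Fin 2)} (hl : l.length ≤ 4) {h : ℝ}
    (hh : 0 < h) (x y : E2) : |kernFn K l h x y| ≤ B * h⁻¹ ^ (2 + l.length) := by
  rw [kernFn, abs_mul, abs_of_nonneg (by positivity), mul_comm]
  gcongr
  exact hK.bound l hl _

theorem abs_kernFn_sub_le (hK : KernelBound K B) {l : List (Fin 2)} (hl : l.length ≤ 3) {h : ℝ}
    (hh : 0 < h) (x x' y : E2) :
    |kernFn K l h x y - kernFn K l h x' y| ≤ 2 * B * h⁻¹ ^ (3 + l.length) * ‖x - x'‖ := by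
  rw [kernFn, kernFn, ← mul_sub, abs_mul, abs_of_nonneg (by positivity)]
  have h1 := hK.abs_sub_le hl (h⁻¹ • (x - y)) (h⁻¹ • (x' - y))
  rw [← smul_sub, sub_sub_sub_cancel_right, norm_smul, norm_inv, Real.norm_eq_abs,
    abs_of_pos hh] at h1
  calc _ ≤ h⁻¹ ^ (2 + l.length) * (2 * B * (h⁻¹ * ‖x - x'‖)) := by gcongr
    _ = _ := by ring

theorem hasCompactSupport_kernFn (hK : KernelBound K B) (l : List (Fin 2)) {h : ℝ} (hh : 0 < h)
    (x : E2) : HasCompactSupport (kernFn K l h x) :=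
  HasCompactSupport.intro (isCompact_closedBall x h) fun y hy => hK.kernFn_eq_zero l hh (by
    rw [Metric.mem_closedBall, not_le, dist_eq_norm, norm_sub_rev] at hy; exact hy)

theorem integrable_kernFn_mul (hK : KernelBound K B) {l : List (Fin 2)} (hl : l.length ≤ 3) {h : ℝ}
    (hh : 0 < h) (x : E2) {g : E2 → ℝ} (hg : Continuous g) :
    Integrable fun y => kernFn K l h x y * g y :=
  ((hK.continuous_kernFn_right hl h x).mul hg).integrable_of_hasCompactSupport
    (hK.hasCompactSupport_kernFn l hh x).mul_right

/-- Integration by parts. The kernel depends on x - y, so its derivative in y is minus that in x,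
and the two signs cancel. Derivatives thus pass from the kernel to the density. -/
theorem integral_kernFn_cons (hK : KernelBound K B) (i : Fin 2) {l : List (Fin 2)}
    (hl : l.length ≤ 2) {h : ℝ} (hh : 0 < h) (x : E2) {g : E2 → ℝ} (hg : ContDiff ℝ 1 g) :
    ∫ y, kernFn K (i :: l) h x y * g y = ∫ y, kernFn K l h x y * dirDeriv i g y := by
  have hd : ∀ y, HasFDerivAt (kernFn K l h x) (h⁻¹ ^ (2 + l.length) •
      (fderiv ℝ (mixedDeriv l K) (h⁻¹ • (x - y))).comp (h⁻¹ • -ContinuousLinearMap.id ℝ E2)) y :=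
    fun y => (((hK.diff l (by omega)) _).hasFDerivAt.comp y
        (((hasFDerivAt_id y).const_sub x).const_smul h⁻¹)).const_mul _
  have he : ∀ y, fderiv ℝ (kernFn K l h x) y (EuclideanSpace.single i 1) =
      -kernFn K (i :: l) h x y := by
    intro y
    rw [(hd y).fderiv, kernFn, mixedDeriv, dirDeriv]
    simp only [smul_apply, ContinuousLinearMap.comp_apply, neg_apply,
      ContinuousLinearMap.id_apply, smul_eq_mul, smul_neg, map_neg, map_smul, List.length_cons]
    ring
  have hgc : Continuous g := hg.continuous
  have hgd : Continuous (dirDeriv i g) := (ContDiff.dirDeriv (m := 0) hg (by norm_num) i).continuous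
  have hibp := integral_mul_fderiv_eq_neg_fderiv_mul_of_integrable (μ := volume) (𝕜 := ℝ)
    (f := g) (g := kernFn K l h x) (v := EuclideanSpace.single i 1)
    (by
      refine (hK.integrable_kernFn_mul (l := l) (by omega) hh x hgd).congr (ae_of_all _ fun y => ?_)
      exact mul_comm _ _)
    (by
      refine (hK.integrable_kernFn_mul (l := i :: l) (by simp; omega) hh x hgc).neg.congr
        (ae_of_all _ fun y => ?_)
      simp only [he, Pi.neg_apply]; ring)
    (by
      refine (hK.integrable_kernFn_mul (l := l) (by omega) hh x hgc).congr (ae_of_all _ fun y => ?_)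
      exact mul_comm _ _)
    (fun y _ => hg.differentiable (by norm_num) y) (fun y _ => (hd y).differentiableAt)
  simp_rw [he, mul_neg, integral_neg, neg_inj] at hibp
  rw [integral_congr_ae (ae_of_all _ fun y => mul_comm (kernFn K (i :: l) h x y) (g y)), hibp]
  exact integral_congr_ae (ae_of_all _ fun y => mul_comm _ _)

theorem integral_kernFn_eq (hK : KernelBound K B) (l : List (Fin 2)) (hl : l.length ≤ 3) {h : ℝ}
    (hh : 0 < h) (x : E2) {g : E2 → ℝ} {m : ℕ} (hg : ContDiff ℝ m g) (hm : l.length ≤ m) :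
    ∫ y, kernFn K l h x y * g y = ∫ y, kernFn K [] h x y * mixedDeriv l.reverse g y := by
  induction l generalizing g m with
  | nil => rfl
  | cons i l ih =>
    simp only [List.length_cons] at hl hm
    have h1 : ContDiff ℝ 1 g := hg.of_le (by exact_mod_cast (by omega : 1 ≤ m))
    have h2 : ContDiff ℝ ((m - 1 : ℕ)) (Filament.dirDeriv i g) :=
      ContDiff.dirDeriv hg (by exact_mod_cast (by omega : m - 1 + 1 ≤ m)) i
    rw [hK.integral_kernFn_cons i (by omega) hh x h1, ih (by omega) h2 (by omega)]
    have : ∀ l' : List (Fin 2), mixedDeriv l' (dirDeriv i g) = mixedDeriv (l' ++ [i]) g := by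
      intro l'
      induction l' with
      | nil => rfl
      | cons j l' ih => simp only [mixedDeriv, List.cons_append, ih]
    rw [this, List.reverse_cons]

end KernelBound

theorem integral_kernFn_nil {K : E2 → ℝ} {h : ℝ} (hh : 0 < h) (x : E2) (G : E2 → ℝ) :
    ∫ y, kernFn K [] h x y * G y = ∫ u, K u * G (x - h • u) := by
  rw [← integral_sub_left_eq_self _ volume x]
  have e : ∀ y, kernFn K [] h x (x - y) * G (x - y) =
      h⁻¹ ^ 2 * (fun u => K u * G (x - h • u)) (h⁻¹ • y) := by
    intro y
    simp only [kernFn, mixedDeriv, sub_sub_cancel, List.length_nil, add_zero, smul_smul,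
      mul_inv_cancel₀ hh.ne', one_smul]
    ring
  rw [integral_congr_ae (ae_of_all _ e), integral_const_mul,
    Measure.integral_comp_smul volume (fun u => K u * G (x - h • u))]
  simp
  field_simp

/-- The function z ↦ G(x + z) + G(x - z) has partials that are differences of partials of G at
points 2z apart, hence at most 4 B ‖w‖ on the ball of radius ‖w‖. The mean value inequality between
0 and w supplies the second factor ‖w‖. -/
theorem abs_second_difference_le {G : E2 → ℝ} (hG : Differentiable ℝ G)
    (hG' : ∀ i, Differentiable ℝ (dirDeriv i G)) {B : ℝ}
    (hB : ∀ i j x, |dirDeriv j (dirDeriv i G) x| ≤ B) (x w : E2) :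
    |G (x + w) + G (x - w) - 2 * G x| ≤ 8 * B * ‖w‖ ^ 2 := by
  have hB0 : 0 ≤ B := (abs_nonneg _).trans (hB 0 0 0)
  set Φ : E2 → ℝ := fun z => G (x + z) + G (x - z) with hΦ
  have hd : ∀ z, HasFDerivAt Φ (fderiv ℝ G (x + z) + (fderiv ℝ G (x - z)).comp
      (-ContinuousLinearMap.id ℝ E2)) z := by
    intro z
    have h1 : HasFDerivAt (fun z => G (x + z)) ((fderiv ℝ G (x + z)).comp
        (ContinuousLinearMap.id ℝ E2)) z :=
      (hG (x + z)).hasFDerivAt.comp z ((hasFDerivAt_id z).const_add x)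
    have h2 : HasFDerivAt (fun z => G (x - z)) ((fderiv ℝ G (x - z)).comp
        (-ContinuousLinearMap.id ℝ E2)) z :=
      (hG (x - z)).hasFDerivAt.comp z ((hasFDerivAt_id z).const_sub x)
    exact h1.add h2
  have hdir : ∀ i z, dirDeriv i Φ z = dirDeriv i G (x + z) - dirDeriv i G (x - z) := by
    intro i z
    rw [dirDeriv, (hd z).fderiv]
    simp [dirDeriv, sub_eq_add_neg]
  have hkey := abs_sub_le_of_dirDeriv (g := Φ) (s := Metric.closedBall 0 ‖w‖)
    (convex_closedBall 0 ‖w‖) (B := 4 * B * ‖w‖) (fun z => (hd z).differentiableAt)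
    (fun z hz i => by
      rw [hdir]
      have h1 := abs_sub_le_of_dirDeriv convex_univ (hG' i) (B := B) (fun y _ j => hB i j y)
        (Set.mem_univ (x + z)) (Set.mem_univ (x - z))
      have h2 : ‖x + z - (x - z)‖ ≤ 2 * ‖w‖ := by
        have e : x + z - (x - z) = z + z := by abel
        rw [e]
        have h3 : ‖z‖ ≤ ‖w‖ := by simpa using hz
        exact (norm_add_le _ _).trans (by linarith)
      calc _ ≤ 2 * B * ‖x + z - (x - z)‖ := h1
        _ ≤ 2 * B * (2 * ‖w‖) := by gcongr
        _ = _ := by ring) (x := w) (y := 0) (by simp) (by simp)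
  simp only [hΦ, add_zero, sub_zero] at hkey
  rw [two_mul]
  refine hkey.trans (le_of_eq ?_)
  ring

/-! ### Bias of the smoothed derivatives. -/

section Bias

variable {K : E2 → ℝ} {B : ℝ}

theorem abs_integral_kernel_mul_le (hK : IsDensity K) {F : E2 → ℝ} {C : ℝ}
    (hF : ∀ u, K u ≠ 0 → |F u| ≤ C) : |∫ u, K u * F u| ≤ C := by
  have : ‖∫ u, K u * F u‖ ≤ ∫ u, K u * C :=
    norm_integral_le_of_norm_le (hK.2.1.mul_const C) (ae_of_all _ fun u => by
      rw [norm_mul, Real.norm_eq_abs, Real.norm_eq_abs, abs_of_nonneg (hK.1 u)]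
      by_cases h : K u = 0
      · simp [h]
      · exact mul_le_mul_of_nonneg_left (hF u h) (hK.1 u))
  rwa [integral_mul_const, hK.2.2, one_mul, Real.norm_eq_abs] at this

/-- Symmetry of the kernel rewrites twice the bias as an average of second differences, so the
first-order term disappears. -/
theorem abs_smoothing_sub_le (hKB : KernelBound K B) (hK : IsDensity K) (hsym : ∀ x, K (-x) = K x)
    {G : E2 → ℝ} (hG : Differentiable ℝ G) (hG' : ∀ i, Differentiable ℝ (dirDeriv i G)) {C : ℝ}
    (hC : ∀ i j x, |dirDeriv j (dirDeriv i G) x| ≤ C) {h : ℝ} (x : E2) :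
    |(∫ u, K u * G (x - h • u)) - G x| ≤ 8 * C * h ^ 2 := by
  have hKc : Continuous K := hKB.continuous_mixedDeriv (l := []) (by simp)
  have hcs : HasCompactSupport K := HasCompactSupport.intro (isCompact_closedBall 0 1)
    fun y hy => hKB.zero [] y (by simpa using hy)
  have hGc := hG.continuous
  have hC0 : 0 ≤ C := (abs_nonneg _).trans (hC 0 0 0)
  have hi1 : Integrable fun u => K u * G (x - h • u) :=
    (by fun_prop : Continuous fun u => K u * G (x - h • u)).integrable_of_hasCompactSupport
      hcs.mul_right
  have hi2 : Integrable fun u => K u * G (x + h • u) :=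
    (by fun_prop : Continuous fun u => K u * G (x + h • u)).integrable_of_hasCompactSupport
      hcs.mul_right
  have hrefl : ∫ u, K u * G (x + h • u) = ∫ u, K u * G (x - h • u) := by
    rw [← integral_neg_eq_self]
    congr 1; ext u
    rw [hsym, smul_neg, ← sub_eq_add_neg]
  have hsum : ∫ u, K u * (G (x + h • u) + G (x - h • u) - 2 * G x) =
      2 * ((∫ u, K u * G (x - h • u)) - G x) := by
    have e : ∀ u, K u * (G (x + h • u) + G (x - h • u) - 2 * G x) =
      K u * G (x + h • u) + K u * G (x - h • u) - K u * (2 * G x) := fun u => by ring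
    simp_rw [e]
    have h1 : Integrable fun u => K u * G (x + h • u) + K u * G (x - h • u) := hi2.add hi1
    rw [integral_sub h1 (hK.2.1.mul_const _), integral_add hi2 hi1, hrefl, integral_mul_const,
      hK.2.2]
    ring
  have hbound := abs_integral_kernel_mul_le hK
    (F := fun u => G (x + h • u) + G (x - h • u) - 2 * G x) (C := 8 * C * h ^ 2) (fun u hu => by
      refine (abs_second_difference_le hG hG' hC x (h • u)).trans ?_
      have hu1 : ‖u‖ ≤ 1 := by
        by_contra hcon
        exact hu (hKB.zero [] u (not_le.mp hcon))
      have : ‖h • u‖ ^ 2 ≤ h ^ 2 := by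
        rw [norm_smul, mul_pow, Real.norm_eq_abs, sq_abs]
        nlinarith [sq_nonneg h, norm_nonneg u, pow_le_one₀ (n := 2) (norm_nonneg u) hu1]
      gcongr)
  rw [hsum, abs_mul, abs_two] at hbound
  nlinarith [abs_nonneg ((∫ u, K u * G (x - h • u)) - G x)]

theorem integral_kernFn_mul_density (hKB : KernelBound K B) {f : E2 → ℝ} (hf : ContDiff ℝ 4 f)
    {l : List (Fin 2)} (hl : l.length ≤ 3) {h : ℝ} (hh : 0 < h) (x : E2) :
    ∫ y, kernFn K l h x y * f y = ∫ u, K u * mixedDeriv l f (x - h • u) := by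
  rw [hKB.integral_kernFn_eq l hl hh x (m := 4) (by exact_mod_cast hf) (by omega),
    mixedDeriv_reverse (diffFour_of_contDiff hf) l (by omega), integral_kernFn_nil hh]

end Bias

end

/-! ### Uniform rates for the density estimator -/

section

variable {Ω : Type*} [MeasurableSpace Ω] {μ : Measure Ω} {X : ℕ → Ω → E2} {f K : E2 → ℝ}
  {h : ℕ → ℝ} {B : ℝ}

theorem BandwidthRates.eventually_le_one (hh : BandwidthRates h) : ∀ᶠ n in atTop, h n ≤ 1 :=
  hh.2.1.eventually_le_const one_pos

theorem eventually_one_le_log : ∀ᶠ n : ℕ in atTop, 1 ≤ Real.log n :=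
  (Real.tendsto_log_atTop.comp tendsto_natCast_atTop_atTop).eventually_ge_atTop 1

theorem BandwidthRates.eventually_log_le (hh : BandwidthRates h) (A : ℝ) :
    ∀ᶠ n : ℕ in atTop, A * Real.log n ^ 3 ≤ n * h n ^ 8 := by
  filter_upwards [hh.2.2.1.eventually_ge_atTop A, eventually_one_le_log] with n h1 h2
  rwa [le_div_iff₀ (by positivity)] at h1

theorem BandwidthRates.eventually_mul_pow_le (hh : BandwidthRates h) :
    ∃ β > 0, ∀ᶠ n : ℕ in atTop, n * h n ^ 9 ≤ β := by
  obtain ⟨β, hβ, ht⟩ := hh.2.2.2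
  exact ⟨β + 1, by linarith, ht.eventually_le_const (by linarith)⟩

/-- A multiple of `log n` is eventually at most `n h ^ k` for `k ≤ 8`. -/
theorem BandwidthRates.eventually_log_le_pow (hh : BandwidthRates h) (A : ℝ) (hA : 0 ≤ A) {k : ℕ}
    (hk : k ≤ 8) : ∀ᶠ n : ℕ in atTop, A * Real.log n ≤ n * h n ^ k := by
  filter_upwards [hh.eventually_log_le A, eventually_one_le_log, hh.eventually_le_one]
    with n h1 h2 h3
  have h4 : Real.log n ≤ Real.log n ^ 3 := le_self_pow₀ h2 (by norm_num)
  have h5 : h n ^ 8 ≤ h n ^ k := pow_le_pow_of_le_one (hh.1 n).le h3 hk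
  calc A * Real.log n ≤ A * Real.log n ^ 3 := by gcongr
    _ ≤ n * h n ^ 8 := h1
    _ ≤ n * h n ^ k := by gcongr

/-- Negative powers of the bandwidth grow at most polynomially. -/
theorem BandwidthRates.eventually_inv_pow_le (hh : BandwidthRates h) (C : ℝ) {k : ℕ}
    (hk : k ≤ 8) : ∀ᶠ n : ℕ in atTop, C * (h n)⁻¹ ^ k ≤ (n : ℝ) ^ 2 := by
  filter_upwards [hh.eventually_log_le_pow 1 zero_le_one hk, eventually_one_le_log,
    tendsto_natCast_atTop_atTop.eventually_ge_atTop |C|] with n h1 h2 h3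
  have hpos := hh.1 n
  have h4 : (h n)⁻¹ ^ k ≤ n := by
    rw [inv_pow, inv_le_iff_one_le_mul₀ (by positivity)]
    linarith
  calc C * (h n)⁻¹ ^ k ≤ |C| * (h n)⁻¹ ^ k := by gcongr; exact le_abs_self C
    _ ≤ n * n := by gcongr
    _ = _ := by ring

/-- Sup bound to the power p, times the bound on the density, times the area of the supporting disc.
Only a local bound on the density is used. -/
theorem integral_abs_kernFn_pow_le (hK : KernelBound K B) {l : List (Fin 2)} (hl : l.length ≤ 4)
    {F : ℝ} (hf0 : ∀ x, 0 ≤ f x) {η : ℝ} (hη : 0 < η) {x : E2}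
    (hF : ∀ y, ‖x - y‖ ≤ η → f y ≤ F) {p : ℕ} (hp : p ≠ 0) :
    ∫ y, |kernFn K l η x y| ^ p * f y ≤
      (B * η⁻¹ ^ (2 + l.length)) ^ p * F * (η ^ 2 * volume.real (Metric.ball (0 : E2) 1)) := by
  have hB := hK.pos
  have hvol : volume.real (Metric.closedBall x η) =
      η ^ 2 * volume.real (Metric.ball (0 : E2) 1) := by
    rw [Measure.addHaar_real_closedBall volume x hη.le]; simp
  have hfin : volume (Metric.closedBall x η) ≠ ⊤ := measure_closedBall_lt_top.ne
  calc ∫ y, |kernFn K l η x y| ^ p * f y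
      ≤ ∫ y, (Metric.closedBall x η).indicator
          (fun _ => (B * η⁻¹ ^ (2 + l.length)) ^ p * F) y := by
        refine integral_mono_of_nonneg (ae_of_all _ fun y => mul_nonneg (by positivity) (hf0 y))
          ((integrable_indicator_iff Metric.isClosed_closedBall.measurableSet).mpr
            (integrableOn_const hfin)) (ae_of_all _ fun y => ?_)
        by_cases hy : y ∈ Metric.closedBall x η
        · simp only [Set.indicator_of_mem hy]
          have h1 := hF y (by rwa [← dist_eq_norm, dist_comm])
          have h2 := hK.abs_kernFn_le hl hη x y
          have := hf0 y
          gcongr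
        · simp only [Set.indicator_of_notMem hy]
          rw [hK.kernFn_eq_zero l hη]
          · simp [hp]
          · rwa [Metric.mem_closedBall, not_le, dist_comm, dist_eq_norm] at hy
    _ = _ := by
        rw [integral_indicator Metric.isClosed_closedBall.measurableSet, setIntegral_const, hvol,
          smul_eq_mul, mul_comm]

theorem exists_le_on_ball (hf : Continuous f) (R : ℝ) :
    ∃ F ≥ 1, ∀ y, ‖y‖ ≤ R → f y ≤ F := by
  obtain ⟨F, hF⟩ := (isCompact_closedBall (0 : E2) R).exists_bound_of_continuousOn hf.continuousOn
  exact ⟨max F 1, le_max_right _ _, fun y hy =>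
    ((le_abs_self _).trans (hF y (by simpa using hy))).trans (le_max_left _ _)⟩

theorem mixedDeriv_kde_eq (hK : KernelBound K B) (n : ℕ) (η : ℝ) (x : ℕ → E2) (l : List (Fin 2))
    (hl : l.length ≤ 4) (z : E2) : mixedDeriv l (kde K n η x) z =
      sampleDev f n x (kernFn K l η z) + ∫ y, kernFn K l η z y * f y := by
  rw [mixedDeriv_kde hK.diff n η x l hl, sampleDev, sub_add_cancel]
  rfl

/-- The second moment at a point is h^(-2(2+|l|)) · h², which gives the power h^(-2-2|l|) under the
root. -/
theorem whp_sampleDev_kernFn_le [IsProbabilityMeasure μ] (hX : IsSample μ X f) (hf : Continuous f)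
    (hfd : IsDensity f) (hK : KernelBound K B) (hh : BandwidthRates h) {l : List (Fin 2)}
    (hl : l.length ≤ 3) (R : ℝ) :
    ∃ M > 0, WithHighProb μ fun n ω => ∀ x : E2, ‖x‖ ≤ R →
      |sampleDev f n (fun i => X i ω) (kernFn K l (h n) x)| ≤
        M * √((h n)⁻¹ ^ (2 + 2 * l.length) * Real.log n / n) := by
  have hB := hK.pos
  obtain ⟨F, hF1, hF⟩ := exists_le_on_ball hf (R + 1)
  set ϖ := volume.real (Metric.ball (0 : E2) 1) with hϖ
  have hϖ0 : 0 ≤ ϖ := measureReal_nonneg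
  set Cv := B ^ 2 * F * ϖ + 1 with hCv
  have hCv1 : 1 ≤ Cv := by have : 0 ≤ B ^ 2 * F * ϖ := by positivity
                           linarith
  -- The real parameter of the general bound is idle here and is frozen at 0.
  obtain ⟨M, hM, hwhp⟩ := uniform_sampleDev_le (μ := μ) hX hf hfd
    (S := Metric.closedBall (0 : E2) R ×ˢ ({0} : Set ℝ))
    (Metric.isBounded_closedBall.prod Bornology.isBounded_singleton)
    (ψ := fun n p => kernFn K l (h n) p.1) (b := fun n => B * (h n)⁻¹ ^ (2 + l.length))
    (v := fun n => Cv * (h n)⁻¹ ^ (2 + 2 * l.length)) 2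
    (fun n p _ => (hK.continuous_kernFn_right hl (h n) p.1).measurable)
    (Eventually.of_forall fun n p _ y => hK.abs_kernFn_le (by omega) (hh.1 n) _ _)
    (by
      filter_upwards [hh.eventually_le_one] with n hn1 p hp
      have hpos := hh.1 n
      have hp1 : ‖p.1‖ ≤ R := by simpa using hp.1
      have := integral_abs_kernFn_pow_le hK (l := l) (by omega) hfd.1 hpos (x := p.1) (F := F)
        (fun y hy => hF y (by
          have : ‖y‖ ≤ ‖p.1‖ + ‖p.1 - y‖ := by
            simpa using norm_sub_le p.1 (p.1 - y)
          linarith)) (p := 2) two_ne_zero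
      simp_rw [sq_abs] at this
      refine this.trans ?_
      have e : (B * (h n)⁻¹ ^ (2 + l.length)) ^ 2 * F * ((h n) ^ 2 * ϖ) =
          B ^ 2 * F * ϖ * (h n)⁻¹ ^ (2 + 2 * l.length) := by
        rw [mul_pow, ← pow_mul, show (2 + l.length) * 2 = 2 + (2 + 2 * l.length) by ring, pow_add]
        field_simp
      rw [e]
      gcongr
      linarith)
    (by
      filter_upwards [hh.eventually_inv_pow_le (2 * B) (k := 3 + l.length) (by omega)]
        with n hn p _ q _ y
      refine (hK.abs_kernFn_sub_le hl (hh.1 n) p.1 q.1 y).trans ?_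
      have hd : ‖p.1 - q.1‖ ≤ dist p q := by
        rw [← dist_eq_norm, Prod.dist_eq]; exact le_max_left _ _
      gcongr)
    (by
      filter_upwards [hh.eventually_log_le_pow (4 * B ^ 2) (by positivity) (k := 2) (by norm_num)]
        with n hn
      have hpos := hh.1 n
      have e : 4 * (B * (h n)⁻¹ ^ (2 + l.length)) ^ 2 * Real.log n =
          (4 * B ^ 2 * Real.log n) * (h n)⁻¹ ^ 2 * (h n)⁻¹ ^ (2 + 2 * l.length) := by
        rw [mul_pow, ← pow_mul, show (2 + l.length) * 2 = 2 + (2 + 2 * l.length) by ring, pow_add]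
        ring
      rw [e, ← mul_assoc]
      refine mul_le_mul_of_nonneg_right ?_ (by positivity)
      calc 4 * B ^ 2 * Real.log n * (h n)⁻¹ ^ 2 ≤ n * h n ^ 2 * (h n)⁻¹ ^ 2 := by gcongr
        _ = (n : ℝ) * 1 := by field_simp
        _ ≤ (n : ℝ) * Cv := by gcongr)
    (by
      filter_upwards [hh.eventually_le_one] with n hn1
      have : 1 ≤ (h n)⁻¹ ^ (2 + 2 * l.length) :=
        one_le_pow₀ ((one_le_inv₀ (hh.1 n)).mpr hn1)
      exact one_le_mul_of_one_le_of_one_le hCv1 this)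
  refine ⟨M * √Cv, by positivity, hwhp.mono (Eventually.of_forall fun n ω hω x hx => ?_)⟩
  have := hω (x, 0) ⟨by simpa using hx, rfl⟩
  refine this.trans (le_of_eq ?_)
  rw [mul_assoc M, ← Real.sqrt_mul (by linarith)]
  congr 2; ring

/-- Rate of uniform convergence of first and second derivatives of the density estimator. -/
def unifRate (h : ℕ → ℝ) (n : ℕ) : ℝ := √(Real.log n / (n * h n ^ 6)) + h n ^ 2

theorem whp_mixedDeriv_kde_sub_le [IsProbabilityMeasure μ] (hX : IsSample μ X f)
    (hF1 : SmoothDensity f) (hK1 : KernelRegular K) (hh : BandwidthRates h) (R : ℝ) :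
    ∃ M > 0, WithHighProb μ fun n ω => ∀ l : List (Fin 2), l.length ≤ 2 →
      ∀ x : E2, ‖x‖ ≤ R →
      |mixedDeriv l (kde K n (h n) fun i => X i ω) x - mixedDeriv l f x| ≤ M * unifRate h n := by
  obtain ⟨B, hK⟩ := hK1.exists_kernelBound
  have hfD := diffFour_of_contDiff hF1.2.1
  obtain ⟨Bf, hBf, hbf⟩ := exists_bound_mixedDeriv hfD hF1.2.2
  have hfc : Continuous f := hF1.2.1.continuous
  have hone : ∀ l : {l : List (Fin 2) // l.length ≤ 2}, ∃ M > 0, WithHighProb μ fun n ω =>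
      ∀ x : E2, ‖x‖ ≤ R → |mixedDeriv l.1 (kde K n (h n) fun i => X i ω) x - mixedDeriv l.1 f x| ≤
        M * unifRate h n := by
    rintro ⟨l, hl⟩
    obtain ⟨M, hM, hwhp⟩ := whp_sampleDev_kernFn_le hX hfc hF1.1 hK hh (l := l) (by omega) R
    refine ⟨M + 8 * Bf, by positivity, hwhp.mono ?_⟩
    filter_upwards [hh.eventually_le_one, eventually_one_le_log] with n hn1 hlog ω hω x hx
    have hpos := hh.1 n
    rw [mixedDeriv_kde_eq (f := f) hK n (h n) _ l (by omega) x,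
      integral_kernFn_mul_density hK hF1.2.1 (by omega) hpos]
    have h1 := hω x hx
    have h2 := abs_smoothing_sub_le hK hK1.1 hK1.2.1 (hfD l (by omega))
      (fun i => hfD (i :: l) (by simp; omega))
      (fun i j x => hbf (j :: i :: l) (by simp) (by simp; omega) x) (h := h n) x
    have h3 : √((h n)⁻¹ ^ (2 + 2 * l.length) * Real.log n / n) ≤
        √(Real.log n / (n * h n ^ 6)) := by
      refine Real.sqrt_le_sqrt ?_
      have e : Real.log n / (n * h n ^ 6) = (h n)⁻¹ ^ 6 * Real.log n / n := by
        field_simp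
      rw [e]
      have : (h n)⁻¹ ^ (2 + 2 * l.length) ≤ (h n)⁻¹ ^ 6 :=
        pow_le_pow_right₀ ((one_le_inv₀ hpos).mpr hn1) (by omega)
      gcongr
    rw [add_sub_assoc]
    refine (abs_add_le _ _).trans ?_
    have h4 : M * √((h n)⁻¹ ^ (2 + 2 * l.length) * Real.log n / n) ≤
        M * √(Real.log n / (n * h n ^ 6)) := by gcongr
    have h5 := Real.sqrt_nonneg (Real.log n / (n * h n ^ 6))
    rw [unifRate]
    nlinarith [sq_nonneg (h n)]
  choose M hM hwhp using hone
  have hfin : Finite {l : List (Fin 2) // l.length ≤ 2} :=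
    (List.finite_length_le (Fin 2) 2).to_subtype
  obtain ⟨M', hM'⟩ := (Set.finite_range M).bddAbove
  refine ⟨max M' 1, by positivity, (WithHighProb.forall_finite hwhp).mono
    (Eventually.of_forall fun n ω hω l hl x hx => (hω ⟨l, hl⟩ x hx).trans ?_)⟩
  have h1 : M ⟨l, hl⟩ ≤ max M' 1 := (hM' ⟨_, rfl⟩).trans (le_max_left _ _)
  have h2 : 0 ≤ unifRate h n := by rw [unifRate]; positivity
  gcongr

/-- Only boundedness is wanted, as a Lipschitz constant for the estimated field. The stochastic part
is of order √(log n / (n h⁸)), hence bounded, and the smoothed third derivatives of the density are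
averages of bounded functions. -/
theorem whp_third_mixedDeriv_kde_le [IsProbabilityMeasure μ] (hX : IsSample μ X f)
    (hF1 : SmoothDensity f) (hK1 : KernelRegular K) (hh : BandwidthRates h) (R : ℝ) :
    ∃ M > 0, WithHighProb μ fun n ω => ∀ l : List (Fin 2), l.length = 3 →
      ∀ x : E2, ‖x‖ ≤ R → |mixedDeriv l (kde K n (h n) fun i => X i ω) x| ≤ M := by
  obtain ⟨B, hK⟩ := hK1.exists_kernelBound
  have hfD := diffFour_of_contDiff hF1.2.1
  obtain ⟨Bf, hBf, hbf⟩ := exists_bound_mixedDeriv hfD hF1.2.2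
  have hone : ∀ l : {l : List (Fin 2) // l.length = 3}, ∃ M > 0, WithHighProb μ fun n ω =>
      ∀ x : E2, ‖x‖ ≤ R → |mixedDeriv l.1 (kde K n (h n) fun i => X i ω) x| ≤ M := by
    rintro ⟨l, hl⟩
    obtain ⟨M, hM, hwhp⟩ := whp_sampleDev_kernFn_le hX hF1.2.1.continuous hF1.1 hK hh (l := l)
      (by omega) R
    refine ⟨M + Bf, by positivity, hwhp.mono ?_⟩
    filter_upwards [hh.eventually_log_le_pow 1 zero_le_one (k := 8) le_rfl,
      eventually_ge_atTop 1] with n hn8 hn1 ω hω x hx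
    have hpos := hh.1 n
    have hn0 : (0 : ℝ) < n := by exact_mod_cast hn1
    rw [mixedDeriv_kde_eq (f := f) hK n (h n) _ l (by omega) x,
      integral_kernFn_mul_density hK hF1.2.1 (by omega) hpos]
    have h1 := hω x hx
    have h2 := abs_integral_kernel_mul_le hK1.1 (F := fun u => mixedDeriv l f (x - h n • u))
      (C := Bf) (fun u _ => hbf l (by omega) (by omega) _)
    have h3 : √((h n)⁻¹ ^ (2 + 2 * l.length) * Real.log n / n) ≤ 1 := by
      rw [Real.sqrt_le_one, hl, show 2 + 2 * 3 = 8 from rfl, div_le_one hn0, inv_pow,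
        inv_mul_le_iff₀ (by positivity)]
      linarith
    refine (abs_add_le _ _).trans ?_
    nlinarith
  choose M hM hwhp using hone
  have hfin : Finite {l : List (Fin 2) // l.length = 3} :=
    (List.finite_length_eq (Fin 2) 3).to_subtype
  obtain ⟨M', hM'⟩ := (Set.finite_range M).bddAbove
  exact ⟨max M' 1, by positivity, (WithHighProb.forall_finite hwhp).mono
    (Eventually.of_forall fun n ω hω l hl x hx => (hω ⟨l, hl⟩ x hx).trans
      ((hM' ⟨_, rfl⟩).trans (le_max_left _ _)))⟩

end

/-! ### Kernels integrated along arcs -/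

section

/-- The contribution of an observation at `y` to the weighted integral of a derivative of the
density estimator along the arc `c` between the times `0` and `τ`. -/
def arcKern (K : E2 → ℝ) (l : List (Fin 2)) (η : ℝ) (w : E2 → ℝ) (c : ℝ → E2) (τ : ℝ)
    (y : E2) : ℝ :=
  ∫ s in (0 : ℝ)..τ, w (c s) * kernFn K l η (c s) y

section Arc

variable {K f : E2 → ℝ} {B η : ℝ} {l : List (Fin 2)} {w : E2 → ℝ} {c c' : ℝ → E2} {a τ τ' : ℝ}

/-- The weight is taken merely measurable, since `gapCos` and `gapSin` may be discontinuous where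
the gap vanishes. -/
theorem measurable_arc_uncurry (hK : KernelBound K B) (hl : l.length ≤ 3) (hw : Measurable w)
    (hc : Continuous c) (η : ℝ) :
    Measurable fun p : ℝ × E2 => w (c p.1) * kernFn K l η (c p.1) p.2 :=
  ((hw.comp hc.measurable).comp measurable_fst).mul ((hK.continuous_kernFn hl η).comp
    (by fun_prop : Continuous fun p : ℝ × E2 => (c p.1, p.2))).measurable

theorem measurable_arc (hK : KernelBound K B) (hl : l.length ≤ 3) (hw : Measurable w)
    (hc : Continuous c) (η : ℝ) (y : E2) : Measurable fun s => w (c s) * kernFn K l η (c s) y :=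
  (measurable_arc_uncurry hK hl hw hc η).comp (by fun_prop : Measurable fun s : ℝ => (s, y))

theorem abs_arc_le (hK : KernelBound K B) (hl : l.length ≤ 3) (hw1 : ∀ x, |w x| ≤ 1) (hη : 0 < η)
    (x y : E2) : |w x * kernFn K l η x y| ≤ B * η⁻¹ ^ (2 + l.length) := by
  rw [abs_mul]
  have h1 := hK.abs_kernFn_le (l := l) (by omega) hη x y
  calc _ ≤ 1 * (B * η⁻¹ ^ (2 + l.length)) := by gcongr; exact hw1 x
    _ = _ := one_mul _

theorem intervalIntegrable_arc (hK : KernelBound K B) (hl : l.length ≤ 3) (hw : Measurable w)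
    (hw1 : ∀ x, |w x| ≤ 1) (hc : Continuous c) (hη : 0 < η) (y : E2) (s t : ℝ) :
    IntervalIntegrable (fun s => w (c s) * kernFn K l η (c s) y) volume s t :=
  intervalIntegrable_of_bounded (measurable_arc hK hl hw hc η y)
    fun _ => abs_arc_le hK hl hw1 hη _ _

theorem continuous_arcKern (hK : KernelBound K B) (hl : l.length ≤ 3) (hw : Measurable w)
    (hw1 : ∀ x, |w x| ≤ 1) (hc : Continuous c) (hη : 0 < η) (τ : ℝ) :
    Continuous (arcKern K l η w c τ) := by
  refine intervalIntegral.continuous_of_dominated_interval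
    (bound := fun _ => B * η⁻¹ ^ (2 + l.length))
    (fun y => (measurable_arc hK hl hw hc η y).aestronglyMeasurable)
    (fun y => ae_of_all _ fun s _ => abs_arc_le hK hl hw1 hη _ _)
    intervalIntegrable_const (ae_of_all _ fun s _ => ?_)
  exact continuous_const.mul (hK.continuous_kernFn_right hl η (c s))

theorem uIoc_zero_subset (hτ : |τ| ≤ a) : Set.uIoc 0 τ ⊆ Set.Icc (-a) a := by
  intro s hs
  have h1 := abs_le.mp hτ
  rcases Set.mem_uIoc.mp hs with h | h <;> constructor <;> linarith [h.1, h.2]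

/-- The kernel sees the arc only while it is within η of `y`. Two such times give points at most 2η
apart, so by `hsep` they differ by at most 2η/γ: the set of these times has length O(η), which gains
a factor η over the pointwise bound. -/
theorem abs_arcKern_le (hK : KernelBound K B) (hl : l.length ≤ 3)
    (hw1 : ∀ x, |w x| ≤ 1) (hc : Continuous c) (hη : 0 < η) {γ : ℝ} (hγ : 0 < γ)
    (hsep : ∀ s ∈ Set.Icc (-a) a, ∀ u ∈ Set.Icc (-a) a, γ * |u - s| ≤ ‖c u - c s‖)
    (hτ : |τ| ≤ a) (y : E2) :
    |arcKern K l η w c τ y| ≤ B * η⁻¹ ^ (2 + l.length) * (2 * η / γ) := by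
  have hB := hK.pos
  set A : Set ℝ := Set.uIoc 0 τ ∩ {s | ‖c s - y‖ ≤ η} with hA
  have hAm : MeasurableSet A := measurableSet_uIoc.inter
    (isClosed_le (by fun_prop : Continuous fun s => ‖c s - y‖) continuous_const).measurableSet
  have hvol : volume A ≤ ENNReal.ofReal (2 * η / γ) := by
    refine (Real.volume_le_diam A).trans (Metric.ediam_le fun s hs u hu => ?_)
    rw [edist_dist]
    refine ENNReal.ofReal_le_ofReal ?_
    rw [Real.dist_eq, le_div_iff₀ hγ, mul_comm]
    refine (hsep u (uIoc_zero_subset hτ hu.1) s (uIoc_zero_subset hτ hs.1)).trans ?_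
    have e : c s - c u = (c s - y) - (c u - y) := by abel
    rw [e]
    have h1 : ‖c s - y‖ ≤ η := hs.2
    have h2 : ‖c u - y‖ ≤ η := hu.2
    exact (norm_sub_le _ _).trans (by linarith)
  rw [arcKern, ← Real.norm_eq_abs, intervalIntegral.norm_integral_eq_norm_integral_uIoc,
    setIntegral_eq_of_subset_of_forall_sdiff_eq_zero (s := A) (t := Set.uIoc 0 τ)
      measurableSet_uIoc Set.inter_subset_left (fun s hs => by
        rw [hK.kernFn_eq_zero l hη, mul_zero]
        by_contra hcon
        exact hs.2 ⟨hs.1, not_lt.mp hcon⟩)]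
  refine (norm_setIntegral_le_of_norm_le_const (hvol.trans_lt ENNReal.ofReal_lt_top)
    fun s _ => abs_arc_le hK hl hw1 hη (c s) y).trans ?_
  gcongr
  rw [measureReal_def]
  exact ENNReal.toReal_le_of_le_ofReal (by positivity) hvol

theorem integrable_arc_mul (hK : KernelBound K B) (hl : l.length ≤ 3) (hw : Measurable w)
    (hw1 : ∀ x, |w x| ≤ 1) (hc : Continuous c) (hη : 0 < η)
    (hfd : IsDensity f) (s t : ℝ) :
    Integrable (Function.uncurry fun (r : ℝ) (y : E2) => w (c r) * kernFn K l η (c r) y * f y)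
      ((volume.restrict (Set.uIoc s t)).prod volume) := by
  have hfin : IsFiniteMeasure ((volume : Measure ℝ).restrict (Set.uIoc s t)) := by
    rw [Set.uIoc]; infer_instance
  have : Integrable (fun p : ℝ × E2 => f p.2) ((volume.restrict (Set.uIoc s t)).prod volume) :=
    hfd.2.1.comp_snd _
  refine this.bdd_mul (c := B * η⁻¹ ^ (2 + l.length))
    (measurable_arc_uncurry hK hl hw hc η).aestronglyMeasurable (ae_of_all _ fun p => ?_)
  exact abs_arc_le hK hl hw1 hη _ _

theorem integral_arcKern_mul (hK : KernelBound K B) (hl : l.length ≤ 3) (hw : Measurable w)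
    (hw1 : ∀ x, |w x| ≤ 1) (hc : Continuous c) (hη : 0 < η)
    (hfd : IsDensity f) (τ : ℝ) : ∫ y, arcKern K l η w c τ y * f y =
      ∫ s in (0 : ℝ)..τ, w (c s) * ∫ y, kernFn K l η (c s) y * f y := by
  have := intervalIntegral_integral_swap (integrable_arc_mul hK hl hw hw1 hc hη hfd 0 τ)
  simp_rw [arcKern, ← intervalIntegral.integral_mul_const]
  rw [← this]
  congr 1; ext s
  simp_rw [mul_assoc]
  rw [integral_const_mul]

/-- Fubini: for each time the kernel lives on a disc of area O(η²). Separation of the arc plays no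
role here. -/
theorem integral_abs_arcKern_mul_le (hK : KernelBound K B) (hl : l.length ≤ 3) (hw : Measurable w)
    (hw1 : ∀ x, |w x| ≤ 1) (hc : Continuous c) (hη : 0 < η) (hf : Continuous f)
    (hfd : IsDensity f) {F : ℝ} (hF : ∀ s ∈ Set.Icc (-a) a, ∀ y, ‖c s - y‖ ≤ η → f y ≤ F)
    (hτ : |τ| ≤ a) : ∫ y, |arcKern K l η w c τ y| * f y ≤
      B * η⁻¹ ^ (2 + l.length) * F * (η ^ 2 * volume.real (Metric.ball (0 : E2) 1)) * a := by
  have hint := (integrable_arc_mul hK hl hw hw1 hc hη hfd 0 τ).norm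
  have hB := hK.pos
  have hpt : ∀ y, |arcKern K l η w c τ y| * f y ≤
      ∫ s in Set.uIoc 0 τ, ‖w (c s) * kernFn K l η (c s) y * f y‖ := by
    intro y
    have e : arcKern K l η w c τ y * f y =
        ∫ s in (0 : ℝ)..τ, w (c s) * kernFn K l η (c s) y * f y := by
      rw [arcKern, intervalIntegral.integral_mul_const]
    rw [← abs_of_nonneg (hfd.1 y), ← abs_mul, abs_of_nonneg (hfd.1 y), e, ← Real.norm_eq_abs]
    exact intervalIntegral.norm_integral_le_integral_norm_uIoc
  have hinner : ∀ s ∈ Set.uIoc 0 τ, ∫ y, ‖w (c s) * kernFn K l η (c s) y * f y‖ ≤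
      B * η⁻¹ ^ (2 + l.length) * F * (η ^ 2 * volume.real (Metric.ball (0 : E2) 1)) := by
    intro s hs
    have h1 := integral_abs_kernFn_pow_le hK (l := l) (by omega) hfd.1 hη
      (hF s (uIoc_zero_subset hτ hs)) (p := 1) one_ne_zero
    simp only [pow_one] at h1
    refine le_trans ?_ h1
    refine integral_mono_of_nonneg (ae_of_all _ fun y => norm_nonneg _) ?_
      (ae_of_all _ fun y => ?_)
    · exact (hK.integrable_kernFn_mul hl hη (c s) hf).abs.congr (ae_of_all _ fun y => by
        simp only [abs_mul, abs_of_nonneg (hfd.1 y)])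
    · simp only [norm_mul, Real.norm_eq_abs, abs_of_nonneg (hfd.1 y)]
      have h2 := hw1 (c s)
      have h3 := hfd.1 y
      have h4 : |w (c s)| * |kernFn K l η (c s) y| ≤ 1 * |kernFn K l η (c s) y| := by gcongr
      rw [one_mul] at h4
      gcongr
  have hF0 : 0 ≤ F := (hfd.1 (c 0)).trans (hF 0 ⟨by linarith [abs_nonneg τ], by
    linarith [abs_nonneg τ]⟩ (c 0) (by simpa using hη.le))
  calc ∫ y, |arcKern K l η w c τ y| * f y
      ≤ ∫ y, ∫ s in Set.uIoc 0 τ, ‖w (c s) * kernFn K l η (c s) y * f y‖ :=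
        integral_mono_of_nonneg (ae_of_all _ fun y => mul_nonneg (abs_nonneg _) (hfd.1 y))
          hint.integral_prod_right (ae_of_all _ hpt)
    _ = ∫ s in Set.uIoc 0 τ, ∫ y, ‖w (c s) * kernFn K l η (c s) y * f y‖ :=
        (integral_integral_swap hint).symm
    _ ≤ ∫ _s in Set.uIoc 0 τ,
          B * η⁻¹ ^ (2 + l.length) * F * (η ^ 2 * volume.real (Metric.ball (0 : E2) 1)) :=
        setIntegral_mono_on hint.integral_prod_left (integrableOn_const (by simp))
          measurableSet_uIoc hinner
    _ ≤ _ := by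
        rw [setIntegral_const, smul_eq_mul, mul_comm]
        have : volume.real (Set.uIoc 0 τ) = |τ| := by simp [measureReal_def]
        rw [this]
        gcongr

/-- Sup norm times L¹ norm. For second derivatives this is η⁻³ · η⁻² = η⁻⁵, and this exponent
determines the final rate. -/
theorem integral_sq_arcKern_mul_le (hK : KernelBound K B) (hl : l.length ≤ 3) (hw : Measurable w)
    (hw1 : ∀ x, |w x| ≤ 1) (hc : Continuous c) (hη : 0 < η) (hf : Continuous f)
    (hfd : IsDensity f) {F : ℝ} (hF : ∀ s ∈ Set.Icc (-a) a, ∀ y, ‖c s - y‖ ≤ η → f y ≤ F)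
    {γ : ℝ} (hγ : 0 < γ)
    (hsep : ∀ s ∈ Set.Icc (-a) a, ∀ u ∈ Set.Icc (-a) a, γ * |u - s| ≤ ‖c u - c s‖)
    (hτ : |τ| ≤ a) : ∫ y, arcKern K l η w c τ y ^ 2 * f y ≤
      B * η⁻¹ ^ (2 + l.length) * (2 * η / γ) *
      (B * η⁻¹ ^ (2 + l.length) * F * (η ^ 2 * volume.real (Metric.ball (0 : E2) 1)) * a) := by
  have hB := hK.pos
  have hbd := abs_arcKern_le hK hl hw1 hc hη hγ hsep hτ
  have hmeas := (continuous_arcKern hK hl hw hw1 hc hη τ).measurable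
  have hi : Integrable fun y => |arcKern K l η w c τ y| * f y :=
    hfd.2.1.bdd_mul (c := B * η⁻¹ ^ (2 + l.length) * (2 * η / γ))
      (hmeas.abs).aestronglyMeasurable (ae_of_all _ fun y => by
        rw [Real.norm_eq_abs, abs_abs]; exact hbd y)
  calc ∫ y, arcKern K l η w c τ y ^ 2 * f y
      ≤ ∫ y, B * η⁻¹ ^ (2 + l.length) * (2 * η / γ) * (|arcKern K l η w c τ y| * f y) := by
        refine integral_mono_of_nonneg
          (ae_of_all _ fun y => mul_nonneg (sq_nonneg _) (hfd.1 y)) (hi.const_mul _)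
          (ae_of_all _ fun y => ?_)
        have := hbd y
        have h0 := hfd.1 y
        simp only
        rw [← mul_assoc, ← sq_abs, sq]
        gcongr
    _ = B * η⁻¹ ^ (2 + l.length) * (2 * η / γ) * ∫ y, |arcKern K l η w c τ y| * f y :=
        integral_const_mul _ _
    _ ≤ _ := by
        gcongr
        exact integral_abs_arcKern_mul_le hK hl hw hw1 hc hη hf hfd hF hτ

theorem abs_arcKern_sub_le (hK : KernelBound K B) (hl : l.length ≤ 3) (hw : Measurable w)
    (hw1 : ∀ x, |w x| ≤ 1) (hc : Continuous c) (hc' : Continuous c') (hη : 0 < η) (hη1 : η ≤ 1)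
    {W D : ℝ} (hW0 : 0 ≤ W) (hD : 0 ≤ D)
    (hW : ∀ s ∈ Set.Icc (-a) a, |w (c s) - w (c' s)| ≤ W * D)
    (hcc : ∀ s ∈ Set.Icc (-a) a, ‖c s - c' s‖ ≤ D) (hτ' : |τ'| ≤ a) (y : E2) :
    |arcKern K l η w c τ y - arcKern K l η w c' τ' y| ≤
      B * η⁻¹ ^ (3 + l.length) * (|τ - τ'| + (W + 2) * D * a) := by
  have hB := hK.pos
  have hη' : 1 ≤ η⁻¹ := (one_le_inv₀ hη).mpr hη1
  have hpow : η⁻¹ ^ (2 + l.length) ≤ η⁻¹ ^ (3 + l.length) := pow_le_pow_right₀ hη' (by omega)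
  have hi := fun s t => intervalIntegrable_arc hK hl hw hw1 hc hη y s t
  have hi' := fun s t => intervalIntegrable_arc hK hl hw hw1 hc' hη y s t
  have e : arcKern K l η w c τ y - arcKern K l η w c' τ' y =
      (∫ s in τ'..τ, w (c s) * kernFn K l η (c s) y) +
      ∫ s in (0 : ℝ)..τ', (w (c s) * kernFn K l η (c s) y - w (c' s) * kernFn K l η (c' s) y) := by
    rw [intervalIntegral.integral_sub (hi 0 τ') (hi' 0 τ'),
      ← intervalIntegral.integral_add_adjacent_intervals (hi τ' 0) (hi 0 τ),
      intervalIntegral.integral_symm 0 τ', arcKern, arcKern]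
    ring
  have h1 : |∫ s in τ'..τ, w (c s) * kernFn K l η (c s) y| ≤
      B * η⁻¹ ^ (2 + l.length) * |τ - τ'| :=
    intervalIntegral.norm_integral_le_of_norm_le_const
      (f := fun s => w (c s) * kernFn K l η (c s) y) fun s _ => abs_arc_le hK hl hw1 hη _ _
  have hpt : ∀ s ∈ Set.uIoc 0 τ',
      |w (c s) * kernFn K l η (c s) y - w (c' s) * kernFn K l η (c' s) y| ≤
        B * η⁻¹ ^ (3 + l.length) * ((W + 2) * D) := by
    intro s hs
    have hs' := uIoc_zero_subset hτ' hs
    have e2 : w (c s) * kernFn K l η (c s) y - w (c' s) * kernFn K l η (c' s) y =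
        (w (c s) - w (c' s)) * kernFn K l η (c s) y +
        w (c' s) * (kernFn K l η (c s) y - kernFn K l η (c' s) y) := by ring
    rw [e2]
    refine (abs_add_le _ _).trans ?_
    rw [abs_mul, abs_mul]
    have h3 := hK.abs_kernFn_le (l := l) (by omega) hη (c s) y
    have h4 := hK.abs_kernFn_sub_le hl hη (c s) (c' s) y
    have h5 := hcc s hs'
    calc _ ≤ W * D * (B * η⁻¹ ^ (2 + l.length)) + 1 * (2 * B * η⁻¹ ^ (3 + l.length) * D) := by
          gcongr
          · exact hW s hs'
          · exact hw1 _
          · exact h4.trans (by gcongr)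
      _ ≤ W * D * (B * η⁻¹ ^ (3 + l.length)) + 1 * (2 * B * η⁻¹ ^ (3 + l.length) * D) := by
          gcongr
      _ = _ := by ring
  have h2 : |∫ s in (0 : ℝ)..τ',
      (w (c s) * kernFn K l η (c s) y - w (c' s) * kernFn K l η (c' s) y)| ≤
      B * η⁻¹ ^ (3 + l.length) * ((W + 2) * D) * |τ' - 0| :=
    intervalIntegral.norm_integral_le_of_norm_le_const
      (f := fun s => w (c s) * kernFn K l η (c s) y - w (c' s) * kernFn K l η (c' s) y) hpt
  rw [e]
  refine (abs_add_le _ _).trans ((add_le_add h1 h2).trans ?_)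
  rw [sub_zero]
  calc _ ≤ B * η⁻¹ ^ (3 + l.length) * |τ - τ'| +
        B * η⁻¹ ^ (3 + l.length) * ((W + 2) * D) * a := by gcongr
    _ = _ := by ring

/-- Integration along the arc commutes with the sample mean and, by Fubini, with the expectation;
the deviation is thus the integral of the estimator's derivative minus that of its mean. -/
theorem sampleDev_arcKern (hK : KernelBound K B) (hl : l.length ≤ 3) (hw : Measurable w)
    (hw1 : ∀ x, |w x| ≤ 1) (hc : Continuous c) (hη : 0 < η) (hf : ContDiff ℝ 4 f)
    (hfd : IsDensity f) (n : ℕ) (x : ℕ → E2) (τ : ℝ) :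
    sampleDev f n x (arcKern K l η w c τ) =
      (∫ s in (0 : ℝ)..τ, w (c s) * mixedDeriv l (kde K n η x) (c s)) -
      ∫ s in (0 : ℝ)..τ, w (c s) * ∫ u, K u * mixedDeriv l f (c s - η • u) := by
  rw [sampleDev, integral_arcKern_mul hK hl hw hw1 hc hη hfd]
  simp_rw [integral_kernFn_mul_density hK hf hl hη]
  congr 1
  simp_rw [arcKern]
  rw [← intervalIntegral.integral_finsetSum
    (fun i _ => intervalIntegrable_arc hK hl hw hw1 hc hη (x i) 0 τ),
    ← intervalIntegral.integral_const_mul]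
  congr 1; ext s
  rw [mixedDeriv_kde hK.diff n η x l (by omega), ← Finset.mul_sum]
  simp only [kernFn]
  ring

end Arc

end

/-! ### Rates for integrals along integral curves -/

section

/-! ### Uniform geometric constants along the arcs. -/

section Geometry

variable {f : E2 → ℝ} {H L : Set E2} {a B : ℝ}

theorem curve_mem_startSet {z : E2} (hz : z ∈ L) {s : ℝ} (hs : s ∈ Set.Icc (-a) a) :
    curve f z s ∈ startSet f L a := ⟨z, hz, s, hs.1, hs.2, rfl⟩

theorem exists_le_eigGap (hf : FlowRegular f B) (hF2 : RegularRegion f H)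
    (hF3 : CompactFilament f H L a) :
    ∃ σ > 0, ∀ x ∈ startSet f L a, σ ≤ eigGap (d2 f x) :=
  (isCompact_startSet hf hF3.2.1).exists_forall_le'
    (continuous_eigGap.comp hf.diff.continuous_d2).continuousOn
    fun _ hx => hF2.eigGap_pos (hF3.2.2.2.1 hx)

theorem exists_norm_startSet_le (hf : FlowRegular f B) (hL : IsCompact L) (a : ℝ) :
    ∃ R, ∀ x ∈ startSet f L a, ‖x‖ ≤ R :=
  (isCompact_startSet hf hL).isBounded.exists_norm_le

/-- The integral of the velocity is the displacement, so the mean velocity bound says that an arc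
never comes back close to itself. -/
theorem MeanVelocityBound.exists_separation (hF4 : MeanVelocityBound f L a)
    (hf : FlowRegular f B) : ∃ γ > 0, ∀ z ∈ L, ∀ s ∈ Set.Icc (-a) a, ∀ u ∈ Set.Icc (-a) a,
      γ * |u - s| ≤ ‖curve f z u - curve f z s‖ := by
  obtain ⟨γ, hγ, h⟩ := hF4
  have key : ∀ z ∈ L, ∀ s ∈ Set.Icc (-a) a, ∀ u ∈ Set.Icc (-a) a, s < u →
      γ * |u - s| ≤ ‖curve f z u - curve f z s‖ := by
    intro z hz s hs u hu hsu
    have h1 := h z hz s u hs.1 hsu hu.2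
    rw [intervalIntegral.integral_eq_sub_of_hasDerivAt (fun r _ => hf.hasDerivAt_curve z r)
      ((hf.diff.continuous_eigField.comp (hf.continuous_curve z)).intervalIntegrable _ _),
      norm_smul, Real.norm_eq_abs, abs_of_pos (by simpa using hsu), one_div,
      le_inv_mul_iff₀ (by linarith)] at h1
    rw [abs_of_pos (by linarith)]
    linarith
  refine ⟨γ, hγ, fun z hz s hs u hu => ?_⟩
  rcases lt_trichotomy s u with hsu | rfl | hsu
  · exact key z hz s hs u hu hsu
  · simp
  · rw [abs_sub_comm, norm_sub_rev]
    exact key z hz u hu s hs hsu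

theorem abs_eigWeight_d2_sub_le (hf : FlowRegular f B) {σ : ℝ} (hσ : 0 < σ) {x y : E2}
    (hx : σ ≤ eigGap (d2 f x)) (hy : σ ≤ eigGap (d2 f y)) (k : Fin 3) :
    |eigWeight k (d2 f x) - eigWeight k (d2 f y)| ≤ 16 * B / σ * ‖x - y‖ := by
  refine (abs_eigWeight_sub_le k hσ hx hy (abs_d2_sub_le hf.diff convex_univ
    (fun l hl x _ => hf.bound l (by omega) (by omega) x) (Set.mem_univ x)
    (Set.mem_univ y))).trans (le_of_eq ?_)
  ring

end Geometry

variable {Ω : Type*} [MeasurableSpace Ω] {μ : Measure Ω} {X : ℕ → Ω → E2} {f K : E2 → ℝ}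
  {h : ℕ → ℝ} {B BK : ℝ} {H L : Set E2} {a : ℝ}

/-- Rate of convergence of weighted integrals of second derivatives of the density estimator along
integral curves. -/
def arcRate (h : ℕ → ℝ) (n : ℕ) : ℝ := √(Real.log n / (n * h n ^ 5))

theorem arcRate_nonneg (h : ℕ → ℝ) (n : ℕ) : 0 ≤ arcRate h n := Real.sqrt_nonneg _

/-- Squaring reduces the claim to n h⁹ ≤ β log n; this is where boundedness of n h⁹ lets the bias be
absorbed. -/
theorem BandwidthRates.exists_sq_le_arcRate (hh : BandwidthRates h) :
    ∃ C > 0, ∀ᶠ n in atTop, h n ^ 2 ≤ C * arcRate h n := by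
  obtain ⟨β, hβ, hev⟩ := hh.eventually_mul_pow_le
  refine ⟨√β, Real.sqrt_pos.mpr hβ, ?_⟩
  filter_upwards [hev, eventually_one_le_log, eventually_ge_atTop 1] with n h1 h2 h3
  have hpos := hh.1 n
  have hn : (0 : ℝ) < n := by exact_mod_cast h3
  rw [arcRate, ← Real.sqrt_mul hβ.le]
  refine Real.le_sqrt_of_sq_le ?_
  rw [← mul_div_assoc, le_div_iff₀ (by positivity)]
  calc (h n ^ 2) ^ 2 * (n * h n ^ 5) = n * h n ^ 9 := by ring
    _ ≤ β * 1 := by linarith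
    _ ≤ β * Real.log n := by gcongr

theorem whp_sampleDev_arcKern_le [IsProbabilityMeasure μ] (hX : IsSample μ X f)
    (hfd : IsDensity f) (hf : FlowRegular f B) (hF2 : RegularRegion f H)
    (hF3 : CompactFilament f H L a) (hF4 : MeanVelocityBound f L a) (hK : KernelBound K BK)
    (hh : BandwidthRates h) {l : List (Fin 2)} (hl : l.length = 2) (k : Fin 3) :
    ∃ M > 0, WithHighProb μ fun n ω => ∀ z ∈ L, ∀ τ, |τ| ≤ a →
      |sampleDev f n (fun i => X i ω)
        (arcKern K l (h n) (fun x => eigWeight k (d2 f x)) (curve f z) τ)| ≤ M * arcRate h n := by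
  have hBK := hK.pos
  have hB := hf.pos
  have ha := hF3.1
  have hfc : Continuous f := (hf.diff [] (by simp)).continuous
  have hl3 : l.length ≤ 3 := by omega
  obtain ⟨σ, hσ, hgap⟩ := exists_le_eigGap hf hF2 hF3
  obtain ⟨R, hR⟩ := exists_norm_startSet_le hf hF3.2.1 a
  obtain ⟨γ, hγ, hsep⟩ := hF4.exists_separation hf
  obtain ⟨F, hF1, hF⟩ := exists_le_on_ball hfc (R + 1)
  set w : E2 → ℝ := fun x => eigWeight k (d2 f x) with hw
  have hwm : Measurable w := (measurable_eigWeight k).comp hf.diff.continuous_d2.measurable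
  have hw1 : ∀ x, |w x| ≤ 1 := fun x => abs_eigWeight_le k _
  set ϖ := volume.real (Metric.ball (0 : E2) 1) with hϖ
  have hϖ0 : 0 ≤ ϖ := measureReal_nonneg
  set Cv := 2 * BK ^ 2 * F * ϖ * a / γ + 1 with hCv
  have hCv1 : 1 ≤ Cv := by
    have : 0 ≤ 2 * BK ^ 2 * F * ϖ * a / γ := by positivity
    linarith
  set E := Real.exp (48 * B * a) with hE
  have hE0 : 0 < E := Real.exp_pos _
  -- The parameters are the filament point and the end time of the arc. The Lipschitz constant is
  -- O(h⁻⁵) ≤ n², and the squared sup bound O(h⁻⁶) is compatible with second moment h⁻⁵ because log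
  -- n = o(n h).
  obtain ⟨M, hM, hwhp⟩ := uniform_sampleDev_le (μ := μ) hX hfc hfd
    (S := L ×ˢ Set.Icc (-a) a)
    (hF3.2.1.isBounded.prod (Metric.isBounded_Icc _ _))
    (ψ := fun n p => arcKern K l (h n) w (curve f p.1) p.2)
    (b := fun n => BK * (h n)⁻¹ ^ 4 * (2 * h n / γ))
    (v := fun n => Cv * (h n)⁻¹ ^ 5) 2
    (fun n p _ => (continuous_arcKern hK hl3 hwm hw1 (hf.continuous_curve _) (hh.1 n) _).measurable)
    (Eventually.of_forall fun n p hp y => by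
      have := abs_arcKern_le hK hl3 hw1 (hf.continuous_curve p.1) (hh.1 n) hγ (hsep p.1 hp.1)
        (abs_le.mpr hp.2) y
      rwa [hl] at this)
    (by
      filter_upwards [hh.eventually_le_one] with n hn1 p hp
      have hpos := hh.1 n
      have := integral_sq_arcKern_mul_le hK hl3 hwm hw1 (hf.continuous_curve p.1) hpos hfc hfd
        (F := F) (fun s hs y hy => hF y (by
          have h1 := hR _ (curve_mem_startSet hp.1 hs)
          have h2 : ‖y‖ ≤ ‖curve f p.1 s‖ + ‖curve f p.1 s - y‖ := by
            simpa using norm_sub_le (curve f p.1 s) (curve f p.1 s - y)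
          linarith)) hγ (hsep p.1 hp.1) (abs_le.mpr hp.2)
      refine this.trans ?_
      rw [hl]
      have e : BK * (h n)⁻¹ ^ (2 + 2) * (2 * h n / γ) *
          (BK * (h n)⁻¹ ^ (2 + 2) * F * (h n ^ 2 * ϖ) * a) =
          2 * BK ^ 2 * F * ϖ * a / γ * (h n)⁻¹ ^ 5 := by
        norm_num only
        field_simp
      rw [e]
      gcongr
      linarith)
    (by
      filter_upwards [hh.eventually_inv_pow_le (BK * (1 + (16 * B / σ + 2) * E * a)) (k := 5)
        (by norm_num), hh.eventually_le_one] with n hn hn1 p hp q hq y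
      have hd1 : ‖p.1 - q.1‖ ≤ dist p q := by
        rw [← dist_eq_norm, Prod.dist_eq]; exact le_max_left _ _
      have hd2 : |p.2 - q.2| ≤ dist p q := by
        rw [← Real.dist_eq, Prod.dist_eq]; exact le_max_right _ _
      have hcc : ∀ s ∈ Set.Icc (-a) a, ‖curve f p.1 s - curve f q.1 s‖ ≤ ‖p.1 - q.1‖ * E := by
        intro s hs
        have hs' : |s| ≤ a := abs_le.mpr hs
        refine (hf.norm_curve_sub_le p.1 q.1 s).trans ?_
        rw [hE]
        gcongr
      have := abs_arcKern_sub_le hK hl3 hwm hw1 (hf.continuous_curve p.1)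
        (hf.continuous_curve q.1) (hh.1 n) hn1 (τ := p.2) (τ' := q.2)
        (W := 16 * B / σ) (D := ‖p.1 - q.1‖ * E) (by positivity) (by positivity)
        (fun s hs => (abs_eigWeight_d2_sub_le hf hσ (hgap _ (curve_mem_startSet hp.1 hs))
          (hgap _ (curve_mem_startSet hq.1 hs)) k).trans (by
            have := hcc s hs
            gcongr)) hcc (abs_le.mpr hq.2) y
      rw [hl] at this
      have hpos := hh.1 n
      refine this.trans ?_
      calc BK * (h n)⁻¹ ^ (3 + 2) * (|p.2 - q.2| + (16 * B / σ + 2) * (‖p.1 - q.1‖ * E) * a)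
          ≤ BK * (h n)⁻¹ ^ 5 * (dist p q + (16 * B / σ + 2) * (dist p q * E) * a) := by gcongr
        _ = BK * (1 + (16 * B / σ + 2) * E * a) * (h n)⁻¹ ^ 5 * dist p q := by ring
        _ ≤ _ := by gcongr)
    (by
      filter_upwards [hh.eventually_log_le_pow (16 * BK ^ 2 / γ ^ 2) (by positivity) (k := 1)
        (by norm_num)] with n hn
      have hpos := hh.1 n
      rw [pow_one] at hn
      have e : 4 * (BK * (h n)⁻¹ ^ 4 * (2 * h n / γ)) ^ 2 * Real.log n =
          16 * BK ^ 2 / γ ^ 2 * Real.log n * (h n)⁻¹ ^ 6 := by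
        field_simp
        norm_num only
        ring
      rw [e]
      calc 16 * BK ^ 2 / γ ^ 2 * Real.log n * (h n)⁻¹ ^ 6 ≤ n * h n * (h n)⁻¹ ^ 6 := by gcongr
        _ = n * (1 * (h n)⁻¹ ^ 5) := by field_simp
        _ ≤ n * (Cv * (h n)⁻¹ ^ 5) := by gcongr)
    (by
      filter_upwards [hh.eventually_le_one] with n hn1
      have : 1 ≤ (h n)⁻¹ ^ 5 := one_le_pow₀ ((one_le_inv₀ (hh.1 n)).mpr hn1)
      exact one_le_mul_of_one_le_of_one_le hCv1 this)
  refine ⟨M * √Cv, by positivity, hwhp.mono (Eventually.of_forall fun n ω hω z hz τ hτ => ?_)⟩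
  refine (hω (z, τ) ⟨hz, abs_le.mp hτ⟩).trans (le_of_eq ?_)
  have hpos := hh.1 n
  rw [mul_assoc M, arcRate, ← Real.sqrt_mul (by linarith)]
  congr 2
  field_simp

theorem measurable_smoothing (hK : Continuous K) {G : E2 → ℝ} (hG : Continuous G) (η : ℝ) :
    Measurable fun x => ∫ u, K u * G (x - η • u) := by
  have : Continuous fun p : E2 × E2 => K p.2 * G (p.1 - η • p.2) := by fun_prop
  exact (this.stronglyMeasurable.integral_prod_right').measurable

/-- Stochastic part plus bias, separated by the smoothed derivative `S`. Integrating along an arc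
does not improve the bias, which stays O(h²). -/
theorem whp_integral_arc_le [IsProbabilityMeasure μ] (hX : IsSample μ X f)
    (hF1 : SmoothDensity f) (hF2 : RegularRegion f H)
    (hF3 : CompactFilament f H L a) (hF4 : MeanVelocityBound f L a) (hK1 : KernelRegular K)
    (hh : BandwidthRates h) {l : List (Fin 2)} (hl : l.length = 2) (k : Fin 3) :
    ∃ M > 0, WithHighProb μ fun n ω => ∀ z ∈ L, ∀ τ, |τ| ≤ a →
      |∫ r in (0 : ℝ)..τ, eigWeight k (d2 f (curve f z r)) *
        (mixedDeriv l (kde K n (h n) fun i => X i ω) (curve f z r) -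
          mixedDeriv l f (curve f z r))| ≤ M * arcRate h n := by
  obtain ⟨BK, hK⟩ := hK1.exists_kernelBound
  obtain ⟨B, hf⟩ := hF1.exists_flowRegular
  obtain ⟨Bf, hBf, hbf⟩ := exists_bound_mixedDeriv hf.diff hF1.2.2
  obtain ⟨C, hC, hCev⟩ := hh.exists_sq_le_arcRate
  have ha := hF3.1
  obtain ⟨M, hM, hwhp⟩ := whp_sampleDev_arcKern_le hX hF1.1 hf hF2 hF3 hF4 hK hh hl k
  refine ⟨M + 8 * Bf * C * a, by positivity, hwhp.mono ?_⟩
  filter_upwards [hCev] with n hn ω hω z hz τ hτ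
  have hpos := hh.1 n
  set w : E2 → ℝ := fun x => eigWeight k (d2 f x) with hw
  have hwm : Measurable w := (measurable_eigWeight k).comp hf.diff.continuous_d2.measurable
  have hw1 : ∀ x, |w x| ≤ 1 := fun x => abs_eigWeight_le k _
  have hc := hf.continuous_curve z
  set g := kde K n (h n) fun i => X i ω with hg
  have hgc : Continuous (mixedDeriv l g) := (hK.diff.kde n (h n) _ l (by omega)).continuous
  have hfc : Continuous (mixedDeriv l f) := (hf.diff l (by omega)).continuous
  set S : E2 → ℝ := fun x => ∫ u, K u * mixedDeriv l f (x - h n • u) with hS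
  have hSm : Measurable S :=
    measurable_smoothing (hK.diff [] (by simp)).continuous hfc (h n)
  have hwc : Measurable fun r => w (curve f z r) := hwm.comp hc.measurable
  have hcont : ∀ {φ : E2 → ℝ}, Continuous φ → IntervalIntegrable
      (fun r => w (curve f z r) * φ (curve f z r)) volume 0 τ := by
    intro φ hφ
    rw [intervalIntegrable_iff]
    refine Integrable.bdd_mul (c := 1) ?_ hwc.aestronglyMeasurable
      (ae_of_all _ fun r => hw1 _)
    exact intervalIntegrable_iff.mp ((hφ.comp hc).intervalIntegrable _ _)
  have hSi : IntervalIntegrable (fun r => w (curve f z r) * S (curve f z r)) volume 0 τ := by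
    refine intervalIntegrable_of_bounded (C := 1 * Bf) (hwc.mul (hSm.comp hc.measurable))
      fun r => ?_
    change |w (curve f z r) * S (curve f z r)| ≤ _
    rw [abs_mul]
    gcongr
    · exact hw1 _
    · exact abs_integral_kernel_mul_le hK1.1 fun u _ => hbf l (by omega) (by omega) _
  have hdev := hω z hz τ hτ
  rw [sampleDev_arcKern hK (by omega) hwm hw1 hc hpos hF1.2.1 hF1.1,
    ← intervalIntegral.integral_sub (hcont hgc) hSi] at hdev
  have hbias : |∫ r in (0 : ℝ)..τ, (w (curve f z r) * S (curve f z r) -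
      w (curve f z r) * mixedDeriv l f (curve f z r))| ≤ 8 * Bf * h n ^ 2 * |τ - 0| := by
    refine intervalIntegral.norm_integral_le_of_norm_le_const (f := fun r =>
      w (curve f z r) * S (curve f z r) - w (curve f z r) * mixedDeriv l f (curve f z r))
      fun r _ => ?_
    rw [← mul_sub, Real.norm_eq_abs, abs_mul]
    have h2 := abs_smoothing_sub_le hK hK1.1 hK1.2.1 (hf.diff l (by omega))
      (fun i => hf.diff (i :: l) (by simp; omega))
      (fun i j x => hbf (j :: i :: l) (by simp) (by simp; omega) x) (h := h n) (curve f z r)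
    calc _ ≤ 1 * (8 * Bf * h n ^ 2) := by
          gcongr
          exact hw1 _
      _ = _ := one_mul _
  have e : ∫ r in (0 : ℝ)..τ, w (curve f z r) *
      (mixedDeriv l g (curve f z r) - mixedDeriv l f (curve f z r)) =
      (∫ r in (0 : ℝ)..τ, (w (curve f z r) * mixedDeriv l g (curve f z r) -
        w (curve f z r) * S (curve f z r))) +
      ∫ r in (0 : ℝ)..τ, (w (curve f z r) * S (curve f z r) -
        w (curve f z r) * mixedDeriv l f (curve f z r)) := by
    rw [← intervalIntegral.integral_add ((hcont hgc).sub hSi) (hSi.sub (hcont hfc))]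
    congr 1; ext r; ring
  change |∫ r in (0 : ℝ)..τ, w (curve f z r) *
      (mixedDeriv l g (curve f z r) - mixedDeriv l f (curve f z r))| ≤ _
  rw [e]
  refine (abs_add_le _ _).trans ((add_le_add hdev hbias).trans ?_)
  rw [sub_zero]
  have hr := arcRate_nonneg h n
  calc _ ≤ M * arcRate h n + 8 * Bf * (C * arcRate h n) * a := by gcongr
    _ = _ := by ring

theorem whp_integral_d2_le [IsProbabilityMeasure μ] (hX : IsSample μ X f)
    (hF1 : SmoothDensity f) (hF2 : RegularRegion f H)
    (hF3 : CompactFilament f H L a) (hF4 : MeanVelocityBound f L a) (hK1 : KernelRegular K)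
    (hh : BandwidthRates h) :
    ∃ M > 0, WithHighProb μ fun n ω => ∀ z ∈ L, ∀ τ, |τ| ≤ a → ∀ k i : Fin 3,
      |∫ r in (0 : ℝ)..τ, eigWeight k (d2 f (curve f z r)) *
        (d2 (kde K n (h n) fun i => X i ω) (curve f z r) i - d2 f (curve f z r) i)| ≤
        M * arcRate h n := by
  have hone : ∀ q : Fin 3 × Fin 3, ∃ M > 0, WithHighProb μ fun n ω => ∀ z ∈ L, ∀ τ, |τ| ≤ a →
      |∫ r in (0 : ℝ)..τ, eigWeight q.1 (d2 f (curve f z r)) *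
        (d2 (kde K n (h n) fun i => X i ω) (curve f z r) q.2 - d2 f (curve f z r) q.2)| ≤
        M * arcRate h n := by
    rintro ⟨k, i⟩
    obtain ⟨l, hl, he⟩ := exists_d2_eq_mixedDeriv i
    simp_rw [he]
    exact whp_integral_arc_le hX hF1 hF2 hF3 hF4 hK1 hh hl k
  choose M hM hwhp using hone
  obtain ⟨M', hM'⟩ := (Set.finite_range M).bddAbove
  refine ⟨max M' 1, by positivity, (WithHighProb.forall_finite hwhp).mono
    (Eventually.of_forall fun n ω hω z hz τ hτ k i => (hω (k, i) z hz τ hτ).trans ?_)⟩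
  have h1 : M (k, i) ≤ max M' 1 := (hM' ⟨_, rfl⟩).trans (le_max_left _ _)
  have h2 := arcRate_nonneg h n
  gcongr

end

/-! ### Assembling the bound -/

section

variable {Ω : Type*} [MeasurableSpace Ω] {μ : Measure Ω} {X : ℕ → Ω → E2} {f K : E2 → ℝ}
  {h : ℕ → ℝ} {B BK : ℝ} {H L : Set E2} {a : ℝ}

theorem BandwidthRates.tendsto_unifRate (hh : BandwidthRates h) :
    Tendsto (unifRate h) atTop (𝓝 0) := by
  have h1 : Tendsto (fun n => h n ^ 2) atTop (𝓝 0) := by simpa using hh.2.1.pow 2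
  have h2 : Tendsto (fun n => √(h n ^ 2)) atTop (𝓝 0) := by simpa using h1.sqrt
  have h3 : Tendsto (fun n : ℕ => √(Real.log n / (n * h n ^ 6))) atTop (𝓝 0) := by
    refine squeeze_zero' (Eventually.of_forall fun _ => Real.sqrt_nonneg _) ?_ h2
    filter_upwards [hh.eventually_log_le_pow 1 zero_le_one (k := 8) le_rfl,
      eventually_ge_atTop 1] with n h4 h5
    have hpos := hh.1 n
    have hn : (0 : ℝ) < n := by exact_mod_cast h5
    refine Real.sqrt_le_sqrt ?_
    rw [div_le_iff₀ (by positivity)]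
    linarith [show h n ^ 2 * (n * h n ^ 6) = n * h n ^ 8 by ring]
  rw [← add_zero (0 : ℝ)]
  exact h3.add h1

/-- The inequality log n / (n h⁶) ≤ √(log n / (n h⁵)) amounts to log n ≤ n h⁷; the bias part h⁴ is
at most h². -/
theorem BandwidthRates.exists_unifRate_sq_le (hh : BandwidthRates h) :
    ∃ C > 0, ∀ᶠ n in atTop, unifRate h n ^ 2 ≤ C * arcRate h n := by
  obtain ⟨C, hC, hCev⟩ := hh.exists_sq_le_arcRate
  refine ⟨2 + 2 * C, by positivity, ?_⟩
  filter_upwards [hCev, hh.eventually_le_one, eventually_one_le_log, eventually_ge_atTop 1,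
    hh.eventually_log_le_pow 1 zero_le_one (k := 7) (by norm_num)] with n h1 h2 h3 h4 h5
  have hpos := hh.1 n
  have hn : (0 : ℝ) < n := by exact_mod_cast h4
  have hq0 : 0 ≤ Real.log n / (n * h n ^ 6) := by positivity
  have h6 : √(Real.log n / (n * h n ^ 6)) ^ 2 ≤ arcRate h n := by
    rw [Real.sq_sqrt hq0, arcRate]
    refine Real.le_sqrt_of_sq_le ?_
    rw [div_pow, div_le_div_iff₀ (by positivity) (by positivity)]
    calc Real.log n ^ 2 * (n * h n ^ 5) = Real.log n * (n * h n ^ 5) * (1 * Real.log n) := by ring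
      _ ≤ Real.log n * (n * h n ^ 5) * (n * h n ^ 7) := by gcongr
      _ = _ := by ring
  have h7 : (h n ^ 2) ^ 2 ≤ C * arcRate h n := by
    refine le_trans ?_ h1
    have : h n ^ 2 ≤ 1 := pow_le_one₀ hpos.le h2
    nlinarith [sq_nonneg (h n)]
  rw [unifRate]
  nlinarith [sq_nonneg (√(Real.log n / (n * h n ^ 6)) - h n ^ 2)]

/-- The bound depends on n and η and is useless as a rate; it only secures global existence and
uniqueness of the estimator's integral curves, for every sample. -/
theorem KernelBound.exists_flowRegular_kde (hK : KernelBound K BK) (n : ℕ) {η : ℝ} (hη : 0 < η)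
    (x : ℕ → E2) : ∃ B, FlowRegular (kde K n η x) B := by
  have hB := hK.pos
  set D := 1 + η⁻¹ with hD
  have hD1 : 1 ≤ D := by have := inv_pos.mpr hη; linarith
  have hle : ∀ l : List (Fin 2), l.length ≤ 3 → η⁻¹ ^ (2 + l.length) ≤ D ^ 5 := fun l hl =>
    (pow_le_pow_left₀ (by positivity) (by linarith) _).trans (pow_le_pow_right₀ hD1 (by omega))
  refine ⟨D ^ 5 * BK, hK.diff.kde n η x, by positivity, fun l _ hl z => ?_⟩
  rw [mixedDeriv_kde hK.diff n η x l (by omega), abs_mul, abs_of_nonneg (by positivity)]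
  have hsum : |∑ i ∈ Finset.range n, η⁻¹ ^ (2 + l.length) * mixedDeriv l K (η⁻¹ • (z - x i))| ≤
      n * (D ^ 5 * BK) := by
    refine (Finset.abs_sum_le_sum_abs _ _).trans ?_
    refine (Finset.sum_le_card_nsmul _ _ (D ^ 5 * BK) fun i _ => ?_).trans (by simp)
    rw [abs_mul, abs_of_nonneg (by positivity)]
    have h1 := hle l hl
    have h2 := hK.bound l (by omega) (η⁻¹ • (z - x i))
    gcongr
  rcases Nat.eq_zero_or_pos n with rfl | hn
  · simp; positivity
  · have hn' : (0 : ℝ) < n := by exact_mod_cast hn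
    calc 1 / (n : ℝ) * _ ≤ 1 / (n : ℝ) * (n * (D ^ 5 * BK)) := by gcongr
      _ = _ := by field_simp

theorem WithHighProb.isBigOInProb {Y : ℕ → Ω → ℝ≥0∞} {r : ℕ → ℝ} {M : ℝ} (hM : 0 < M)
    (h : WithHighProb μ fun n ω => Y n ω ≤ ENNReal.ofReal (M * r n)) : IsBigOInProb μ Y r := by
  intro ε hε
  refine ⟨M, hM, ?_⟩
  have := h.eventually_le_const (show (0 : ℝ≥0∞) < ENNReal.ofReal ε by simpa using hε)
  simpa only [not_le] using this

theorem whp_filament_deviation_le [IsProbabilityMeasure μ] (hX : IsSample μ X f)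
    (hF1 : SmoothDensity f) (hF2 : RegularRegion f H) (hF3 : CompactFilament f H L a)
    (hF4 : MeanVelocityBound f L a) (hF5 : TransversalOn f L)
    (hF6 : NoDegeneratePoint f (H ∪ searchedArcs f L a)) (hK1 : KernelRegular K)
    (hh : BandwidthRates h) :
    ∃ M > 0, WithHighProb μ fun n ω => ∀ x₀ ∈ startSet f L a, ∀ t,
      IsArgminOrZero (filTimes (kde K n (h n) fun i => X i ω) x₀) t →
      ‖(curve (kde K n (h n) fun i => X i ω) x₀ t - curve f x₀ (theta f x₀)) -
        (t - theta f x₀) • eigField f (curve f x₀ (theta f x₀))‖ ≤ M * arcRate h n := by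
  obtain ⟨B, hf⟩ := hF1.exists_flowRegular
  obtain ⟨BK, hK⟩ := hK1.exists_kernelBound
  have ha := hF3.1
  obtain ⟨R, hR, hdev⟩ := filament_deviation_le hf hF1 hF2 hF3 hF5 hF6
  obtain ⟨R', hR'⟩ := exists_norm_startSet_le hf hF3.2.1 a
  obtain ⟨σ, hσ, hgap⟩ := exists_le_eigGap hf hF2 hF3
  -- The ball must contain both the region where the curves are compared and the set of starting
  -- points, on which the field is linearized.
  obtain ⟨M₁, hM₁, hwhp₁⟩ := whp_mixedDeriv_kde_sub_le hX hF1 hK1 hh (max R R')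
  obtain ⟨M₂, hM₂, hwhp₂⟩ := whp_third_mixedDeriv_kde_le hX hF1 hK1 hh R
  obtain ⟨M₃, hM₃, hwhp₃⟩ := whp_integral_d2_le hX hF1 hF2 hF3 hF4 hK1 hh
  -- M₂ depends on R, so the deterministic bound can be specialized only now.
  obtain ⟨δ₀, hδ₀, C, hC, hdev⟩ := hdev M₂ hM₂
  obtain ⟨C', hC', hsq⟩ := hh.exists_unifRate_sq_le
  have hsmall : ∀ᶠ n in atTop, M₁ * unifRate h n ≤ δ₀ := by
    have := hh.tendsto_unifRate.const_mul M₁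
    rw [mul_zero] at this
    exact this.eventually_le_const hδ₀
  refine ⟨C * (36 * M₃ + 24 * (M₁ ^ 2 * C') / σ * a + M₁ ^ 2 * C'), by positivity,
    ((hwhp₁.and hwhp₂).and hwhp₃).mono ?_⟩
  filter_upwards [hsq, hsmall] with n hn hδ ω ⟨⟨h1, h2⟩, h3⟩ x₀ hx₀ t ht
  obtain ⟨Bg, hg⟩ := hK.exists_flowRegular_kde n (hh.1 n) fun i => X i ω
  set g := kde K n (h n) fun i => X i ω with hgdef
  have hr := arcRate_nonneg h n
  have hδsq : (M₁ * unifRate h n) ^ 2 ≤ M₁ ^ 2 * C' * arcRate h n := by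
    rw [mul_pow, mul_assoc]; gcongr
  refine (hdev g Bg hg (M₁ * unifRate h n) hδ
    (36 * (M₃ * arcRate h n) + 24 * (M₁ * unifRate h n) ^ 2 / σ * a)
    (fun l _ hl x hx => h1 l hl x (hx.trans (le_max_left _ _))) h2
    (fun z hz τ hτ => ?_) x₀ hx₀ t ht).trans ?_
  · have hc := hf.continuous_curve z
    have hmem : ∀ r ∈ Set.uIoc 0 τ, curve f z r ∈ startSet f L a := fun r hr =>
      curve_mem_startSet hz (uIoc_zero_subset hτ hr)
    refine (norm_integral_eigG_sub_le (p := fun r => d2 f (curve f z r))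
      (q := fun r => d2 g (curve f z r)) (hf.diff.continuous_d2.comp hc)
      (hg.diff.continuous_d2.comp hc) hσ (fun r hr => hgap _ (hmem r hr))
      (fun r hr i => abs_d2_diff_le (fun l hl => h1 l hl.le _
        ((hR' _ (hmem r hr)).trans (le_max_right _ _))) i)
      (fun k i => h3 z hz τ hτ k i)).trans ?_
    gcongr
  · calc C * (36 * (M₃ * arcRate h n) + 24 * (M₁ * unifRate h n) ^ 2 / σ * a +
          (M₁ * unifRate h n) ^ 2)
        ≤ C * (36 * (M₃ * arcRate h n) + 24 * (M₁ ^ 2 * C' * arcRate h n) / σ * a +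
          M₁ ^ 2 * C' * arcRate h n) := by gcongr
      _ = _ := by ring

end

end Filament

end

theorem theorem3p4 {Ω : Type*} [MeasurableSpace Ω] (μ : Measure Ω) [IsProbabilityMeasure μ]
    (f K : Filament.E2 → ℝ) (H L : Set Filament.E2) (a : ℝ) (h : ℕ → ℝ)
    (X : ℕ → Ω → Filament.E2) (fhat : ℕ → Ω → Filament.E2 → ℝ)
    (thetaHat : ℕ → Ω → Filament.E2 → ℝ)
    (hF1 : Filament.SmoothDensity f)
    (hF2 : Filament.RegularRegion f H)
    (hF3 : Filament.CompactFilament f H L a)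
    (hF4 : Filament.MeanVelocityBound f L a)
    (hF5 : Filament.TransversalOn f L)
    (hF6 : Filament.NoDegeneratePoint f (H ∪ Filament.searchedArcs f L a))
    (hK1 : Filament.KernelRegular K)
    (hK2 : Filament.KernelSquareIntegrable K)
    (hH1 : Filament.BandwidthRates h)
    (hX : Filament.IsSample μ X f)
    (hfhat : ∀ n ω, fhat n ω = Filament.kde K n (h n) (fun i => X i ω))
    (hthetaHat : ∀ n ω, ∀ x₀ ∈ Filament.startSet f L a,
      Filament.IsArgminOrZero (Filament.filTimes (fhat n ω) x₀) (thetaHat n ω x₀)) :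
    Filament.IsBigOInProb μ
      (fun n ω => ⨆ x₀ ∈ Filament.startSet f L a,
        ‖(Filament.curve (fhat n ω) x₀ (thetaHat n ω x₀)
            - Filament.curve f x₀ (Filament.theta f x₀))
          - (thetaHat n ω x₀ - Filament.theta f x₀) •
              Filament.eigField f (Filament.curve f x₀ (Filament.theta f x₀))‖ₑ)
      (fun n => √(Real.log n / ((n : ℝ) * h n ^ 5))) := by
  obtain ⟨M, hM, hwhp⟩ := Filament.whp_filament_deviation_le hX hF1 hF2 hF3 hF4 hF5 hF6 hK1 hH1
  -- On one event the bound holds for all starting points and all admissible times at once, so the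
  -- choice of `thetaHat` needs no measurability.
  refine Filament.WithHighProb.isBigOInProb hM
    (hwhp.mono (Eventually.of_forall fun n ω hω => iSup₂_le fun x₀ hx₀ => ?_))
  have ht := hthetaHat n ω x₀ hx₀
  rw [hfhat] at ht ⊢
  rw [← ofReal_norm]
  exact ENNReal.ofReal_le_ofReal (hω x₀ hx₀ _ ht)
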